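/- **Setting.** Consider an episodic multi-objective Markov decision process with finite state space $\mathcal S$, finite nonempty action space $\mathcal A$, horizon $H\ge 1$, $m\ge 1$ objectives, a fixed initial state $s_1$, transition probabilities $\mathbb P_h(s'\mid s,a)$ and reward functions $r_{i,h}(s,a)\in[0,1]$ ($i\in[m]$, $h\in[H]$), all unknown to the learner. Whenever action $a$ is taken in state $s$ at step $h$, a random reward vector in $[0,1]^m$ with mean $(r_{1,h}(s,a),\dots,r_{m,h}(s,a))$ is observed. Let $\Pi$ be the set of stochastic policies $\pi=(\pi_h(\cdot\mid s))_{h,s}$, let $V_{i,1}^\pi(s_1)=\mathbb E[\sum_{h=1}^H r_{i,h}(s_h,a_h)\mid s_1,\pi,\mathbb P]$, and let $V_{i,1}^*(s_1)=\max_{\pi\in\Pi}V_{i,1}^\pi(s_1)$. For $\lambda$ in the probability simplex $\Delta_m$, a regularizer $0<\iota\le 1$ and a smoothing parameter $\mu>0$ put $$\mathrm{STCH}_{\mu,\lambda}(\pi)=\mu\log\sum_{i=1}^m\exp\Big(\frac{\lambda_i\,(V_{i,1}^*(s_1)+\iota-V_{i,1}^\pi(s_1))}{\mu}\Big).$$ **Algorithm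 STchRL** (inputs $T\ge1$, $\delta\in(0,1)$, $\lambda,\iota,\mu$, step sizes $\eta_t$, mixing rates $\alpha_t$). Start with $w_i^0=1/m$, $V_{i,1}^0=\tilde V_{i,1}^0=0$ and empty datasets $\mathcal D,\tilde{\mathcal D}_1,\dots,\tilde{\mathcal D}_m$. In round $t=1,\dots,T$: 1. Set $\tilde w_i^{t-1}=(1-\alpha_{t-1})w_i^{t-1}+\alpha_{t-1}/m$, and let $w^t\in\Delta_m$ satisfy $w_i^t\propto(\tilde w_i^{t-1})^{1-\mu\eta_{t-1}}\exp\{\eta_{t-1}\lambda_i(\tilde V_{i,1}^{t-1}(s_1)+\iota-V_{i,1}^{t-1}(s_1))\}$. 2. For $h=H,\dots,1$, starting from $V^t_{i,H+1}=\tilde V^t_{i,H+1}=0$, let $Q_{i,h}^t$ be the optimistic Q-function (defined below) built from $\mathcal D$ and $V_{i,h+1}^t$, and let $\tilde Q_{i,h}^t$ be the one built from $\tilde{\mathcal D}_i$ and $\tilde V_{i,h+1}^t$. Let $\tilde\nu_{i,h}^t(\cdot\mid s)$ maximize $p\mapsto\sum_a\tilde Q_{i,h}^t(s,a)p(a)$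 and let $\pi_h^t(\cdot\mid s)$ maximize $p\mapsto\sum_a\big(\sum_i w_i^t\lambda_iQ_{i,h}^t(s,a)\big)p(a)$ over probability vectors $p$ on $\mathcal A$, ties being broken by any measurable rule that may depend on the past observations. Put $V_{i,h}^t(s)=\sum_aQ_{i,h}^t(s,a)\pi_h^t(a\mid s)$ and $\tilde V_{i,h}^t(s)=\sum_a\tilde Q_{i,h}^t(s,a)\tilde\nu_{i,h}^t(a\mid s)$. 3. Given the past, run independently one episode with $\pi^t$, appended to $\mathcal D$, and for each $i$ one episode with $\tilde\nu_i^t$, appended to $\tilde{\mathcal D}_i$. The optimistic Q-function built from a dataset and $V:\mathcal S\to\mathbb R$ for objective $i$ at step $h$ is $$Q(s,a)=\min\Big\{\max\Big\{\hat r(s,a)+\sum_{s'}\hat{\mathbb P}(s'\mid s,a)V(s')+\Phi(s,a)+\Psi(s,a),\,0\Big\},\,H-h+1\Big\}.$$ Here $N(s,a)$ and $N(s,a,s')$ are the numbers of visits to $(s,a)$ and of transitions from $(s,a)$ to $s'$ at step $h$ in the dataset, and $\bar N=\max\{N(s,a),1\}$. Further, $\hat r(s,a)$ is the sum of the rewards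 for objective $i$ observed at $(s,a)$ at step $h$, divided by $\bar N$; $\hat{\mathbb P}(s'\mid s,a)=N(s,a,s')/\bar N$; and, with $\ell=\log(8m|\mathcal S||\mathcal A|HT/\delta)$, $\Psi=\min\{\sqrt{2\ell/\bar N},1\}$ and $\Phi=\min\{\sqrt{2H^2|\mathcal S|\ell/\bar N},H\}$. **Theorem.** There is a universal constant $C>0$ such that the following holds for all data as above. Let $\eta_0=\alpha_0=0$, and $\eta_t=1/(\mu t)$, $\alpha_t=1/t^2$ for $t\ge1$. Let $\hat\pi$ be the mixture of $\pi^1,\dots,\pi^T$ (one of these policies is selected uniformly at random beforehand and then followed), and let $\pi^*_{\mu,\lambda}\in\arg\min_{\pi\in\Pi}\mathrm{STCH}_{\mu,\lambda}(\pi)$. Then, with probability at least $1-\delta$, $$\mathrm{STCH}_{\mu,\lambda}(\hat\pi)-\mathrm{STCH}_{\mu,\lambda}(\pi^*_{\mu,\lambda})\le C\left(\frac{H^2\log T}{\mu T}+\frac{\mu\log^3(mT)}{T}+\sqrt{\frac{H^4|\mathcal S|^2|\mathcal A|\,\varrho}{T}}\right),\qquad \varrho=\log\frac{m|\mathcal S||\mathcal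 A|HT}{\delta}.$$ -/

import Mathlib

open MeasureTheory

universe u v

namespace MORL

/-- A (Markov, stochastic) policy: a probability vector on the actions for every step and state.
Steps are numbered `0, …, H - 1`. -/
abbrev Policy (S A : Type*) [Fintype A] (H : ℕ) : Type _ :=
  Fin H → S → stdSimplex ℝ A

/-- What is recorded at one step of an episode: `(s_h, a_h, (r_{1,h}, …, r_{m,h}), s_{h+1})`. -/
abbrev Step (S A : Type*) (m : ℕ) : Type _ :=
  S × A × (Fin m → ℝ) × S

/-- The record of one episode of length `H`. -/
abbrev Traj (S A : Type*) (H m : ℕ) : Type _ :=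
  Fin H → Step S A m

/-- The record of one round of the online interaction: the episode of the main policy and the
episodes of the `m` auxiliary policies. -/
abbrev Round (S A : Type*) (H m : ℕ) : Type _ :=
  Traj S A H m × (Fin m → Traj S A H m)

/-- An episodic multi-objective Markov decision process with finite state and action spaces,
horizon `H` and `m` objectives.  Observed rewards are random, with values in `[0,1]` and with
expectation the reward function `r`. -/
structure MOMDP (S A : Type*) [Fintype S] (H m : ℕ) where
  /-- the fixed initial state -/
  init : S
  /-- `trans h s a s'` is the probability of moving from `s` to `s'` under action `a` at step `h` -/
  trans : Fin H → S → A → stdSimplex ℝ S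
  /-- the expected reward of each objective -/
  r : Fin m → Fin H → S → A → ℝ
  /-- the law of the observed reward vector -/
  rewardLaw : Fin H → S → A → Measure (Fin m → ℝ)
  isProbabilityMeasure_rewardLaw : ∀ h s a, IsProbabilityMeasure (rewardLaw h s a)
  rewardLaw_mem : ∀ h s a, ∀ᵐ x ∂(rewardLaw h s a), ∀ i, x i ∈ Set.Icc (0 : ℝ) 1
  rewardLaw_mean : ∀ i h s a, ∫ x, x i ∂(rewardLaw h s a) = r i h s a

/-- The law of the record of `n` consecutive steps started at the state `s`, when actions are
drawn from `π`, next states from `P` and reward vectors from `R`. -/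
noncomputable def rollout {S A : Type*} [Fintype S] [Fintype A] [MeasurableSpace S]
    [MeasurableSpace A] {m : ℕ} :
    (n : ℕ) → (Fin n → S → stdSimplex ℝ A) → (Fin n → S → A → stdSimplex ℝ S) →
      (Fin n → S → A → Measure (Fin m → ℝ)) → S → Measure (Fin n → Step S A m)
  | 0, _, _, _, _ => Measure.dirac Fin.elim0
  | n + 1, π, P, R, s =>
      ∑ a : A, ∑ s' : S,
        ENNReal.ofReal ((π 0 s : A → ℝ) a * (P 0 s a : S → ℝ) s') •
          ((R 0 s a).prod
            (rollout n (fun h => π h.succ) (fun h => P h.succ) (fun h => R h.succ) s')).map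
            (fun x => (Fin.cons (s, a, x.1, s') x.2 : Fin (n + 1) → Step S A m))

section Model

variable {S A : Type*} [Fintype S] [Fintype A] [MeasurableSpace S] [MeasurableSpace A] {H m : ℕ}

/-- The law of an episode when `π` is followed from the initial state. -/
noncomputable def MOMDP.episode (M : MOMDP S A H m) (π : Policy S A H) :
    Measure (Traj S A H m) :=
  rollout H π M.trans M.rewardLaw M.init

/-- The law of an episode under the mixture of `π^1, …, π^T`: a policy is selected uniformly at
random beforehand and followed throughout the episode. -/
noncomputable def MOMDP.mixEpisode (M : MOMDP S A H m) {T : ℕ} (π : Fin T → Policy S A H) :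
    Measure (Traj S A H m) :=
  (T : ENNReal)⁻¹ • ∑ t, M.episode (π t)

/-- The expected total reward `𝔼[∑_h r_{i,h}(s_h, a_h)]` of each objective under a given law of
episodes. -/
noncomputable def MOMDP.valueUnder (M : MOMDP S A H m) (ρ : Measure (Traj S A H m)) (i : Fin m) :
    ℝ :=
  ∫ τ, ∑ h : Fin H, M.r i h (τ h).1 (τ h).2.1 ∂ρ

/-- The value `V_{i,1}^π(s_1)` of a policy for each objective. -/
noncomputable def MOMDP.value (M : MOMDP S A H m) (π : Policy S A H) (i : Fin m) : ℝ :=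
  M.valueUnder (M.episode π) i

/-- The value of the uniform mixture of finitely many policies for each objective. -/
noncomputable def MOMDP.mixValue (M : MOMDP S A H m) {T : ℕ} (π : Fin T → Policy S A H)
    (i : Fin m) : ℝ :=
  M.valueUnder (M.mixEpisode π) i

/-- The largest value `V_{i,1}^*(s_1)` over all policies of each objective. -/
noncomputable def MOMDP.optValue (M : MOMDP S A H m) (i : Fin m) : ℝ :=
  ⨆ π : Policy S A H, M.value π i

/-- Smooth Tchebycheff scalarization of a vector `v` of values, one for each objective. -/
noncomputable def MOMDP.stch (M : MOMDP S A H m) (lam : stdSimplex ℝ (Fin m)) (ι μ : ℝ)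
    (v : Fin m → ℝ) : ℝ :=
  μ * Real.log (∑ i, Real.exp ((lam : Fin m → ℝ) i * (M.optValue i + ι - v i) / μ))

end Model

section Estimation

variable {S A : Type*} [Fintype S] [Fintype A] [DecidableEq S] [DecidableEq A] {H m n : ℕ}

/-- Number of visits to `(s, a)` at step `h` in a dataset of `n` episodes. -/
def visits (D : Fin n → Traj S A H m) (h : Fin H) (s : S) (a : A) : ℕ :=
  (Finset.univ.filter fun τ : Fin n => (D τ h).1 = s ∧ (D τ h).2.1 = a).card

/-- Number of transitions from `(s, a)` to `s'` at step `h` in a dataset of `n` episodes. -/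
def transitions (D : Fin n → Traj S A H m) (h : Fin H) (s : S) (a : A) (s' : S) : ℕ :=
  (Finset.univ.filter fun τ : Fin n =>
    (D τ h).1 = s ∧ (D τ h).2.1 = a ∧ (D τ h).2.2.2 = s').card

/-- Empirical reward of objective `i`. -/
noncomputable def rewardEst (D : Fin n → Traj S A H m) (i : Fin m) (h : Fin H) (s : S) (a : A) :
    ℝ :=
  (∑ τ : Fin n, if (D τ h).1 = s ∧ (D τ h).2.1 = a then (D τ h).2.2.1 i else 0) /
    max (visits D h s a : ℝ) 1

/-- Empirical transition probability. -/
noncomputable def transEst (D : Fin n → Traj S A H m) (h : Fin H) (s : S) (a : A) (s' : S) : ℝ :=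
  (transitions D h s a s' : ℝ) / max (visits D h s a : ℝ) 1

/-- The logarithmic factor `log (8 m |S| |A| H T / δ)` of the bonuses. -/
noncomputable def bonusLog (S A : Type*) [Fintype S] [Fintype A] (H m T : ℕ) (δ : ℝ) : ℝ :=
  Real.log (8 * m * Fintype.card S * Fintype.card A * H * T / δ)

/-- Reward bonus. -/
noncomputable def rewardBonus (T : ℕ) (δ : ℝ) (D : Fin n → Traj S A H m) (h : Fin H) (s : S)
    (a : A) : ℝ :=
  min (Real.sqrt (2 * bonusLog S A H m T δ / max (visits D h s a : ℝ) 1)) 1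

/-- Transition bonus. -/
noncomputable def transBonus (T : ℕ) (δ : ℝ) (D : Fin n → Traj S A H m) (h : Fin H) (s : S)
    (a : A) : ℝ :=
  min (Real.sqrt (2 * (H : ℝ) ^ 2 * Fintype.card S * bonusLog S A H m T δ /
    max (visits D h s a : ℝ) 1)) H

/-- The optimistic Q-function built from a dataset and a value function for the next step,
truncated to `[0, H - h]` (with `h` counted from `0`). -/
noncomputable def optQ (T : ℕ) (δ : ℝ) (D : Fin n → Traj S A H m) (i : Fin m) (h : Fin H)
    (V : S → ℝ) (s : S) (a : A) : ℝ :=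
  max 0 (min (rewardEst D i h s a + ∑ s', transEst D h s a s' * V s' +
    transBonus T δ D h s a + rewardBonus T δ D h s a) ((H : ℝ) - (h : ℕ)))

/-- The optimistic value function at step `h` obtained backwards from the zero function after the
last step: `V_h(s) = ⟨Q_h(s, ·), π_h(·|s)⟩` with `Q_h` the optimistic Q-function for `V_{h+1}`. -/
noncomputable def optV (T : ℕ) (δ : ℝ) (D : Fin n → Traj S A H m) (i : Fin m)
    (π : Policy S A H) (h : ℕ) (s : S) : ℝ :=
  if hh : h < H then
    ∑ a, optQ T δ D i ⟨h, hh⟩ (optV T δ D i π (h + 1)) s a * (π ⟨h, hh⟩ s : A → ℝ) a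
  else 0
termination_by H - h

/-- The optimistic Q-function at step `h` in the backward recursion along `π`. -/
noncomputable def estQ (T : ℕ) (δ : ℝ) (D : Fin n → Traj S A H m) (i : Fin m)
    (π : Policy S A H) (h : Fin H) (s : S) (a : A) : ℝ :=
  optQ T δ D i h (optV T δ D i π (h + 1)) s a

end Estimation

section Weights

variable {m : ℕ}

/-- Mixing with the uniform weights. -/
noncomputable def mixWeights (α : ℝ) (w : Fin m → ℝ) (i : Fin m) : ℝ :=
  (1 - α) * w i + α / m

/-- The mirror ascent step: weights proportional to
`w_i ^ (1 - μ η) * exp (η * λ_i * g_i)`. -/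
noncomputable def ascend (μ η : ℝ) (lam : Fin m → ℝ) (w g : Fin m → ℝ) (i : Fin m) : ℝ :=
  w i ^ (1 - μ * η) * Real.exp (η * (lam i * g i)) /
    ∑ j, w j ^ (1 - μ * η) * Real.exp (η * (lam j * g j))

end Weights

/-- The policies played by a learner.  In round `n + 1`, having seen the records of the first `n`
rounds, it plays one main policy and `m` auxiliary policies.  -/
structure Learner (S A : Type*) [Fintype A] (H m : ℕ) where
  main : (n : ℕ) → (Fin n → Round S A H m) → Policy S A H
  aux : (n : ℕ) → (Fin n → Round S A H m) → Fin m → Policy S A H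

section Interaction

variable {S A : Type*} [Fintype S] [Fintype A] {H m : ℕ}

/-- The law of the records of the first `n` rounds: in every round, given the past, the `m + 1`
episodes are drawn independently, following the current main and auxiliary policies. -/
noncomputable def Learner.run [MeasurableSpace S] [MeasurableSpace A] (L : Learner S A H m)
    (M : MOMDP S A H m) : (n : ℕ) → Measure (Fin n → Round S A H m)
  | 0 => Measure.dirac Fin.elim0
  | n + 1 => (L.run M n).bind fun past =>
      ((M.episode (L.main n past)).prod
        (Measure.pi fun i => M.episode (L.aux n past i))).map
        (fun x => (Fin.snoc past x : Fin (n + 1) → Round S A H m))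

/-- The main policy played in round `t + 1`, as a function of the records of `T` rounds. -/
def Learner.played (L : Learner S A H m) {T : ℕ} (rec : Fin T → Round S A H m) (t : Fin T) :
    Policy S A H :=
  L.main t fun j => rec (Fin.castLE t.isLt.le j)

variable [DecidableEq S] [DecidableEq A]

/-- Optimistic value of the main policy in round `n + 1` at the initial state. -/
noncomputable def Learner.mainV (L : Learner S A H m) (s₁ : S) (T : ℕ) (δ : ℝ) (n : ℕ)
    (past : Fin n → Round S A H m) (i : Fin m) : ℝ :=
  optV T δ (fun τ => (past τ).1) i (L.main n past) 0 s₁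

/-- Optimistic value of the `i`-th auxiliary policy in round `n + 1` at the initial state. -/
noncomputable def Learner.auxV (L : Learner S A H m) (s₁ : S) (T : ℕ) (δ : ℝ) (n : ℕ)
    (past : Fin n → Round S A H m) (i : Fin m) : ℝ :=
  optV T δ (fun τ => (past τ).2 i) i (L.aux n past i) 0 s₁

/-- The weights `w^{n+1}` of round `n + 1`, computed from `w^n` and from the optimistic values of
round `n`; initially `w^0 = 1/m` and the optimistic values of round `0` are zero. -/
noncomputable def Learner.weights (L : Learner S A H m) (s₁ : S) (T : ℕ) (δ : ℝ)
    (lam : Fin m → ℝ) (ι μ : ℝ) (η α : ℕ → ℝ) :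
    (n : ℕ) → (Fin n → Round S A H m) → Fin m → ℝ
  | 0, _ => ascend μ (η 0) lam (mixWeights (α 0) fun _ => 1 / (m : ℝ)) fun _ => 0 + ι - 0
  | n + 1, past =>
      ascend μ (η (n + 1)) lam
        (mixWeights (α (n + 1)) (L.weights s₁ T δ lam ι μ η α n (Fin.init past)))
        (fun i => L.auxV s₁ T δ n (Fin.init past) i + ι - L.mainV s₁ T δ n (Fin.init past) i)

/-- The learner runs STchRL (for `T` rounds, confidence `δ`, preference `lam`, regularizer `ι`,
smoothing `μ`, step sizes `η` and mixing rates `α`): its policies depend measurably on the past,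
every auxiliary policy is greedy for the optimistic Q-function of its objective, and the main
policy is greedy for the combination of the optimistic Q-functions with coefficients
`w_i^t λ_i`.  Ties may be broken in any way. -/
structure Learner.IsSTchRL [MeasurableSpace S] [MeasurableSpace A] (L : Learner S A H m)
    (s₁ : S) (T : ℕ) (δ : ℝ) (lam : Fin m → ℝ) (ι μ : ℝ) (η α : ℕ → ℝ) : Prop where
  measurable_main : ∀ n, Measurable (L.main n)
  measurable_aux : ∀ n, Measurable (L.aux n)
  aux_greedy : ∀ (n : ℕ) (past : Fin n → Round S A H m) (i : Fin m) (h : Fin H) (s : S)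
    (p : stdSimplex ℝ A),
    ∑ a, estQ T δ (fun τ => (past τ).2 i) i (L.aux n past i) h s a * (p : A → ℝ) a ≤
      ∑ a, estQ T δ (fun τ => (past τ).2 i) i (L.aux n past i) h s a *
        (L.aux n past i h s : A → ℝ) a
  main_greedy : ∀ (n : ℕ) (past : Fin n → Round S A H m) (h : Fin H) (s : S)
    (p : stdSimplex ℝ A),
    ∑ a, (∑ i, L.weights s₁ T δ lam ι μ η α n past i * lam i *
        estQ T δ (fun τ => (past τ).1) i (L.main n past) h s a) * (p : A → ℝ) a ≤
      ∑ a, (∑ i, L.weights s₁ T δ lam ι μ η α n past i * lam i *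
        estQ T δ (fun τ => (past τ).1) i (L.main n past) h s a) *
        (L.main n past h s : A → ℝ) a

end Interaction

/-- The step sizes `η_0 = 0` and `η_t = 1 / (μ t)` for `t ≥ 1`. -/
noncomputable def stepSize (μ : ℝ) (t : ℕ) : ℝ :=
  if t = 0 then 0 else 1 / (μ * t)

/-- The mixing rates `α_0 = 0` and `α_t = 1 / t ^ 2` for `t ≥ 1`. -/
noncomputable def mixRate (t : ℕ) : ℝ :=
  if t = 0 then 0 else 1 / (t : ℝ) ^ 2

end MORL

open MeasureTheory ProbabilityTheory
open scoped ENNReal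

set_option linter.unusedSectionVars false

namespace MORL

/-! By the Gibbs variational principle, `STCH` at a value vector `v` is the maximum over probability
vectors `p` of `∑ p_i λ_i (V*_i + ι - v_i)` plus `μ` times the entropy of `p`
(`entReg_le_logSumExp`, with equality at the Gibbs distribution, `entReg_softmax`). Minimising
`STCH` is thus a game between policies and weights, and STchRL plays it with mirror ascent for the
weights and optimistic best responses for the policies.

Let `p` be the Gibbs distribution at the values of the mixture. For fixed `p` the payoff is affine
in the values, and the mixture's values are averages, so `T * STCH` of the mixture is the sum over
rounds of the payoff of `p`. Three comparisons follow in `stch_mixValue_sub_le`. True values are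
replaced by optimistic ones, at the price of the main estimation error. Then `p` is replaced by the
weights of the round, at the price of the regret. Finally optimism and greediness bound the payoff
of these weights by `STCH` of any competitor, at the price of the auxiliary estimation error.

Regret (`sum_entReg_sub_le`): the entropy term makes one ascent step contract the relative entropy
to any `p` by `1 - μη`. With `η_t = 1 / (μ t)` this telescopes and leaves errors of order `1 / t`.
Mixing with the uniform weights bounds the logarithms of the weights, hence the gradients, by `2 log
(mT)` up to the factor `μ`.

Estimation (`Learner.GoodRecord.sum_optV_sub_value_le`): exponential supermartingales and union
bounds make all empirical models accurate up to the bonuses. Then optimistic values exceed true ones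
by at most twice the expected bonuses collected. By Azuma-Hoeffding these are close to the realised
bonuses, and a pigeonhole argument bounds the latter. -/

lemma sum_ofReal_stdSimplex {X : Type*} [Fintype X] (p : stdSimplex ℝ X) :
    ∑ x, ENNReal.ofReal ((p : X → ℝ) x) = 1 := by
  rw [← ENNReal.ofReal_sum_of_nonneg (fun x _ => stdSimplex.zero_le p x), stdSimplex.sum_eq_one,
    ENNReal.ofReal_one]

lemma stdSimplex_sum_mul_le {X : Type*} [Fintype X] (p : stdSimplex ℝ X) {f : X → ℝ} {c : ℝ}
    (hf : ∀ x, f x ≤ c) : ∑ x, (p : X → ℝ) x * f x ≤ c := by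
  calc ∑ x, (p : X → ℝ) x * f x ≤ ∑ x, (p : X → ℝ) x * c :=
        Finset.sum_le_sum fun x _ => mul_le_mul_of_nonneg_left (hf x) (stdSimplex.zero_le p x)
    _ = c := by rw [← Finset.sum_mul, stdSimplex.sum_eq_one, one_mul]

lemma le_stdSimplex_sum_mul {X : Type*} [Fintype X] (p : stdSimplex ℝ X) {f : X → ℝ} {c : ℝ}
    (hf : ∀ x, c ≤ f x) : c ≤ ∑ x, (p : X → ℝ) x * f x := by
  calc c = ∑ x, (p : X → ℝ) x * c := by rw [← Finset.sum_mul, stdSimplex.sum_eq_one, one_mul]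
    _ ≤ ∑ x, (p : X → ℝ) x * f x :=
        Finset.sum_le_sum fun x _ => mul_le_mul_of_nonneg_left (hf x) (stdSimplex.zero_le p x)

lemma measurable_stdSimplex_apply {X : Type*} [Fintype X] (x : X) :
    Measurable fun p : stdSimplex ℝ X => (p : X → ℝ) x :=
  (measurable_pi_apply x).comp measurable_subtype_coe

lemma measurable_fin_cons {α β : Type*} [MeasurableSpace α] [MeasurableSpace β] {n : ℕ}
    {f : α → β} {g : α → Fin n → β} (hf : Measurable f) (hg : Measurable g) :
    Measurable fun x => (Fin.cons (f x) (g x) : Fin (n + 1) → β) := by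
  refine measurable_pi_lambda _ fun j => ?_
  refine Fin.cases ?_ (fun i => ?_) j
  · simpa using hf
  · simp only [Fin.cons_succ]
    exact (measurable_pi_apply i).comp hg

/-! ### Integration against the law of one episode. -/

section Rollout

variable {S : Type u} {A : Type v} [Fintype S] [Fintype A] [MeasurableSpace S] [MeasurableSpace A]
  {m : ℕ}

lemma measurable_cons_step {n : ℕ} (s : S) (a : A) (s' : S) :
    Measurable fun x : (Fin m → ℝ) × (Fin n → Step S A m) =>
      (Fin.cons (s, a, x.1, s') x.2 : Fin (n + 1) → Step S A m) :=
  measurable_fin_cons (by fun_prop) measurable_snd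

instance isProbabilityMeasure_rollout {n : ℕ} (π : Fin n → S → stdSimplex ℝ A)
    (P : Fin n → S → A → stdSimplex ℝ S) (R : Fin n → S → A → Measure (Fin m → ℝ))
    [∀ h s a, IsProbabilityMeasure (R h s a)] (s : S) :
    IsProbabilityMeasure (rollout n π P R s) := by
  induction n generalizing s with
  | zero => rw [rollout]; infer_instance
  | succ n ih =>
    refine ⟨?_⟩
    rw [rollout]
    have h : ∀ a s', (((R 0 s a).prod (rollout n (fun h => π h.succ) (fun h => P h.succ)
        (fun h => R h.succ) s')).map
          (fun x => (Fin.cons (s, a, x.1, s') x.2 : Fin (n + 1) → Step S A m))) Set.univ = 1 := by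
      intro a s'
      have := ih (fun h => π h.succ) (fun h => P h.succ) (fun h => R h.succ) s'
      rw [Measure.map_apply (measurable_cons_step s a s') MeasurableSet.univ]
      simp
    simp only [Measure.finsetSum_apply, Measure.smul_apply, smul_eq_mul, h, mul_one]
    simp_rw [ENNReal.ofReal_mul (stdSimplex.zero_le (π 0 s) _), ← Finset.mul_sum,
      sum_ofReal_stdSimplex, mul_one, sum_ofReal_stdSimplex]

lemma lintegral_rollout_succ {n : ℕ} (π : Fin (n + 1) → S → stdSimplex ℝ A)
    (P : Fin (n + 1) → S → A → stdSimplex ℝ S) (R : Fin (n + 1) → S → A → Measure (Fin m → ℝ))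
    [∀ h s a, IsProbabilityMeasure (R h s a)] (s : S) {F : (Fin (n + 1) → Step S A m) → ℝ≥0∞}
    (hF : Measurable F) :
    ∫⁻ τ, F τ ∂rollout (n + 1) π P R s =
      ∑ a, ENNReal.ofReal ((π 0 s : A → ℝ) a) * ∑ s', ENNReal.ofReal ((P 0 s a : S → ℝ) s') *
        ∫⁻ x, ∫⁻ τ, F (Fin.cons (s, a, x, s') τ) ∂rollout n (fun h => π h.succ)
          (fun h => P h.succ) (fun h => R h.succ) s' ∂(R 0 s a) := by
  rw [rollout]
  simp only [lintegral_finsetSum_measure, lintegral_smul_measure, smul_eq_mul]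
  simp_rw [ENNReal.ofReal_mul (stdSimplex.zero_le (π 0 s) _), Finset.mul_sum, mul_assoc]
  refine Finset.sum_congr rfl fun a _ => Finset.sum_congr rfl fun s' _ => ?_
  rw [lintegral_map hF (measurable_cons_step s a s')]
  congr 2
  exact lintegral_prod _ (hF.comp (measurable_cons_step s a s')).aemeasurable

lemma sum_ofReal_mul_le {X : Type*} [Fintype X] (p : stdSimplex ℝ X) {f : X → ℝ≥0∞} {c : ℝ≥0∞}
    (hf : ∀ x, f x ≤ c) : ∑ x, ENNReal.ofReal ((p : X → ℝ) x) * f x ≤ c := by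
  calc ∑ x, ENNReal.ofReal ((p : X → ℝ) x) * f x ≤ ∑ x, ENNReal.ofReal ((p : X → ℝ) x) * c :=
        Finset.sum_le_sum fun x _ => mul_le_mul_right (hf x) _
    _ = c := by rw [← Finset.sum_mul, sum_ofReal_stdSimplex, one_mul]

/-- A function of the `j`-th step has expectation at most `c` if it does so conditionally on the
state and the action. -/
lemma lintegral_rollout_step_le {n : ℕ} (π : Fin n → S → stdSimplex ℝ A)
    (P : Fin n → S → A → stdSimplex ℝ S) (R : Fin n → S → A → Measure (Fin m → ℝ))
    [∀ h s a, IsProbabilityMeasure (R h s a)] (s : S) (j : Fin n) {F : Step S A m → ℝ≥0∞}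
    (hF : Measurable F) {c : ℝ≥0∞}
    (hc : ∀ s a, ∑ s', ENNReal.ofReal ((P j s a : S → ℝ) s') * ∫⁻ x, F (s, a, x, s') ∂(R j s a) ≤ c) :
    ∫⁻ τ, F (τ j) ∂rollout n π P R s ≤ c := by
  induction n generalizing s with
  | zero => exact j.elim0
  | succ n ih =>
    rw [lintegral_rollout_succ π P R s (F := fun τ => F (τ j)) (by fun_prop)]
    refine sum_ofReal_mul_le _ fun a => ?_
    revert hc
    refine Fin.cases (fun hc => ?_) (fun i hc => ?_) j
    · simpa using hc s a
    · simp only [Fin.cons_succ]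
      refine sum_ofReal_mul_le _ fun s' => ?_
      calc _ ≤ ∫⁻ _, c ∂(R 0 s a) := lintegral_mono fun x => ih _ _ _ s' i hc
        _ = c := by simp

variable [MeasurableSingletonClass S] [MeasurableSingletonClass A]

lemma measurable_visit {n : ℕ} (f : S → A → ℝ) (j : Fin n) :
    Measurable fun τ : Fin n → Step S A m => f (τ j).1 (τ j).2.1 := by
  have h : Measurable (fun p : S × A => f p.1 p.2) := Measurable.of_discrete
  exact h.comp (by fun_prop : Measurable fun τ : Fin n → Step S A m => ((τ j).1, (τ j).2.1))

lemma integrable_sum_visit {n : ℕ} (f : Fin n → S → A → ℝ) (ν : Measure (Fin n → Step S A m))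
    [IsFiniteMeasure ν] : Integrable (fun τ => ∑ j, f j (τ j).1 (τ j).2.1) ν := by
  refine integrable_finsetSum _ fun j _ => ?_
  refine Integrable.of_bound (measurable_visit (f j) j).aestronglyMeasurable
    (∑ s, ∑ a, |f j s a|) (Filter.Eventually.of_forall fun τ => ?_)
  rw [Real.norm_eq_abs]
  calc |f j (τ j).1 (τ j).2.1| ≤ ∑ a, |f j (τ j).1 a| :=
        Finset.single_le_sum (f := fun a => |f j (τ j).1 a|) (fun _ _ => abs_nonneg _)
          (Finset.mem_univ _)
    _ ≤ _ := Finset.single_le_sum (f := fun s => ∑ a, |f j s a|)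
        (fun _ _ => Finset.sum_nonneg fun _ _ => abs_nonneg _) (Finset.mem_univ _)

lemma integral_rollout_succ {n : ℕ} (π : Fin (n + 1) → S → stdSimplex ℝ A)
    (P : Fin (n + 1) → S → A → stdSimplex ℝ S) (R : Fin (n + 1) → S → A → Measure (Fin m → ℝ))
    [∀ h s a, IsProbabilityMeasure (R h s a)] (s : S) (f : Fin (n + 1) → S → A → ℝ) :
    ∫ τ, ∑ j, f j (τ j).1 (τ j).2.1 ∂rollout (n + 1) π P R s =
      ∑ a, (f 0 s a + ∑ s', (P 0 s a : S → ℝ) s' *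
        ∫ τ, ∑ j : Fin n, f j.succ (τ j).1 (τ j).2.1 ∂rollout n (fun h => π h.succ)
          (fun h => P h.succ) (fun h => R h.succ) s') * (π 0 s : A → ℝ) a := by
  rw [rollout]
  have hint : ∀ a s', Integrable (fun τ : Fin (n + 1) → Step S A m =>
      ∑ j, f j (τ j).1 (τ j).2.1) (ENNReal.ofReal ((π 0 s : A → ℝ) a * (P 0 s a : S → ℝ) s') •
          ((R 0 s a).prod
            (rollout n (fun h => π h.succ) (fun h => P h.succ) (fun h => R h.succ) s')).map
            (fun x => (Fin.cons (s, a, x.1, s') x.2 : Fin (n + 1) → Step S A m))) := by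
    intro a s'
    refine Integrable.smul_measure ?_ ENNReal.ofReal_ne_top
    have := Measure.isProbabilityMeasure_map (μ := (R 0 s a).prod
      (rollout n (fun h => π h.succ) (fun h => P h.succ) (fun h => R h.succ) s'))
      (measurable_cons_step s a s').aemeasurable
    exact integrable_sum_visit f _
  rw [integral_finsetSum_measure fun a _ => integrable_finsetSum_measure.2 fun s' _ => hint a s']
  refine Finset.sum_congr rfl fun a _ => ?_
  rw [integral_finsetSum_measure fun s' _ => hint a s']
  have key : ∀ s', ∫ τ, ∑ j, f j (τ j).1 (τ j).2.1 ∂(ENNReal.ofReal ((π 0 s : A → ℝ) a *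
      (P 0 s a : S → ℝ) s') • ((R 0 s a).prod
            (rollout n (fun h => π h.succ) (fun h => P h.succ) (fun h => R h.succ) s')).map
            (fun x => (Fin.cons (s, a, x.1, s') x.2 : Fin (n + 1) → Step S A m))) =
      (π 0 s : A → ℝ) a * (P 0 s a : S → ℝ) s' * (f 0 s a +
        ∫ τ, ∑ j : Fin n, f j.succ (τ j).1 (τ j).2.1 ∂rollout n (fun h => π h.succ)
          (fun h => P h.succ) (fun h => R h.succ) s') := by
    intro s'
    have hm : Measurable fun τ : Fin (n + 1) → Step S A m => ∑ j, f j (τ j).1 (τ j).2.1 :=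
      Finset.measurable_fun_sum _ fun j _ => measurable_visit (f j) j
    rw [integral_smul_measure, ENNReal.toReal_ofReal (mul_nonneg (stdSimplex.zero_le _ _)
      (stdSimplex.zero_le _ _)), smul_eq_mul,
      integral_map (measurable_cons_step s a s').aemeasurable hm.aestronglyMeasurable]
    congr 1
    simp only [Fin.sum_univ_succ, Fin.cons_zero, Fin.cons_succ]
    have hi := integrable_sum_visit (fun j => f j.succ) (rollout n (fun h => π h.succ)
      (fun h => P h.succ) (fun h => R h.succ) s')
    rw [integral_add (integrable_const _) (hi.comp_snd _), integral_const,
      integral_fun_snd (μ := R 0 s a) (fun τ : Fin n → Step S A m =>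
        ∑ j : Fin n, f j.succ (τ j).1 (τ j).2.1)]
    simp
  simp_rw [key, mul_add, Finset.sum_add_distrib, mul_assoc, ← Finset.mul_sum, ← Finset.sum_mul,
    stdSimplex.sum_eq_one]
  ring

/-- `Measure.bind` in `Learner.run` integrates as an iterated integral only for measurable kernels,
so measurability in the policy has to be carried through the recursion. -/
lemma measurable_rollout {n : ℕ} (P : Fin n → S → A → stdSimplex ℝ S)
    (R : Fin n → S → A → Measure (Fin m → ℝ)) [∀ h s a, IsProbabilityMeasure (R h s a)] (s : S) :
    Measurable fun π : Fin n → S → stdSimplex ℝ A => rollout n π P R s := by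
  induction n generalizing s with
  | zero => simp only [rollout]; exact measurable_const
  | succ n ih =>
    simp only [rollout]
    refine Finset.measurable_fun_sum _ fun a _ => Finset.measurable_fun_sum _ fun s' _ => ?_
    have hcoef : Measurable fun π : Fin (n + 1) → S → stdSimplex ℝ A =>
        ENNReal.ofReal ((π 0 s : A → ℝ) a * (P 0 s a : S → ℝ) s') := by
      refine ENNReal.measurable_ofReal.comp (Measurable.mul_const ?_ _)
      exact (measurable_stdSimplex_apply a).comp
        ((measurable_pi_apply s).comp (measurable_pi_apply 0))
    have htail : Measurable fun π : Fin (n + 1) → S → stdSimplex ℝ A =>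
        rollout n (fun h => π h.succ) (fun h => P h.succ) (fun h => R h.succ) s' :=
      (ih (fun h => P h.succ) (fun h => R h.succ) s').comp
        (measurable_pi_lambda _ fun h => measurable_pi_apply h.succ)
    -- Packaged as a kernel, the tail may be multiplied with the reward law: products of Markov
    -- kernels are measurable.
    let κ : Kernel (Fin (n + 1) → S → stdSimplex ℝ A) (Fin n → Step S A m) := ⟨_, htail⟩
    have : IsMarkovKernel κ := ⟨fun π => isProbabilityMeasure_rollout _ _ _ _⟩
    have hprod : Measurable fun π : Fin (n + 1) → S → stdSimplex ℝ A => (R 0 s a).prod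
        (rollout n (fun h => π h.succ) (fun h => P h.succ) (fun h => R h.succ) s') := by
      have h := (Kernel.const (Fin (n + 1) → S → stdSimplex ℝ A) (R 0 s a) ×ₖ κ).measurable
      have e : (⇑(Kernel.const (Fin (n + 1) → S → stdSimplex ℝ A) (R 0 s a) ×ₖ κ)) =
          fun π : Fin (n + 1) → S → stdSimplex ℝ A => (R 0 s a).prod
        (rollout n (fun h => π h.succ) (fun h => P h.succ) (fun h => R h.succ) s') := by
        funext π
        rw [Kernel.prod_apply, Kernel.const_apply]
        rfl
      rwa [e] at h
    refine Measure.measurable_of_measurable_coe _ fun E hE => ?_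
    simp only [Measure.smul_apply, smul_eq_mul]
    exact hcoef.mul ((Measure.measurable_coe hE).comp
      ((Measure.measurable_map _ (measurable_cons_step s a s')).comp hprod))

end Rollout

/-! ### The law of the whole interaction. -/

lemma measurable_measurePi {α ι : Type*} [MeasurableSpace α] [Fintype ι] {β : Type*}
    [MeasurableSpace β] {κ : α → ι → Measure β} [∀ x i, IsProbabilityMeasure (κ x i)]
    (hκ : ∀ i, Measurable fun x => κ x i) : Measurable fun x => Measure.pi (κ x) := by
  refine Measurable.measure_of_isPiSystem_of_isProbabilityMeasure (generateFrom_pi).symm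
    isPiSystem_pi ?_
  rintro _ ⟨t, ht, rfl⟩
  simp only [Measure.pi_pi]
  exact Finset.measurable_fun_prod _ fun i _ =>
    (Measure.measurable_coe (ht i (Set.mem_univ i))).comp (hκ i)

lemma measurable_fin_snoc {α β : Type*} [MeasurableSpace α] [MeasurableSpace β] {n : ℕ}
    {f : α → Fin n → β} {g : α → β} (hf : Measurable f) (hg : Measurable g) :
    Measurable fun x => (Fin.snoc (f x) (g x) : Fin (n + 1) → β) := by
  refine measurable_pi_lambda _ fun j => ?_
  refine Fin.lastCases ?_ (fun i => ?_) j
  · simp only [Fin.snoc_last]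
    exact hg
  · simp only [Fin.snoc_castSucc]
    exact (measurable_pi_apply i).comp hf

section Run

variable {S : Type u} {A : Type v} [Fintype S] [Fintype A] {H m : ℕ}

/-- The episode of a round that is appended to the dataset `d`: the main dataset is `none`, the
auxiliary dataset of objective `i` is `some i`. -/
def Round.episode (d : Option (Fin m)) (x : Round S A H m) : Traj S A H m :=
  match d with
  | none => x.1
  | some i => x.2 i

/-- The policy which generates the episodes of the dataset `d`. -/
def Learner.policy (L : Learner S A H m) (d : Option (Fin m)) (n : ℕ)
    (past : Fin n → Round S A H m) : Policy S A H :=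
  match d with
  | none => L.main n past
  | some i => L.aux n past i

/-- The dataset `d` after `n` rounds. -/
def dataset {n : ℕ} (d : Option (Fin m)) (past : Fin n → Round S A H m) :
    Fin n → Traj S A H m :=
  fun τ => (past τ).episode d

/-- The records of the first `n` rounds. -/
def restrict {n T : ℕ} (h : n ≤ T) (rec : Fin T → Round S A H m) : Fin n → Round S A H m :=
  fun j => rec (Fin.castLE h j)

lemma restrict_snoc {n T : ℕ} (h : n ≤ T) (past : Fin T → Round S A H m) (x : Round S A H m) :
    restrict (h.trans T.le_succ) (Fin.snoc past x : Fin (T + 1) → Round S A H m) =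
      restrict h past := by
  funext j
  exact Fin.snoc_castSucc (α := fun _ => Round S A H m) x past (Fin.castLE h j)

variable [MeasurableSpace S] [MeasurableSpace A]

@[fun_prop]
lemma measurable_roundEpisode (d : Option (Fin m)) :
    Measurable (Round.episode d : Round S A H m → Traj S A H m) := by
  cases d with
  | none => exact measurable_fst
  | some i => exact (measurable_pi_apply i).comp measurable_snd

@[fun_prop]
lemma measurable_restrict {n T : ℕ} (h : n ≤ T) :
    Measurable (restrict h : (Fin T → Round S A H m) → _) :=
  measurable_pi_lambda _ fun _ => measurable_pi_apply _

@[fun_prop]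
lemma measurable_dataset {n : ℕ} (d : Option (Fin m)) :
    Measurable (dataset d : (Fin n → Round S A H m) → _) :=
  measurable_pi_lambda _ fun j => (measurable_roundEpisode d).comp (measurable_pi_apply j)

instance isProbabilityMeasure_episode (M : MOMDP S A H m) (π : Policy S A H) :
    IsProbabilityMeasure (M.episode π) := by
  have := M.isProbabilityMeasure_rewardLaw
  exact isProbabilityMeasure_rollout _ _ _ _

lemma measurable_episode [MeasurableSingletonClass S] [MeasurableSingletonClass A]
    (M : MOMDP S A H m) : Measurable M.episode := by
  have := M.isProbabilityMeasure_rewardLaw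
  exact measurable_rollout _ _ _

/-- The law of the next round given the past. -/
noncomputable def Learner.roundLaw (L : Learner S A H m) (M : MOMDP S A H m) (n : ℕ)
    (past : Fin n → Round S A H m) : Measure (Round S A H m) :=
  (M.episode (L.main n past)).prod (Measure.pi fun i => M.episode (L.aux n past i))

instance isProbabilityMeasure_roundLaw (L : Learner S A H m) (M : MOMDP S A H m) (n : ℕ)
    (past : Fin n → Round S A H m) : IsProbabilityMeasure (L.roundLaw M n past) := by
  unfold Learner.roundLaw; infer_instance

/-- Only marginals of the round law are ever needed: each dataset is analysed separately, and
independence of the episodes within a round plays no role in the bounds. -/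
lemma lintegral_roundLaw_episode (L : Learner S A H m) (M : MOMDP S A H m) (d : Option (Fin m))
    (n : ℕ) (past : Fin n → Round S A H m) {F : Traj S A H m → ℝ≥0∞} (hF : Measurable F) :
    ∫⁻ x, F (x.episode d) ∂L.roundLaw M n past =
      ∫⁻ τ, F τ ∂M.episode (L.policy d n past) := by
  unfold Learner.roundLaw
  cases d with
  | none =>
    exact (measurePreserving_fst (μ := M.episode (L.main n past))
      (ν := Measure.pi fun i => M.episode (L.aux n past i))).lintegral_comp hF
  | some i =>
    exact ((measurePreserving_eval (fun i => M.episode (L.aux n past i)) i).comp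
      measurePreserving_snd).lintegral_comp hF

variable [MeasurableSingletonClass S] [MeasurableSingletonClass A]

lemma measurable_roundLaw {L : Learner S A H m} (M : MOMDP S A H m) {n : ℕ}
    (h₁ : Measurable (L.main n)) (h₂ : Measurable (L.aux n)) :
    Measurable (L.roundLaw M n) := by
  let κ : Kernel (Fin n → Round S A H m) (Traj S A H m) :=
    ⟨fun past => M.episode (L.main n past), (measurable_episode M).comp h₁⟩
  let κ' : Kernel (Fin n → Round S A H m) (Fin m → Traj S A H m) :=
    ⟨fun past => Measure.pi fun i => M.episode (L.aux n past i),
      measurable_measurePi fun i => (measurable_episode M).comp ((measurable_pi_apply i).comp h₂)⟩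
  have : IsMarkovKernel κ := ⟨fun past => isProbabilityMeasure_episode _ _⟩
  have : IsMarkovKernel κ' := ⟨fun past => by
    change IsProbabilityMeasure (Measure.pi fun i => M.episode (L.aux n past i)); infer_instance⟩
  have e : ⇑(κ ×ₖ κ') = L.roundLaw M n := by
    funext past
    rw [Kernel.prod_apply]
    rfl
  exact e ▸ (κ ×ₖ κ').measurable

lemma measurable_map_snoc {L : Learner S A H m} (M : MOMDP S A H m) {n : ℕ}
    (h₁ : Measurable (L.main n)) (h₂ : Measurable (L.aux n)) :
    Measurable fun past => (L.roundLaw M n past).map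
      (fun x => (Fin.snoc past x : Fin (n + 1) → Round S A H m)) := by
  let κ : Kernel (Fin n → Round S A H m) (Round S A H m) := ⟨_, measurable_roundLaw M h₁ h₂⟩
  have : IsMarkovKernel κ := ⟨fun past => isProbabilityMeasure_roundLaw _ _ _ _⟩
  have hs : Measurable fun p : (Fin n → Round S A H m) × Round S A H m =>
      (Fin.snoc p.1 p.2 : Fin (n + 1) → Round S A H m) :=
    measurable_fin_snoc measurable_fst measurable_snd
  have e : ⇑((Kernel.id ×ₖ κ).map (fun p : (Fin n → Round S A H m) × Round S A H m =>
      (Fin.snoc p.1 p.2 : Fin (n + 1) → Round S A H m))) = fun past => (L.roundLaw M n past).map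
      (fun x => (Fin.snoc past x : Fin (n + 1) → Round S A H m)) := by
    funext past
    rw [Kernel.map_apply _ hs, Kernel.prod_apply, Kernel.id_apply, Measure.dirac_prod,
      Measure.map_map hs (by fun_prop)]
    rfl
  exact e ▸ Kernel.measurable _

lemma lintegral_run_succ {L : Learner S A H m} (M : MOMDP S A H m) {n : ℕ}
    (h₁ : Measurable (L.main n)) (h₂ : Measurable (L.aux n))
    {G : (Fin (n + 1) → Round S A H m) → ℝ≥0∞} (hG : Measurable G) :
    ∫⁻ rec, G rec ∂L.run M (n + 1) =
      ∫⁻ past, ∫⁻ x, G (Fin.snoc past x) ∂L.roundLaw M n past ∂L.run M n := by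
  rw [Learner.run]
  refine (Measure.lintegral_bind (measurable_map_snoc M h₁ h₂).aemeasurable
    hG.aemeasurable).trans ?_
  refine lintegral_congr fun past => ?_
  exact lintegral_map hG (measurable_fin_snoc measurable_const measurable_id)

lemma isProbabilityMeasure_run {L : Learner S A H m} (M : MOMDP S A H m)
    (h₁ : ∀ n, Measurable (L.main n)) (h₂ : ∀ n, Measurable (L.aux n)) (n : ℕ) :
    IsProbabilityMeasure (L.run M n) := by
  induction n with
  | zero => rw [Learner.run]; infer_instance
  | succ n ih =>
    refine ⟨?_⟩
    rw [← lintegral_one, lintegral_run_succ M (h₁ n) (h₂ n) measurable_const]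
    simp

lemma lintegral_run_restrict {L : Learner S A H m} (M : MOMDP S A H m)
    (h₁ : ∀ n, Measurable (L.main n)) (h₂ : ∀ n, Measurable (L.aux n)) {n T : ℕ} (h : n ≤ T)
    {G : (Fin n → Round S A H m) → ℝ≥0∞} (hG : Measurable G) :
    ∫⁻ rec, G (restrict h rec) ∂L.run M T = ∫⁻ past, G past ∂L.run M n := by
  induction T, h using Nat.le_induction with
  | base => rfl
  | succ T h ih =>
    rw [lintegral_run_succ M (h₁ T) (h₂ T) (G := fun rec => G (restrict (h.trans T.le_succ) rec))
      (hG.comp (measurable_restrict _))]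
    simp only [restrict_snoc h, lintegral_const, measure_univ, mul_one]
    exact ih

/-- Carries a tail bound for the first `n` rounds over to the run of `T` rounds, where the union
over `n` is taken. -/
lemma run_restrict_mem {L : Learner S A H m} (M : MOMDP S A H m)
    (h₁ : ∀ n, Measurable (L.main n)) (h₂ : ∀ n, Measurable (L.aux n)) {n T : ℕ} (h : n ≤ T)
    {E : Set (Fin n → Round S A H m)} (hE : MeasurableSet E) :
    L.run M T {rec | restrict h rec ∈ E} = L.run M n E := by
  have := lintegral_run_restrict M h₁ h₂ h (G := E.indicator 1) (measurable_one.indicator hE)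
  rw [lintegral_indicator_one hE] at this
  rw [← this]
  exact (lintegral_indicator_one (measurable_restrict h hE)).symm

/-- The hypothesis `hstep` says that `G` is a nonnegative supermartingale, so its expectation never
exceeds the initial value. It serves both for exponential moments and for null events. -/
lemma lintegral_run_le {L : Learner S A H m} (M : MOMDP S A H m)
    (h₁ : ∀ n, Measurable (L.main n)) (h₂ : ∀ n, Measurable (L.aux n))
    (G : (n : ℕ) → (Fin n → Round S A H m) → ℝ≥0∞) (hG : ∀ n, Measurable (G n)) {c : ℝ≥0∞}
    (h0 : G 0 Fin.elim0 ≤ c)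
    (hstep : ∀ n past, ∫⁻ x, G (n + 1) (Fin.snoc past x) ∂L.roundLaw M n past ≤ G n past)
    (n : ℕ) : ∫⁻ rec, G n rec ∂L.run M n ≤ c := by
  induction n with
  | zero => rwa [Learner.run, lintegral_dirac' _ (hG 0)]
  | succ n ih =>
    rw [lintegral_run_succ M (h₁ n) (h₂ n) (hG _)]
    exact (lintegral_mono fun past => hstep n past).trans ih

end Run

/-- Hoeffding's lemma. -/
lemma lintegral_exp_centered_le {Ω : Type*} [MeasurableSpace Ω] {ρ : Measure Ω}
    [IsProbabilityMeasure ρ] {Y : Ω → ℝ} {a b : ℝ} (hY : Measurable Y)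
    (hb : ∀ᵐ ω ∂ρ, Y ω ∈ Set.Icc a b) (θ : ℝ) :
    ∫⁻ ω, ENNReal.ofReal (Real.exp (θ * (Y ω - ∫ x, Y x ∂ρ) - θ ^ 2 * (b - a) ^ 2 / 8)) ∂ρ ≤ 1 := by
  have h := hasSubgaussianMGF_of_mem_Icc hY.aemeasurable hb
  have hm := h.mgf_le θ
  have hi := h.integrable_exp_mul θ
  simp_rw [sub_eq_add_neg _ (θ ^ 2 * (b - a) ^ 2 / 8), Real.exp_add]
  rw [← ofReal_integral_eq_lintegral_ofReal (hi.mul_const _)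
    (Filter.Eventually.of_forall fun ω => by positivity), integral_mul_const]
  refine ENNReal.ofReal_le_one.2 ?_
  calc _ ≤ Real.exp (((‖b - a‖₊ / 2) ^ 2 : NNReal) * θ ^ 2 / 2) *
        Real.exp (-(θ ^ 2 * (b - a) ^ 2 / 8)) :=
        mul_le_mul_of_nonneg_right hm (Real.exp_pos _).le
    _ = 1 := by
        rw [← Real.exp_add, Real.exp_eq_one_iff]
        push_cast
        rw [Real.norm_eq_abs, div_pow, sq_abs]
        ring

/-! ### Exponential supermartingales and Chernoff bounds. -/

section Predictable

variable {S : Type u} {A : Type v} [Fintype S] [Fintype A] {H m : ℕ}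

/-- The sum over the first `n` rounds of a function of the past and of the new episode in the
dataset `d`. -/
noncomputable def predictableSum (d : Option (Fin m))
    (W : (n : ℕ) → (Fin n → Round S A H m) → Traj S A H m → ℝ) (n : ℕ)
    (past : Fin n → Round S A H m) : ℝ :=
  ∑ k : Fin n, W k (restrict k.2.le past) ((past k).episode d)

lemma predictableSum_snoc (d : Option (Fin m))
    (W : (n : ℕ) → (Fin n → Round S A H m) → Traj S A H m → ℝ) (n : ℕ)
    (past : Fin n → Round S A H m) (x : Round S A H m) :
    predictableSum d W (n + 1) (Fin.snoc past x) =
      predictableSum d W n past + W n past (x.episode d) := by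
  have h1 : ∀ k : Fin n, restrict (k.castSucc.2.le) (Fin.snoc past x : Fin (n + 1) → _) =
      restrict k.2.le past := fun k => restrict_snoc k.2.le past x
  have h2 : restrict (Fin.last n).2.le (Fin.snoc past x : Fin (n + 1) → _) = past :=
    (restrict_snoc le_rfl past x).trans rfl
  unfold predictableSum
  rw [Fin.sum_univ_castSucc]
  simp_rw [h1, Fin.snoc_castSucc, Fin.snoc_last]
  congr 1
  exact congrArg (fun p => W n p (x.episode d)) h2

variable [MeasurableSpace S] [MeasurableSpace A]

lemma measurable_predictableSum (d : Option (Fin m))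
    {W : (n : ℕ) → (Fin n → Round S A H m) → Traj S A H m → ℝ}
    (hW : ∀ n, Measurable fun p : (Fin n → Round S A H m) × Traj S A H m => W n p.1 p.2) (n : ℕ) :
    Measurable (predictableSum d W n) := by
  refine Finset.measurable_fun_sum _ fun k _ => ?_
  exact (hW k).comp ((measurable_restrict k.2.le).prodMk
    ((measurable_roundEpisode d).comp (measurable_pi_apply k)))

variable [MeasurableSingletonClass S] [MeasurableSingletonClass A]

/-- Given the past, the exponential of the sum factors into a constant and the exponential of the
new term, whose conditional mean is at most one. -/
lemma lintegral_exp_predictableSum_le {L : Learner S A H m} (M : MOMDP S A H m)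
    (h₁ : ∀ n, Measurable (L.main n)) (h₂ : ∀ n, Measurable (L.aux n)) (d : Option (Fin m))
    {W : (n : ℕ) → (Fin n → Round S A H m) → Traj S A H m → ℝ}
    (hW : ∀ n, Measurable fun p : (Fin n → Round S A H m) × Traj S A H m => W n p.1 p.2)
    (hstep : ∀ n past, ∫⁻ τ, ENNReal.ofReal (Real.exp (W n past τ))
      ∂(M.episode (L.policy d n past)) ≤ 1) (n : ℕ) :
    ∫⁻ rec, ENNReal.ofReal (Real.exp (predictableSum d W n rec)) ∂(L.run M n) ≤ 1 := by
  refine lintegral_run_le M h₁ h₂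
    (fun n rec => ENNReal.ofReal (Real.exp (predictableSum d W n rec)))
    (fun n => (measurable_predictableSum d hW n).exp.ennreal_ofReal) ?_ ?_ n
  · simp [predictableSum]
  · intro n past
    have hWn : Measurable (W n past) := (hW n).comp measurable_prodMk_left
    simp_rw [predictableSum_snoc, Real.exp_add, ENNReal.ofReal_mul (Real.exp_pos _).le]
    have hWx : Measurable fun x : Round S A H m => W n past (x.episode d) :=
      hWn.comp (measurable_roundEpisode d)
    rw [lintegral_const_mul _ hWx.exp.ennreal_ofReal,
      lintegral_roundLaw_episode L M d n past
        (F := fun τ => ENNReal.ofReal (Real.exp (W n past τ))) hWn.exp.ennreal_ofReal]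
    exact mul_le_of_le_one_right' (hstep n past)

/-- Markov's inequality for the exponential supermartingale. -/
lemma run_predictableSum_ge_le {L : Learner S A H m} (M : MOMDP S A H m)
    (h₁ : ∀ n, Measurable (L.main n)) (h₂ : ∀ n, Measurable (L.aux n)) (d : Option (Fin m))
    {W : (n : ℕ) → (Fin n → Round S A H m) → Traj S A H m → ℝ}
    (hW : ∀ n, Measurable fun p : (Fin n → Round S A H m) × Traj S A H m => W n p.1 p.2)
    (hstep : ∀ n past, ∫⁻ τ, ENNReal.ofReal (Real.exp (W n past τ))
      ∂(M.episode (L.policy d n past)) ≤ 1) (n : ℕ) (c : ℝ) :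
    L.run M n {rec | c ≤ predictableSum d W n rec} ≤ ENNReal.ofReal (Real.exp (-c)) := by
  have h := mul_meas_ge_le_lintegral (μ := L.run M n)
    (measurable_predictableSum d hW n).exp.ennreal_ofReal (ENNReal.ofReal (Real.exp c))
  have e : {rec | ENNReal.ofReal (Real.exp c) ≤ ENNReal.ofReal (Real.exp
      (predictableSum d W n rec))} = {rec | c ≤ predictableSum d W n rec} := by
    ext rec
    simp [ENNReal.ofReal_le_ofReal_iff (Real.exp_pos _).le]
  rw [e] at h
  have h' := h.trans (lintegral_exp_predictableSum_le M h₁ h₂ d hW hstep n)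
  rw [Real.exp_neg, ENNReal.ofReal_inv_of_pos (Real.exp_pos _), ENNReal.le_inv_iff_mul_le, mul_comm]
  exact h'

end Predictable

/-! ### Concentration of rewards and transitions along visits. -/

section Deviation

variable {S : Type u} {A : Type v} [Fintype S] [Fintype A] [DecidableEq S] [DecidableEq A]
  {H m : ℕ}

/-- The sum of `X` over the visits of `(s, a)` at step `h`. -/
noncomputable def visitSum {n : ℕ} (X : (Fin m → ℝ) → S → ℝ) (D : Fin n → Traj S A H m)
    (h : Fin H) (s : S) (a : A) : ℝ :=
  ∑ τ : Fin n, if (D τ h).1 = s ∧ (D τ h).2.1 = a then X (D τ h).2.2.1 (D τ h).2.2.2 else 0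

lemma visits_eq_sum {n : ℕ} (D : Fin n → Traj S A H m) (h : Fin H) (s : S) (a : A) :
    (visits D h s a : ℝ) = ∑ τ : Fin n, if (D τ h).1 = s ∧ (D τ h).2.1 = a then (1 : ℝ) else 0 := by
  rw [visits, Finset.card_filter]
  push_cast
  rfl

lemma visits_le {n : ℕ} (D : Fin n → Traj S A H m) (h : Fin H) (s : S) (a : A) :
    visits D h s a ≤ n := by
  exact (Finset.card_filter_le _ _).trans (by simp)

variable [MeasurableSpace S] [MeasurableSpace A]

/-- `X`, a function of the observed rewards and of the next state, is centered and sub-Gaussian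
like a random variable with values in an interval of length one. -/
def IsCentered (M : MOMDP S A H m) (h : Fin H) (s : S) (a : A) (X : (Fin m → ℝ) → S → ℝ) : Prop :=
  ∀ θ : ℝ, ∑ s', ENNReal.ofReal ((M.trans h s a : S → ℝ) s') *
    ∫⁻ x, ENNReal.ofReal (Real.exp (θ * X x s' - θ ^ 2 / 8)) ∂(M.rewardLaw h s a) ≤ 1

lemma isCentered_reward (M : MOMDP S A H m) (h : Fin H) (s : S) (a : A) (i : Fin m) :
    IsCentered M h s a (fun x _ => x i - M.r i h s a) := by
  intro θ
  have := M.isProbabilityMeasure_rewardLaw h s a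
  have hb : ∀ᵐ x ∂(M.rewardLaw h s a), x i ∈ Set.Icc (0 : ℝ) 1 := by
    filter_upwards [M.rewardLaw_mem h s a] with x hx using hx i
  have := lintegral_exp_centered_le (measurable_pi_apply i) hb θ
  rw [M.rewardLaw_mean] at this
  refine sum_ofReal_mul_le _ fun _ => ?_
  simpa using this

lemma isCentered_neg_reward (M : MOMDP S A H m) (h : Fin H) (s : S) (a : A) (i : Fin m) :
    IsCentered M h s a (fun x _ => M.r i h s a - x i) := by
  intro θ
  convert isCentered_reward M h s a i (-θ) using 7
  ring

lemma isCentered_next (M : MOMDP S A H m) (h : Fin H) (s : S) (a : A) (B : Finset S)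
    [MeasurableSingletonClass S] :
    IsCentered M h s a (fun _ s' => (if s' ∈ B then 1 else 0) -
      ∑ s' ∈ B, (M.trans h s a : S → ℝ) s') := by
  intro θ
  have := M.isProbabilityMeasure_rewardLaw h s a
  -- Hoeffding's lemma is applied to the indicator of `B` under the next-state distribution,
  -- realised as a sum of point masses.
  let ν : Measure S := ∑ s', ENNReal.ofReal ((M.trans h s a : S → ℝ) s') • Measure.dirac s'
  have hν : IsProbabilityMeasure ν := ⟨by
    simp only [ν, Measure.finsetSum_apply, Measure.smul_apply, measure_univ, smul_eq_mul, mul_one]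
    exact sum_ofReal_stdSimplex _⟩
  have hY : Measurable fun s' : S => if s' ∈ B then (1 : ℝ) else 0 := Measurable.of_discrete
  have hb : ∀ᵐ s' ∂ν, (if s' ∈ B then (1 : ℝ) else 0) ∈ Set.Icc (0 : ℝ) 1 :=
    Filter.Eventually.of_forall fun s' => by split_ifs <;> simp
  have hmean : ∫ s', (if s' ∈ B then (1 : ℝ) else 0) ∂ν = ∑ s' ∈ B, (M.trans h s a : S → ℝ) s' := by
    have hfin : ∀ s', IsFiniteMeasure (ENNReal.ofReal ((M.trans h s a : S → ℝ) s') •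
        Measure.dirac s') := fun s' => Measure.smul_finite _ ENNReal.ofReal_ne_top
    rw [integral_finsetSum_measure fun s' _ => Integrable.of_finite]
    simp [integral_smul_measure, ENNReal.toReal_ofReal (stdSimplex.zero_le _ _)]
  have key := lintegral_exp_centered_le hY hb θ
  rw [hmean, lintegral_finsetSum_measure] at key
  simpa [lintegral_smul_measure] using key

variable [MeasurableSingletonClass S] [MeasurableSingletonClass A]

lemma measurable_visitTerm (s : S) (a : A) {X : (Fin m → ℝ) → S → ℝ}
    (hX : Measurable fun p : (Fin m → ℝ) × S => X p.1 p.2) :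
    Measurable fun x : Step S A m => if x.1 = s ∧ x.2.1 = a then X x.2.2.1 x.2.2.2 else 0 := by
  refine Measurable.ite ?_ (hX.comp (by fun_prop :
    Measurable fun x : Step S A m => (x.2.2.1, x.2.2.2))) measurable_const
  exact ((measurableSet_singleton s).preimage measurable_fst).inter
    ((measurableSet_singleton a).preimage (measurable_fst.comp measurable_snd))

lemma measurable_visits {n : ℕ} (h : Fin H) (s : S) (a : A) :
    Measurable fun D : Fin n → Traj S A H m => (visits D h s a : ℝ) := by
  simp_rw [visits_eq_sum]
  refine Finset.measurable_fun_sum _ fun τ _ => ?_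
  exact (measurable_visitTerm s a (X := fun _ _ => 1) measurable_const).comp
    ((measurable_pi_apply h).comp (measurable_pi_apply τ))

lemma measurable_visitSum {n : ℕ} (h : Fin H) (s : S) (a : A) {X : (Fin m → ℝ) → S → ℝ}
    (hX : Measurable fun p : (Fin m → ℝ) × S => X p.1 p.2) :
    Measurable fun D : Fin n → Traj S A H m => visitSum X D h s a := by
  refine Finset.measurable_fun_sum _ fun τ _ => ?_
  exact (measurable_visitTerm s a hX).comp
    ((measurable_pi_apply h).comp (measurable_pi_apply τ))

/-- The number of visits is random, so its value `k` is fixed first and the exponential parameter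
tuned to it. Only episodes visiting `(s, a)` contribute to the exponent, hence the compensator is
exactly `θ ^ 2 / 8` times the number of visits. -/
lemma run_visitSum_ge_le {L : Learner S A H m} (M : MOMDP S A H m)
    (h₁ : ∀ n, Measurable (L.main n)) (h₂ : ∀ n, Measurable (L.aux n)) (d : Option (Fin m))
    {h : Fin H} {s : S} {a : A} {X : (Fin m → ℝ) → S → ℝ}
    (hX : Measurable fun p : (Fin m → ℝ) × S => X p.1 p.2) (hc : IsCentered M h s a X)
    (n : ℕ) {k : ℕ} (hk : 0 < k) {c : ℝ} (hc0 : 0 ≤ c) :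
    L.run M n {rec | visits (dataset d rec) h s a = k ∧
      Real.sqrt (2 * c / k) * k ≤ visitSum X (dataset d rec) h s a} ≤
      ENNReal.ofReal (Real.exp (-(4 * c))) := by
  -- This maximises `θ x - θ ^ 2 k / 8` at `x = k √(2c/k)`; the maximum is `8c - 4c = 4c`.
  set θ : ℝ := 4 * Real.sqrt (2 * c / k) with hθ
  have hk' : (0 : ℝ) < k := Nat.cast_pos.2 hk
  have hsq : Real.sqrt (2 * c / k) ^ 2 * k = 2 * c := by
    rw [Real.sq_sqrt (by positivity)]; field_simp
  let f : Step S A m → ℝ := fun x =>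
    if x.1 = s ∧ x.2.1 = a then θ * X x.2.2.1 x.2.2.2 - θ ^ 2 / 8 else 0
  have hf : Measurable f :=
    measurable_visitTerm s a (X := fun x s' => θ * X x s' - θ ^ 2 / 8) (by fun_prop)
  let W : (n : ℕ) → (Fin n → Round S A H m) → Traj S A H m → ℝ := fun _ _ τ => f (τ h)
  have hR := M.isProbabilityMeasure_rewardLaw
  have hstep : ∀ n past, ∫⁻ τ, ENNReal.ofReal (Real.exp (W n past τ))
      ∂(M.episode (L.policy d n past)) ≤ 1 := by
    intro n past
    refine lintegral_rollout_step_le _ _ _ _ h (F := fun x => ENNReal.ofReal (Real.exp (f x)))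
      hf.exp.ennreal_ofReal fun s₁ a₁ => ?_
    by_cases hsa : s₁ = s ∧ a₁ = a
    · obtain ⟨rfl, rfl⟩ := hsa
      simpa [f] using hc θ
    · refine sum_ofReal_mul_le _ fun s' => ?_
      simp [f, hsa]
  refine le_trans (measure_mono ?_) (run_predictableSum_ge_le M h₁ h₂ d (W := W)
    (fun n => hf.comp ((measurable_pi_apply h).comp measurable_snd)) hstep n (4 * c))
  rintro rec ⟨hv, hz⟩
  have e : predictableSum d W n rec = θ * visitSum X (dataset d rec) h s a -
      θ ^ 2 / 8 * visits (dataset d rec) h s a := by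
    rw [visits_eq_sum, visitSum, Finset.mul_sum, Finset.mul_sum, ← Finset.sum_sub_distrib]
    refine Finset.sum_congr rfl fun k _ => ?_
    by_cases hv : (dataset d rec k h).1 = s ∧ (dataset d rec k h).2.1 = a
    · have hv' : ((rec k).episode d h).1 = s ∧ ((rec k).episode d h).2.1 = a := hv
      rw [if_pos hv, if_pos hv]
      simp only [W, f, if_pos hv', dataset]
      ring
    · have hv' : ¬(((rec k).episode d h).1 = s ∧ ((rec k).episode d h).2.1 = a) := hv
      rw [if_neg hv, if_neg hv]
      simp only [W, f, if_neg hv']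
      ring
  simp only [Set.mem_ofPred_eq, e, hv]
  have : θ * (Real.sqrt (2 * c / k) * k) ≤ θ * visitSum X (dataset d rec) h s a :=
    mul_le_mul_of_nonneg_left hz (by positivity)
  have e1 : θ * (Real.sqrt (2 * c / k) * k) = 8 * c := by rw [hθ]; linear_combination 4 * hsq
  have e2 : θ ^ 2 / 8 * k = 4 * c := by rw [hθ]; linear_combination 2 * hsq
  linarith

/-- Union bound over the round and the value of the visit count: at most `T ^ 2` pairs. -/
lemma run_exists_visitSum_ge_le {L : Learner S A H m} (M : MOMDP S A H m)
    (h₁ : ∀ n, Measurable (L.main n)) (h₂ : ∀ n, Measurable (L.aux n)) (d : Option (Fin m))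
    {h : Fin H} {s : S} {a : A} {X : (Fin m → ℝ) → S → ℝ}
    (hX : Measurable fun p : (Fin m → ℝ) × S => X p.1 p.2) (hc : IsCentered M h s a X)
    (T : ℕ) {c : ℝ} (hc0 : 0 ≤ c) :
    L.run M T {rec | ∃ (n : ℕ) (hn : n < T),
      0 < visits (dataset d (restrict hn.le rec)) h s a ∧
      Real.sqrt (2 * c / visits (dataset d (restrict hn.le rec)) h s a) *
        visits (dataset d (restrict hn.le rec)) h s a ≤
          visitSum X (dataset d (restrict hn.le rec)) h s a} ≤
      ENNReal.ofReal (T ^ 2 * Real.exp (-(4 * c))) := by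
  let E : (n k : ℕ) → Set (Fin n → Round S A H m) := fun n k =>
    {rec | visits (dataset d rec) h s a = k ∧
      Real.sqrt (2 * c / k) * k ≤ visitSum X (dataset d rec) h s a}
  have hE : ∀ n k, MeasurableSet (E n k) := by
    intro n k
    have hv : Measurable fun rec : Fin n → Round S A H m =>
        (visits (dataset d rec) h s a : ℝ) :=
      (measurable_visits h s a).comp (measurable_dataset d)
    have hz : Measurable fun rec : Fin n → Round S A H m => visitSum X (dataset d rec) h s a :=
      (measurable_visitSum h s a hX).comp (measurable_dataset d)
    have e : E n k = {rec | (visits (dataset d rec) h s a : ℝ) = k} ∩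
        {rec | Real.sqrt (2 * c / k) * k ≤ visitSum X (dataset d rec) h s a} := by
      ext rec; simp [E]
    rw [e]
    exact (measurableSet_eq_fun hv measurable_const).inter
      (measurableSet_le measurable_const hz)
  -- The index `k : Fin T` stands for the visit count `k + 1`, since only positive counts matter.
  calc _ ≤ L.run M T (⋃ n : Fin T, ⋃ k : Fin T, {rec | restrict n.2.le rec ∈ E n (k + 1)}) := by
        refine measure_mono ?_
        rintro rec ⟨n, hn, hpos, hz⟩
        have hle := visits_le (dataset d (restrict hn.le rec)) h s a
        refine Set.mem_iUnion.2 ⟨⟨n, hn⟩, Set.mem_iUnion.2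
          ⟨⟨visits (dataset d (restrict hn.le rec)) h s a - 1, by omega⟩, ?_⟩⟩
        have e : visits (dataset d (restrict hn.le rec)) h s a - 1 + 1 =
          visits (dataset d (restrict hn.le rec)) h s a := by omega
        simp only [Set.mem_ofPred_eq, e]
        exact ⟨rfl, hz⟩
    _ ≤ ∑ n : Fin T, ∑ k : Fin T, L.run M T {rec | restrict n.2.le rec ∈ E n (k + 1)} :=
        (measure_iUnion_fintype_le _ _).trans
          (Finset.sum_le_sum fun n _ => measure_iUnion_fintype_le _ _)
    _ ≤ ∑ n : Fin T, ∑ k : Fin T, ENNReal.ofReal (Real.exp (-(4 * c))) := by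
        refine Finset.sum_le_sum fun n _ => Finset.sum_le_sum fun k _ => ?_
        rw [run_restrict_mem M h₁ h₂ n.2.le (hE _ _)]
        exact run_visitSum_ge_le M h₁ h₂ d hX hc n k.1.succ_pos hc0
    _ = ENNReal.ofReal (T ^ 2 * Real.exp (-(4 * c))) := by
        rw [ENNReal.ofReal_mul (by positivity), ENNReal.ofReal_pow (by positivity),
          ENNReal.ofReal_natCast]
        simp [sq, mul_assoc]

/-- Almost surely all observed rewards lie in `[0, 1]`. -/
lemma run_reward_notMem {L : Learner S A H m} (M : MOMDP S A H m)
    (h₁ : ∀ n, Measurable (L.main n)) (h₂ : ∀ n, Measurable (L.aux n)) (d : Option (Fin m))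
    (T : ℕ) :
    L.run M T {rec | ∃ τ h i, (dataset d rec τ h).2.2.1 i ∉ Set.Icc (0 : ℝ) 1} = 0 := by
  have hR := M.isProbabilityMeasure_rewardLaw
  have hset : {rec : Fin T → Round S A H m |
      ∃ τ h i, (dataset d rec τ h).2.2.1 i ∉ Set.Icc (0 : ℝ) 1} =
      ⋃ h, {rec | ∃ τ i, (dataset d rec τ h).2.2.1 i ∉ Set.Icc (0 : ℝ) 1} := by
    ext rec
    simp only [Set.mem_ofPred_eq, Set.mem_iUnion]
    exact exists_comm
  rw [hset, measure_iUnion_null_iff]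
  intro h
  let B : Set (Step S A m) := {x | ∃ i, x.2.2.1 i ∉ Set.Icc (0 : ℝ) 1}
  have hB : MeasurableSet B := by
    have e : B = ⋃ i, {x | x.2.2.1 i ∈ Set.Icc (0 : ℝ) 1}ᶜ := by ext x; simp [B]
    rw [e]
    refine MeasurableSet.iUnion fun i => (MeasurableSet.compl ?_)
    exact measurableSet_Icc.preimage (by fun_prop)
  let F : Step S A m → ℝ≥0∞ := B.indicator 1
  have hF : Measurable F := measurable_one.indicator hB
  let G : (n : ℕ) → (Fin n → Round S A H m) → ℝ≥0∞ := fun n rec => ∑ τ, F (dataset d rec τ h)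
  have hG : ∀ n, Measurable (G n) := fun n => Finset.measurable_fun_sum _ fun τ _ =>
    hF.comp ((measurable_pi_apply h).comp ((measurable_pi_apply τ).comp (measurable_dataset d)))
  -- The expected number of recorded steps with a reward outside the unit interval stays zero from
  -- round to round.
  have key : ∫⁻ rec, G T rec ∂(L.run M T) ≤ 0 := by
    refine lintegral_run_le M h₁ h₂ G hG (by simp [G]) ?_ T
    intro n past
    have e : ∀ x, G (n + 1) (Fin.snoc past x) = G n past + F (x.episode d h) := by
      intro x
      simp only [G, dataset, Fin.sum_univ_castSucc, Fin.snoc_castSucc, Fin.snoc_last]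
    simp_rw [e]
    rw [lintegral_add_left measurable_const, lintegral_const, measure_univ, mul_one,
      lintegral_roundLaw_episode L M d n past (F := fun τ => F (τ h))
        (hF.comp (measurable_pi_apply h))]
    have : ∫⁻ τ, F (τ h) ∂(M.episode (L.policy d n past)) ≤ 0 := by
      refine lintegral_rollout_step_le _ _ _ _ h hF fun s a => ?_
      refine sum_ofReal_mul_le _ fun s' => ?_
      have : ∀ᵐ x ∂(M.rewardLaw h s a), F (s, a, x, s') = 0 := by
        filter_upwards [M.rewardLaw_mem h s a] with x hx
        refine Set.indicator_of_notMem ?_ _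
        rintro ⟨i, hi⟩
        exact hi (hx i)
      rw [lintegral_congr_ae this]
      simp
    exact (add_le_add_right this _).trans_eq (add_zero _)
  have h0 : ∀ᵐ rec ∂(L.run M T), G T rec = 0 :=
    (lintegral_eq_zero_iff (hG T)).1 (le_antisymm key bot_le)
  refine measure_mono_null ?_ (ae_iff.1 h0)
  rintro rec ⟨τ, i, hi⟩ hz
  have h3 := (Finset.sum_eq_zero_iff.1 hz) τ (Finset.mem_univ _)
  have h4 : F (dataset d rec τ h) = 1 :=
    Set.indicator_of_mem (show dataset d rec τ h ∈ B from ⟨i, hi⟩) _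
  rw [h4] at h3
  exact one_ne_zero h3

end Deviation

lemma MOMDP.r_mem_Icc {S A : Type*} [Fintype S] {H m : ℕ} (M : MOMDP S A H m) (i : Fin m)
    (h : Fin H) (s : S) (a : A) : M.r i h s a ∈ Set.Icc (0 : ℝ) 1 := by
  have := M.isProbabilityMeasure_rewardLaw h s a
  rw [← M.rewardLaw_mean]
  have hx : ∀ᵐ x ∂(M.rewardLaw h s a), x i ∈ Set.Icc (0 : ℝ) 1 := by
    filter_upwards [M.rewardLaw_mem h s a] with x hx using hx i
  refine ⟨integral_nonneg_of_ae (by filter_upwards [hx] with x hx using hx.1), ?_⟩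
  calc ∫ x, x i ∂(M.rewardLaw h s a) ≤ ∫ _, (1 : ℝ) ∂(M.rewardLaw h s a) := by
        refine integral_mono_ae (Integrable.of_mem_Icc 0 1 (measurable_pi_apply i).aemeasurable hx)
          (integrable_const _) ?_
        filter_upwards [hx] with x hx using hx.2
    _ = 1 := by simp

/-! ### Values by backward recursion. -/

section StageValue

variable {S : Type u} {A : Type v} [Fintype S] [Fintype A] {H m : ℕ}

/-- Expected sum of `f` over the steps from `h` on, started at `s`. -/
noncomputable def MOMDP.stageValue (M : MOMDP S A H m) (f : Fin H → S → A → ℝ) (π : Policy S A H)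
    (h : ℕ) (s : S) : ℝ :=
  if hh : h < H then
    ∑ a, (f ⟨h, hh⟩ s a + ∑ s', (M.trans ⟨h, hh⟩ s a : S → ℝ) s' * M.stageValue f π (h + 1) s') *
      (π ⟨h, hh⟩ s : A → ℝ) a
  else 0
termination_by H - h

lemma MOMDP.stageValue_of_lt (M : MOMDP S A H m) (f : Fin H → S → A → ℝ) (π : Policy S A H)
    (h : Fin H) (s : S) : M.stageValue f π h s =
      ∑ a, (f h s a + ∑ s', (M.trans h s a : S → ℝ) s' * M.stageValue f π (h + 1) s') *
        (π h s : A → ℝ) a := by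
  rw [MOMDP.stageValue, dif_pos h.2]

lemma MOMDP.stageValue_of_le (M : MOMDP S A H m) (f : Fin H → S → A → ℝ) (π : Policy S A H)
    {h : ℕ} (hh : H ≤ h) (s : S) : M.stageValue f π h s = 0 := by
  rw [MOMDP.stageValue, dif_neg hh.not_gt]

/-- Backward induction over the steps. -/
lemma backward_induction {H : ℕ} {p : ℕ → Prop} (hend : p H)
    (hstep : ∀ h : Fin H, p (h + 1) → p h) {h : ℕ} (hh : h ≤ H) : p h :=
  Nat.decreasingInduction (motive := fun k _ => p k) (fun k hk ih => hstep ⟨k, hk⟩ ih) hend hh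

variable [MeasurableSpace S] [MeasurableSpace A]
  [MeasurableSingletonClass S] [MeasurableSingletonClass A]

/-- `rollout` peels off the first of the remaining steps, whereas `stageValue` counts absolute
steps. Indexing the tail by `k + j` with `n + k = H` reconciles the two recursions. -/
lemma integral_rollout_eq_stageValue (M : MOMDP S A H m) (f : Fin H → S → A → ℝ)
    (π : Policy S A H) (n k : ℕ) (hk : n + k = H) (s : S) :
    ∫ τ, ∑ j : Fin n, f ⟨k + j, by omega⟩ (τ j).1 (τ j).2.1 ∂rollout n
      (fun j => π ⟨k + j, by omega⟩) (fun j => M.trans ⟨k + j, by omega⟩)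
      (fun j => M.rewardLaw ⟨k + j, by omega⟩) s = M.stageValue f π k s := by
  have hR := M.isProbabilityMeasure_rewardLaw
  induction n generalizing k s with
  | zero => rw [M.stageValue_of_le f π (by omega)]; simp
  | succ n ih =>
    have := integral_rollout_succ (fun j : Fin (n + 1) => π ⟨k + j, by omega⟩)
      (fun j => M.trans ⟨k + j, by omega⟩) (fun j => M.rewardLaw ⟨k + j, by omega⟩) s
      (fun j => f ⟨k + j, by omega⟩)
    rw [this]
    have h0 := M.stageValue_of_lt f π ⟨k, by omega⟩ s
    rw [show M.stageValue f π k s = _ from h0]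
    refine Finset.sum_congr rfl fun a _ => ?_
    congr 2
    refine Finset.sum_congr rfl fun s' _ => ?_
    congr 1
    rw [← ih (k + 1) (by omega) s']
    have e : ∀ j : Fin n, (⟨k + (j.succ : Fin (n + 1)), by omega⟩ : Fin H) =
        ⟨k + 1 + j, by omega⟩ := fun j => Fin.ext (by simp; omega)
    simp only [e]

lemma integral_episode_eq_stageValue (M : MOMDP S A H m) (f : Fin H → S → A → ℝ)
    (π : Policy S A H) :
    ∫ τ, ∑ h, f h (τ h).1 (τ h).2.1 ∂(M.episode π) = M.stageValue f π 0 M.init := by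
  rw [← integral_rollout_eq_stageValue M f π H 0 rfl M.init]
  simp only [Nat.zero_add]
  rfl

lemma integrable_episode (M : MOMDP S A H m) (f : Fin H → S → A → ℝ) (π : Policy S A H) :
    Integrable (fun τ : Traj S A H m => ∑ h, f h (τ h).1 (τ h).2.1) (M.episode π) :=
  integrable_sum_visit f _

lemma MOMDP.value_eq_stageValue (M : MOMDP S A H m) (π : Policy S A H) (i : Fin m) :
    M.value π i = M.stageValue (M.r i) π 0 M.init :=
  integral_episode_eq_stageValue M (M.r i) π

lemma MOMDP.value_mem_Icc (M : MOMDP S A H m) (π : Policy S A H) (i : Fin m) :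
    M.value π i ∈ Set.Icc (0 : ℝ) H := by
  refine ⟨integral_nonneg fun τ => Finset.sum_nonneg fun h _ => (M.r_mem_Icc i h _ _).1, ?_⟩
  calc M.value π i ≤ ∫ _, (H : ℝ) ∂(M.episode π) := by
        refine integral_mono (integrable_episode M (M.r i) π) (integrable_const _) fun τ => ?_
        calc ∑ h, M.r i h (τ h).1 (τ h).2.1 ≤ ∑ _ : Fin H, (1 : ℝ) :=
              Finset.sum_le_sum fun h _ => (M.r_mem_Icc i h _ _).2
          _ = H := by simp
    _ = H := by simp

lemma MOMDP.value_le_optValue (M : MOMDP S A H m) (π : Policy S A H) (i : Fin m) :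
    M.value π i ≤ M.optValue i :=
  le_ciSup (f := fun π => M.value π i) ⟨H, by rintro _ ⟨π, rfl⟩; exact (M.value_mem_Icc π i).2⟩ π

lemma MOMDP.mixValue_eq (M : MOMDP S A H m) {T : ℕ} (π : Fin T → Policy S A H) (i : Fin m) :
    M.mixValue π i = (∑ t, M.value (π t) i) / T := by
  unfold MOMDP.mixValue MOMDP.valueUnder MOMDP.mixEpisode
  rw [integral_smul_measure, integral_finsetSum_measure
    fun t _ => integrable_episode M (M.r i) (π t)]
  simp only [ENNReal.toReal_inv, ENNReal.toReal_natCast, smul_eq_mul]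
  rw [div_eq_inv_mul]
  rfl

end StageValue

/-! ### Optimism and its price for accurate datasets. -/

section Optimism

variable {S : Type u} {A : Type v} [Fintype S] [Fintype A] [DecidableEq S] [DecidableEq A]
  {H m n T : ℕ} {δ : ℝ}

/-- The sum of the two bonuses. -/
noncomputable def bonus (T : ℕ) (δ : ℝ) (D : Fin n → Traj S A H m) (h : Fin H) (s : S) (a : A) :
    ℝ :=
  transBonus T δ D h s a + rewardBonus T δ D h s a

/-- The empirical rewards and transition probabilities are accurate up to the bonuses. -/
structure Accurate (M : MOMDP S A H m) (T : ℕ) (δ : ℝ) (D : Fin n → Traj S A H m) : Prop where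
  reward : ∀ i h s a, |rewardEst D i h s a - M.r i h s a| ≤ rewardBonus T δ D h s a
  trans : ∀ h s a (V : S → ℝ), (∀ s', V s' ∈ Set.Icc (0 : ℝ) H) →
    |∑ s', transEst D h s a s' * V s' - ∑ s', (M.trans h s a : S → ℝ) s' * V s'| ≤
      transBonus T δ D h s a

lemma bonus_nonneg (D : Fin n → Traj S A H m) (h : Fin H) (s : S) (a : A) :
    0 ≤ bonus T δ D h s a :=
  add_nonneg (le_min (Real.sqrt_nonneg _) (Nat.cast_nonneg _))
    (le_min (Real.sqrt_nonneg _) zero_le_one)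

lemma bonus_le (D : Fin n → Traj S A H m) (h : Fin H) (s : S) (a : A) :
    bonus T δ D h s a ≤ 2 * H := by
  have h1 : transBonus T δ D h s a ≤ H := min_le_right _ _
  have h2 : rewardBonus T δ D h s a ≤ 1 := min_le_right _ _
  have h3 : (1 : ℝ) ≤ H := Nat.one_le_cast.2 (Nat.one_le_of_lt h.2)
  unfold bonus
  linarith

lemma optV_of_lt (D : Fin n → Traj S A H m) (i : Fin m) (π : Policy S A H) (h : Fin H) (s : S) :
    optV T δ D i π h s = ∑ a, estQ T δ D i π h s a * (π h s : A → ℝ) a := by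
  rw [optV, dif_pos h.2]
  rfl

lemma optV_end (D : Fin n → Traj S A H m) (i : Fin m) (π : Policy S A H) (s : S) :
    optV T δ D i π H s = 0 := by
  rw [optV, dif_neg (lt_irrefl H)]

lemma optQ_mem_Icc (D : Fin n → Traj S A H m) (i : Fin m) (h : Fin H) (V : S → ℝ) (s : S) (a : A) :
    optQ T δ D i h V s a ∈ Set.Icc (0 : ℝ) ((H : ℝ) - (h : ℕ)) := by
  have : (0 : ℝ) ≤ (H : ℝ) - (h : ℕ) := sub_nonneg.2 (Nat.cast_le.2 h.2.le)
  exact ⟨le_max_left _ _, max_le this (min_le_right _ _)⟩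

lemma optV_mem_Icc (D : Fin n → Traj S A H m) (i : Fin m) (π : Policy S A H) {h : ℕ} (hh : h ≤ H)
    (s : S) : optV T δ D i π h s ∈ Set.Icc (0 : ℝ) ((H : ℝ) - h) := by
  rcases hh.lt_or_eq with hlt | rfl
  · rw [optV_of_lt D i π ⟨h, hlt⟩ s]
    simp_rw [mul_comm (estQ T δ D i π ⟨h, hlt⟩ s _)]
    exact ⟨le_stdSimplex_sum_mul _ fun a => (optQ_mem_Icc D i ⟨h, hlt⟩ _ s a).1,
      stdSimplex_sum_mul_le _ fun a => (optQ_mem_Icc D i ⟨h, hlt⟩ _ s a).2⟩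
  · rw [optV_end]; simp

/-- The added bonuses dominate both estimation errors, and truncation is harmless because the true
backup is at most `1 + (H - (h + 1)) = H - h`. -/
lemma Accurate.le_optQ {M : MOMDP S A H m} {D : Fin n → Traj S A H m} (hD : Accurate M T δ D)
    (i : Fin m) (h : Fin H) {V : S → ℝ}
    (hV : ∀ s', V s' ∈ Set.Icc (0 : ℝ) ((H : ℝ) - ((h : ℕ) + 1 : ℕ))) (s : S) (a : A) :
    M.r i h s a + ∑ s', (M.trans h s a : S → ℝ) s' * V s' ≤ optQ T δ D i h V s a := by
  have hr := M.r_mem_Icc i h s a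
  have h1 := abs_le.1 (hD.reward i h s a)
  have hh : (0 : ℝ) ≤ ((h : ℕ) + 1 : ℕ) := Nat.cast_nonneg _
  have h2 := abs_le.1 (hD.trans h s a V fun s' => ⟨(hV s').1, (hV s').2.trans (by linarith)⟩)
  have h3 := stdSimplex_sum_mul_le (M.trans h s a) fun s' => (hV s').2
  push_cast at h3
  refine le_max_of_le_right (le_min ?_ ?_)
  · linarith
  · linarith [hr.2]

/-- Each bonus enters twice: once because it is added, once for the estimation error it controls.
Truncation from below costs nothing, the right side being nonnegative. -/
lemma Accurate.optQ_le {M : MOMDP S A H m} {D : Fin n → Traj S A H m} (hD : Accurate M T δ D)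
    (i : Fin m) (h : Fin H) {V : S → ℝ}
    (hV : ∀ s', V s' ∈ Set.Icc (0 : ℝ) ((H : ℝ) - ((h : ℕ) + 1 : ℕ))) (s : S) (a : A) :
    optQ T δ D i h V s a ≤ M.r i h s a + 2 * bonus T δ D h s a +
      ∑ s', (M.trans h s a : S → ℝ) s' * V s' := by
  have hr := M.r_mem_Icc i h s a
  have h1 := abs_le.1 (hD.reward i h s a)
  have hh : (0 : ℝ) ≤ ((h : ℕ) + 1 : ℕ) := Nat.cast_nonneg _
  have h2 := abs_le.1 (hD.trans h s a V fun s' => ⟨(hV s').1, (hV s').2.trans (by linarith)⟩)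
  have h3 := le_stdSimplex_sum_mul (M.trans h s a) fun s' => (hV s').1
  have hb := bonus_nonneg (T := T) (δ := δ) D h s a
  refine max_le (by linarith [hr.1]) ((min_le_left _ _).trans ?_)
  unfold bonus at *
  linarith

lemma Accurate.optV_le {M : MOMDP S A H m} {D : Fin n → Traj S A H m} (hD : Accurate M T δ D)
    (i : Fin m) (π : Policy S A H) {h : ℕ} (hh : h ≤ H) (s : S) :
    optV T δ D i π h s ≤
      M.stageValue (fun h s a => M.r i h s a + 2 * bonus T δ D h s a) π h s := by
  revert s
  refine backward_induction (p := fun h => ∀ s, optV T δ D i π h s ≤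
    M.stageValue (fun h s a => M.r i h s a + 2 * bonus T δ D h s a) π h s) ?_ ?_ hh
  · intro s
    rw [optV_end, M.stageValue_of_le _ _ le_rfl]
  · intro h ih s
    rw [optV_of_lt, M.stageValue_of_lt]
    refine Finset.sum_le_sum fun a _ => mul_le_mul_of_nonneg_right ?_ (stdSimplex.zero_le _ _)
    refine (hD.optQ_le i h (fun s' => optV_mem_Icc D i π h.2 s') s a).trans ?_
    refine add_le_add le_rfl (Finset.sum_le_sum fun s' _ => ?_)
    exact mul_le_mul_of_nonneg_left (ih s') (stdSimplex.zero_le _ _)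

/-- If `π` is greedy for a nonnegative combination of the optimistic Q-functions, the combination
of its optimistic values is at least the same combination of the values of any policy. -/
lemma Accurate.sum_stageValue_le {M : MOMDP S A H m} {D : Fin n → Traj S A H m}
    (hD : Accurate M T δ D) {c : Fin m → ℝ} (hc : ∀ i, 0 ≤ c i) {π : Policy S A H}
    (hπ : ∀ h s (p : stdSimplex ℝ A), ∑ a, (∑ i, c i * estQ T δ D i π h s a) * (p : A → ℝ) a ≤
      ∑ a, (∑ i, c i * estQ T δ D i π h s a) * (π h s : A → ℝ) a)
    (π' : Policy S A H) {h : ℕ} (hh : h ≤ H) (s : S) :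
    ∑ i, c i * M.stageValue (M.r i) π' h s ≤ ∑ i, c i * optV T δ D i π h s := by
  revert s
  refine backward_induction (p := fun h => ∀ s, ∑ i, c i * M.stageValue (M.r i) π' h s ≤
    ∑ i, c i * optV T δ D i π h s) ?_ ?_ hh
  · intro s
    simp [optV_end, M.stageValue_of_le]
  · intro h ih s
    have e1 : ∑ i, c i * optV T δ D i π h s =
        ∑ a, (∑ i, c i * estQ T δ D i π h s a) * (π h s : A → ℝ) a := by
      simp_rw [optV_of_lt, Finset.mul_sum, Finset.sum_mul]
      rw [Finset.sum_comm]
      simp_rw [mul_assoc]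
    have e2 : ∑ i, c i * M.stageValue (M.r i) π' h s = ∑ a, (∑ i, c i * (M.r i h s a +
        ∑ s', (M.trans h s a : S → ℝ) s' * M.stageValue (M.r i) π' (h + 1) s')) *
          (π' h s : A → ℝ) a := by
      simp_rw [M.stageValue_of_lt, Finset.mul_sum, Finset.sum_mul]
      rw [Finset.sum_comm]
      simp_rw [mul_assoc]
    rw [e1, e2]
    -- Greediness is available only for the combination over objectives, since all of them share one
    -- policy. So the induction compares weighted sums; the individual optimistic values need not
    -- dominate those of `π'`.
    refine le_trans ?_ (hπ h s (π' h s))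
    refine Finset.sum_le_sum fun a _ => mul_le_mul_of_nonneg_right ?_ (stdSimplex.zero_le _ _)
    calc ∑ i, c i * (M.r i h s a +
        ∑ s', (M.trans h s a : S → ℝ) s' * M.stageValue (M.r i) π' (h + 1) s')
        = ∑ i, c i * M.r i h s a + ∑ s', (M.trans h s a : S → ℝ) s' *
            ∑ i, c i * M.stageValue (M.r i) π' (h + 1) s' := by
          simp_rw [mul_add, Finset.sum_add_distrib, Finset.mul_sum]
          rw [Finset.sum_comm]
          simp_rw [mul_left_comm]
      _ ≤ ∑ i, c i * M.r i h s a + ∑ s', (M.trans h s a : S → ℝ) s' *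
            ∑ i, c i * optV T δ D i π (h + 1) s' := by
          refine add_le_add le_rfl (Finset.sum_le_sum fun s' _ => ?_)
          exact mul_le_mul_of_nonneg_left (ih s') (stdSimplex.zero_le _ _)
      _ = ∑ i, c i * (M.r i h s a +
            ∑ s', (M.trans h s a : S → ℝ) s' * optV T δ D i π (h + 1) s') := by
          simp_rw [mul_add, Finset.sum_add_distrib, Finset.mul_sum]
          rw [Finset.sum_comm]
          simp_rw [mul_left_comm]
      _ ≤ _ := Finset.sum_le_sum fun i _ => mul_le_mul_of_nonneg_left
          (hD.le_optQ i h (fun s' => optV_mem_Icc D i π h.2 s') s a) (hc i)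

end Optimism

/-! ### From deviation bounds to accurate models. -/

section Accuracy

variable {S : Type u} {A : Type v} [Fintype S] [Fintype A] [DecidableEq S] [DecidableEq A]
  {H m n T : ℕ} {δ : ℝ}

lemma visitSum_sub_const (X : (Fin m → ℝ) → S → ℝ) (p : ℝ) (D : Fin n → Traj S A H m) (h : Fin H)
    (s : S) (a : A) : visitSum (fun x s' => X x s' - p) D h s a =
      visitSum X D h s a - p * visits D h s a := by
  rw [visits_eq_sum, visitSum, visitSum, Finset.mul_sum, ← Finset.sum_sub_distrib]
  refine Finset.sum_congr rfl fun τ _ => ?_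
  split_ifs <;> ring

lemma visitSum_neg (X : (Fin m → ℝ) → S → ℝ) (D : Fin n → Traj S A H m) (h : Fin H)
    (s : S) (a : A) : visitSum (fun x s' => - X x s') D h s a = - visitSum X D h s a := by
  rw [visitSum, visitSum, ← Finset.sum_neg_distrib]
  refine Finset.sum_congr rfl fun τ _ => ?_
  split_ifs <;> ring

lemma sum_transitions (B : Finset S) (D : Fin n → Traj S A H m) (h : Fin H) (s : S) (a : A) :
    ∑ s' ∈ B, (transitions D h s a s' : ℝ) =
      visitSum (fun _ s' => if s' ∈ B then 1 else 0) D h s a := by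
  simp_rw [transitions, Finset.card_filter]
  push_cast
  rw [Finset.sum_comm, visitSum]
  refine Finset.sum_congr rfl fun τ _ => ?_
  by_cases hv : (D τ h).1 = s ∧ (D τ h).2.1 = a
  · rw [if_pos hv]
    simp only [hv.1, hv.2, true_and, Finset.sum_ite_eq]
  · rw [if_neg hv]
    refine Finset.sum_eq_zero fun s' _ => if_neg fun h' => hv ⟨h'.1, h'.2.1⟩

lemma sum_transitions_univ (D : Fin n → Traj S A H m) (h : Fin H) (s : S) (a : A) :
    ∑ s', (transitions D h s a s' : ℝ) = visits D h s a := by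
  rw [sum_transitions, visits_eq_sum, visitSum]
  simp

lemma rewardEst_eq (D : Fin n → Traj S A H m) (i : Fin m) (h : Fin H) (s : S) (a : A) :
    rewardEst D i h s a = visitSum (fun x _ => x i) D h s a / max (visits D h s a : ℝ) 1 := rfl

lemma rewardEst_mem_Icc {D : Fin n → Traj S A H m}
    (hD : ∀ τ h i, (D τ h).2.2.1 i ∈ Set.Icc (0 : ℝ) 1) (i : Fin m) (h : Fin H) (s : S) (a : A) :
    rewardEst D i h s a ∈ Set.Icc (0 : ℝ) 1 := by
  have hpos : (0 : ℝ) < max (visits D h s a : ℝ) 1 := lt_max_of_lt_right one_pos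
  constructor
  · refine div_nonneg (Finset.sum_nonneg fun τ _ => ?_) hpos.le
    split_ifs
    exacts [(hD τ h i).1, le_rfl]
  · rw [rewardEst, div_le_one hpos]
    refine le_max_of_le_left ?_
    rw [visits_eq_sum]
    refine Finset.sum_le_sum fun τ _ => ?_
    split_ifs
    exacts [(hD τ h i).2, le_rfl]

lemma sum_transEst_mul_mem_Icc (D : Fin n → Traj S A H m) (h : Fin H) (s : S) (a : A) {V : S → ℝ}
    {c : ℝ} (hV : ∀ s', V s' ∈ Set.Icc (0 : ℝ) c) (hc : 0 ≤ c) :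
    ∑ s', transEst D h s a s' * V s' ∈ Set.Icc (0 : ℝ) c := by
  have hpos : (0 : ℝ) < max (visits D h s a : ℝ) 1 := lt_max_of_lt_right one_pos
  have h0 : ∀ s', 0 ≤ transEst D h s a s' := fun s' => div_nonneg (Nat.cast_nonneg _) hpos.le
  refine ⟨Finset.sum_nonneg fun s' _ => mul_nonneg (h0 s') (hV s').1, ?_⟩
  calc ∑ s', transEst D h s a s' * V s' ≤ ∑ s', transEst D h s a s' * c :=
        Finset.sum_le_sum fun s' _ => mul_le_mul_of_nonneg_left (hV s').2 (h0 s')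
    _ = (visits D h s a / max (visits D h s a : ℝ) 1) * c := by
        rw [← Finset.sum_mul]
        simp_rw [transEst]
        rw [← Finset.sum_div, sum_transitions_univ]
    _ ≤ c := mul_le_of_le_one_left hc ((div_le_one hpos).2 (le_max_left _ _))

/-- The sum is largest when `V` equals `c` where `d` is positive and `0` elsewhere, so subset sums
control all test functions. This makes a union over the `2 ^ |S|` subsets sufficient for a bound
uniform in the data-dependent `V`. -/
lemma sum_mul_le_of_sum_finset_le {d V : S → ℝ} {c e : ℝ} (hc : 0 ≤ c)
    (hV : ∀ s, V s ∈ Set.Icc 0 c) (hd : ∀ B : Finset S, ∑ s ∈ B, d s ≤ e) :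
    ∑ s, d s * V s ≤ c * e := by
  calc ∑ s, d s * V s ≤ ∑ s, if 0 < d s then c * d s else 0 := by
        refine Finset.sum_le_sum fun s _ => ?_
        split_ifs with h
        · rw [mul_comm]
          exact mul_le_mul_of_nonneg_right (hV s).2 h.le
        · exact mul_nonpos_of_nonpos_of_nonneg (not_lt.1 h) (hV s).1
    _ = c * ∑ s with 0 < d s, d s := by rw [← Finset.sum_filter, Finset.mul_sum]
    _ ≤ c * e := mul_le_mul_of_nonneg_left (hd _) hc

lemma accurate_of_visitSum_lt {M : MOMDP S A H m} {D : Fin n → Traj S A H m}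
    (hℓ : 1 ≤ bonusLog S A H m T δ) (hD : ∀ τ h i, (D τ h).2.2.1 i ∈ Set.Icc (0 : ℝ) 1)
    (hr : ∀ h s a i, 0 < visits D h s a → visitSum (fun x _ => x i - M.r i h s a) D h s a <
      Real.sqrt (2 * bonusLog S A H m T δ / visits D h s a) * visits D h s a)
    (hr' : ∀ h s a i, 0 < visits D h s a → visitSum (fun x _ => M.r i h s a - x i) D h s a <
      Real.sqrt (2 * bonusLog S A H m T δ / visits D h s a) * visits D h s a)
    (ht : ∀ h s a (B : Finset S), 0 < visits D h s a →
      visitSum (fun _ s' => (if s' ∈ B then 1 else 0) - ∑ s' ∈ B, (M.trans h s a : S → ℝ) s')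
        D h s a <
      Real.sqrt (2 * (Fintype.card S * bonusLog S A H m T δ) / visits D h s a) *
        visits D h s a) :
    Accurate M T δ D := by
  set ℓ := bonusLog S A H m T δ with hℓ'
  constructor
  · intro i h s a
    have h1 := rewardEst_mem_Icc hD i h s a
    have h2 := M.r_mem_Icc i h s a
    refine le_min ?_ (abs_le.2 ⟨by linarith [h1.1, h2.2], by linarith [h1.2, h2.1]⟩)
    -- Without visits the untruncated bonus is at least `1`, because `ℓ ≥ 1`, and the trivial bound
    -- is enough.
    rcases Nat.eq_zero_or_pos (visits D h s a) with h0 | hpos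
    · rw [h0]
      have : (1 : ℝ) ≤ Real.sqrt (2 * ℓ / max ((0 : ℕ) : ℝ) 1) := by
        rw [Real.one_le_sqrt]; simp; linarith
      exact le_trans (abs_le.2 ⟨by linarith [h1.1, h2.2], by linarith [h1.2, h2.1]⟩) this
    · have hN : (0 : ℝ) < visits D h s a := Nat.cast_pos.2 hpos
      have hmax : max (visits D h s a : ℝ) 1 = visits D h s a :=
        max_eq_left (Nat.one_le_cast.2 hpos)
      have e1 := hr h s a i hpos
      have e2 := hr' h s a i hpos
      rw [visitSum_sub_const (fun x _ => x i)] at e1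
      have e3 : visitSum (fun x (_ : S) => M.r i h s a - x i) D h s a =
          -visitSum (fun x (_ : S) => x i - M.r i h s a) D h s a := by
        rw [← visitSum_neg]; simp
      rw [e3, visitSum_sub_const (fun x _ => x i)] at e2
      rw [rewardEst_eq, hmax]
      have e4 : visitSum (fun x _ => x i) D h s a / (visits D h s a : ℝ) - M.r i h s a =
          (visitSum (fun x _ => x i) D h s a - M.r i h s a * visits D h s a) /
            visits D h s a := by field_simp
      rw [e4, abs_le]
      constructor
      · rw [le_div_iff₀ hN]; linarith
      · rw [div_le_iff₀ hN]; linarith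
  · intro h s a V hV
    have hH : (0 : ℝ) ≤ H := Nat.cast_nonneg _
    have h1 := sum_transEst_mul_mem_Icc D h s a hV hH
    have h2 : ∑ s', (M.trans h s a : S → ℝ) s' * V s' ∈ Set.Icc (0 : ℝ) H :=
      ⟨le_stdSimplex_sum_mul _ fun s' => (hV s').1, stdSimplex_sum_mul_le _ fun s' => (hV s').2⟩
    have hab : |∑ s', transEst D h s a s' * V s' - ∑ s', (M.trans h s a : S → ℝ) s' * V s'| ≤ H :=
      abs_le.2 ⟨by linarith [h1.1, h2.2], by linarith [h1.2, h2.1]⟩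
    refine le_min ?_ hab
    have hS : (1 : ℝ) ≤ Fintype.card S := by
      exact_mod_cast Fintype.card_pos_iff.2 ⟨s⟩
    rcases Nat.eq_zero_or_pos (visits D h s a) with h0 | hpos
    · rw [h0]
      refine hab.trans (Real.le_sqrt_of_sq_le ?_)
      have : (1 : ℝ) ≤ Fintype.card S * ℓ := one_le_mul_of_one_le_of_one_le hS hℓ
      simp only [CharP.cast_eq_zero, zero_le_one, sup_of_le_right, div_one]
      nlinarith [sq_nonneg (H : ℝ)]
    · have hN : (0 : ℝ) < visits D h s a := Nat.cast_pos.2 hpos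
      have hmax : max (visits D h s a : ℝ) 1 = visits D h s a :=
        max_eq_left (Nat.one_le_cast.2 hpos)
      set ε := Real.sqrt (2 * (Fintype.card S * ℓ) / visits D h s a) with hε
      have hsq : Real.sqrt (2 * (H : ℝ) ^ 2 * Fintype.card S * ℓ / max (visits D h s a : ℝ) 1) =
          H * ε := by
        rw [hmax, hε, show 2 * (H : ℝ) ^ 2 * Fintype.card S * ℓ / visits D h s a =
          (H : ℝ) ^ 2 * (2 * (Fintype.card S * ℓ) / visits D h s a) by ring,
          Real.sqrt_mul (sq_nonneg _), Real.sqrt_sq hH]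
      have key : ∀ B : Finset S,
          ∑ s' ∈ B, (transEst D h s a s' - (M.trans h s a : S → ℝ) s') ≤ ε := by
        intro B
        have := ht h s a B hpos
        rw [visitSum_sub_const (fun _ s' => if s' ∈ B then 1 else 0), ← sum_transitions] at this
        rw [Finset.sum_sub_distrib]
        simp_rw [transEst]
        rw [← Finset.sum_div, hmax, sub_le_iff_le_add, div_le_iff₀ hN]
        linarith
      have htot : ∑ s', (transEst D h s a s' - (M.trans h s a : S → ℝ) s') = 0 := by
        rw [Finset.sum_sub_distrib, stdSimplex.sum_eq_one]
        simp_rw [transEst]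
        rw [← Finset.sum_div, sum_transitions_univ, hmax, div_self hN.ne', sub_self]
      -- The differences sum to zero, so the negative deviation on `B` is the positive deviation on
      -- its complement; no second family of events is needed.
      have key' : ∀ B : Finset S,
          ∑ s' ∈ B, ((M.trans h s a : S → ℝ) s' - transEst D h s a s') ≤ ε := by
        intro B
        have h3 := key Bᶜ
        have h4 := Finset.sum_add_sum_compl B
          (fun s' => transEst D h s a s' - (M.trans h s a : S → ℝ) s')
        rw [htot] at h4
        have h5 : ∑ s' ∈ B, ((M.trans h s a : S → ℝ) s' - transEst D h s a s') =
            -∑ s' ∈ B, (transEst D h s a s' - (M.trans h s a : S → ℝ) s') := by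
          rw [← Finset.sum_neg_distrib]; simp
        linarith
      rw [hsq, abs_le]
      have g1 := sum_mul_le_of_sum_finset_le hH hV key
      have g2 := sum_mul_le_of_sum_finset_le hH hV key'
      simp_rw [sub_mul, Finset.sum_sub_distrib] at g1 g2
      exact ⟨by linarith, g1⟩

end Accuracy

/-! ### The bonuses collected along the realised episodes. -/

section Pigeonhole

variable {S : Type u} {A : Type v} [Fintype S] [Fintype A] [DecidableEq S] [DecidableEq A]
  {H m T : ℕ}

/-- The first `n` episodes of a dataset. -/
def initial (D : Fin T → Traj S A H m) (n : Fin T) : Fin n → Traj S A H m :=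
  fun j => D (Fin.castLE n.2.le j)

/-- For `N ≥ 1` the difference of roots is `1 / (√(N+1) + √N)` and `√(N+1) ≤ 2 √N`, which gives the
constant `3`; it also covers `N = 0`. -/
lemma one_div_sqrt_max_le (N : ℕ) :
    1 / Real.sqrt (max (N : ℝ) 1) ≤ 3 * Real.sqrt (N + 1 : ℝ) - 3 * Real.sqrt N := by
  rcases Nat.eq_zero_or_pos N with rfl | hN
  · norm_num
  · have h1 : (1 : ℝ) ≤ N := Nat.one_le_cast.2 hN
    rw [max_eq_left h1]
    set x := Real.sqrt N with hx
    set y := Real.sqrt (N + 1 : ℝ) with hy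
    have hx0 : 0 < x := Real.sqrt_pos.2 (by linarith)
    have hxx : x ^ 2 = N := Real.sq_sqrt (by linarith)
    have hyy : y ^ 2 = N + 1 := Real.sq_sqrt (by linarith)
    have hy2 : y ≤ 2 * x := by
      refine Real.sqrt_le_iff.2 ⟨by linarith, ?_⟩
      nlinarith
    have hxy : x ≤ y := Real.sqrt_le_sqrt (by linarith)
    rw [div_le_iff₀ hx0]
    nlinarith

/-- At a fixed step each episode visits exactly one pair, whose count is taken before that episode
and then increases by one. The bound by differences of roots therefore telescopes pair by pair. -/
lemma sum_one_div_sqrt_visits_le (D : Fin T → Traj S A H m) (h : Fin H) :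
    ∑ n : Fin T, 1 / Real.sqrt (max (visits (initial D n) h (D n h).1 (D n h).2.1 : ℝ) 1) ≤
      ∑ s, ∑ a, 3 * Real.sqrt (visits D h s a) := by
  induction T with
  | zero => simp [visits]
  | succ T ih =>
    rw [Fin.sum_univ_castSucc]
    let D' : Fin T → Traj S A H m := fun j => D j.castSucc
    have h1 := ih D'
    have h2 : ∀ s a, (visits D h s a : ℝ) = visits D' h s a +
        if (D (Fin.last T) h).1 = s ∧ (D (Fin.last T) h).2.1 = a then (1 : ℝ) else 0 := by
      intro s a
      rw [visits_eq_sum, visits_eq_sum, Fin.sum_univ_castSucc]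
    set s₀ := (D (Fin.last T) h).1
    set a₀ := (D (Fin.last T) h).2.1
    have h3 : ∑ s, ∑ a, (3 * Real.sqrt (visits D h s a) - 3 * Real.sqrt (visits D' h s a)) =
        3 * Real.sqrt (visits D' h s₀ a₀ + 1 : ℝ) - 3 * Real.sqrt (visits D' h s₀ a₀) := by
      rw [Finset.sum_eq_single s₀, Finset.sum_eq_single a₀]
      · rw [h2, if_pos ⟨rfl, rfl⟩]
      · intro a _ ha
        rw [h2, if_neg fun h' => ha h'.2.symm, add_zero, sub_self]
      · simp
      · intro s _ hs
        refine Finset.sum_eq_zero fun a _ => ?_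
        rw [h2, if_neg fun h' => hs h'.1.symm, add_zero, sub_self]
      · simp
    have h4 := one_div_sqrt_max_le (visits D' h s₀ a₀)
    simp_rw [Finset.sum_sub_distrib] at h3
    have h5 : 1 / Real.sqrt (max (visits (initial D (Fin.last T)) h s₀ a₀ : ℝ) 1) ≤
      3 * Real.sqrt (visits D' h s₀ a₀ + 1 : ℝ) - 3 * Real.sqrt (visits D' h s₀ a₀) := h4
    have h6 : ∑ n : Fin T, 1 / Real.sqrt (max (visits (initial D n.castSucc) h (D n.castSucc h).1
      (D n.castSucc h).2.1 : ℝ) 1) ≤ ∑ s, ∑ a, 3 * Real.sqrt (visits D' h s a) := h1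
    linarith

lemma sum_visits (D : Fin T → Traj S A H m) (h : Fin H) :
    ∑ s, ∑ a, (visits D h s a : ℝ) = T := by
  simp_rw [visits_eq_sum]
  have : ∀ s : S, ∑ a : A, ∑ τ : Fin T,
      (if (D τ h).1 = s ∧ (D τ h).2.1 = a then (1 : ℝ) else 0) =
      ∑ τ : Fin T, if (D τ h).1 = s then (1 : ℝ) else 0 := by
    intro s
    rw [Finset.sum_comm]
    refine Finset.sum_congr rfl fun τ _ => ?_
    by_cases hs : (D τ h).1 = s <;> simp [hs]
  simp_rw [this]
  rw [Finset.sum_comm]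
  simp

/-- Cauchy-Schwarz over the pairs, whose counts add up to `T`. -/
lemma sum_sqrt_visits_le (D : Fin T → Traj S A H m) (h : Fin H) :
    ∑ s, ∑ a, Real.sqrt (visits D h s a) ≤
      Real.sqrt (Fintype.card S * Fintype.card A * T) := by
  refine Real.le_sqrt_of_sq_le ?_
  have := sq_sum_le_card_mul_sum_sq (s := (Finset.univ : Finset (S × A)))
    (f := fun z => Real.sqrt (visits D h z.1 z.2))
  simp_rw [Real.sq_sqrt (Nat.cast_nonneg _), Fintype.sum_prod_type, sum_visits] at this
  simpa using this

variable {δ : ℝ}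

lemma bonus_le_div_sqrt {n : ℕ} {T₀ : ℕ} (hℓ : 0 ≤ bonusLog S A H m T₀ δ)
    (D : Fin n → Traj S A H m) (h : Fin H) (s : S) (a : A) :
    bonus T₀ δ D h s a ≤ 2 * Real.sqrt (2 * (H : ℝ) ^ 2 * Fintype.card S * bonusLog S A H m T₀ δ) *
      (1 / Real.sqrt (max (visits D h s a : ℝ) 1)) := by
  have hS : (1 : ℝ) ≤ Fintype.card S := by
    exact_mod_cast Fintype.card_pos_iff.2 ⟨s⟩
  have hH : (1 : ℝ) ≤ (H : ℝ) ^ 2 := one_le_pow₀ (Nat.one_le_cast.2 (Nat.one_le_of_lt h.2))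
  have hN : (0 : ℝ) ≤ max (visits D h s a : ℝ) 1 := le_max_of_le_right zero_le_one
  have h1 : transBonus T₀ δ D h s a ≤ _ := min_le_left _ _
  have h2 : rewardBonus T₀ δ D h s a ≤ _ := min_le_left _ _
  rw [Real.sqrt_div' _ hN] at h1 h2
  have h3 : Real.sqrt (2 * bonusLog S A H m T₀ δ) ≤
      Real.sqrt (2 * (H : ℝ) ^ 2 * Fintype.card S * bonusLog S A H m T₀ δ) := by
    refine Real.sqrt_le_sqrt ?_
    have := one_le_mul_of_one_le_of_one_le hH hS
    nlinarith
  have h4 := div_le_div_of_nonneg_right h3 (Real.sqrt_nonneg (max (visits D h s a : ℝ) 1))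
  unfold bonus
  rw [mul_one_div, mul_div_assoc]
  linarith

lemma sum_bonus_le {T₀ : ℕ} (hℓ : 0 ≤ bonusLog S A H m T₀ δ) (D : Fin T → Traj S A H m) :
    ∑ n : Fin T, ∑ h, bonus T₀ δ (initial D n) h (D n h).1 (D n h).2.1 ≤
      6 * (H * (Real.sqrt (2 * (H : ℝ) ^ 2 * Fintype.card S * bonusLog S A H m T₀ δ) *
        Real.sqrt (Fintype.card S * Fintype.card A * T))) := by
  rw [Finset.sum_comm]
  set K := Real.sqrt (2 * (H : ℝ) ^ 2 * Fintype.card S * bonusLog S A H m T₀ δ)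
  have hK : 0 ≤ K := Real.sqrt_nonneg _
  calc _ ≤ ∑ _ : Fin H, 2 * K * (3 * Real.sqrt (Fintype.card S * Fintype.card A * T)) := by
        refine Finset.sum_le_sum fun h _ => ?_
        calc _ ≤ ∑ n : Fin T, 2 * K *
              (1 / Real.sqrt (max (visits (initial D n) h (D n h).1 (D n h).2.1 : ℝ) 1)) :=
              Finset.sum_le_sum fun n _ => bonus_le_div_sqrt hℓ _ _ _ _
          _ ≤ _ := by
              rw [← Finset.mul_sum]
              refine mul_le_mul_of_nonneg_left ?_ (by positivity)
              refine (sum_one_div_sqrt_visits_le D h).trans ?_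
              simp_rw [← Finset.mul_sum]
              exact mul_le_mul_of_nonneg_left (sum_sqrt_visits_le D h) (by norm_num)
    _ = _ := by
        rw [Finset.sum_const, Finset.card_univ, Fintype.card_fin, nsmul_eq_mul]
        ring

end Pigeonhole

/-! ### The good event and its probability. -/

section GoodEvent

variable {S : Type u} {A : Type v} [Fintype S] [Fintype A] [DecidableEq S] [DecidableEq A]
  [MeasurableSpace S] [MeasurableSpace A] {H m : ℕ}

/-- Total bonus collected along an episode. -/
noncomputable def bonusSum (T : ℕ) (δ : ℝ) {n : ℕ} (D : Fin n → Traj S A H m)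
    (τ : Traj S A H m) : ℝ :=
  ∑ h, bonus T δ D h (τ h).1 (τ h).2.1

/-- Conditional expectation of the total bonus collected in the next episode of the dataset `d`. -/
noncomputable def Learner.expectedBonus (L : Learner S A H m) (M : MOMDP S A H m) (T : ℕ) (δ : ℝ)
    (d : Option (Fin m)) (n : ℕ) (past : Fin n → Round S A H m) : ℝ :=
  ∫ τ, bonusSum T δ (dataset d past) τ ∂(M.episode (L.policy d n past))

lemma bonusSum_mem_Icc (T : ℕ) (δ : ℝ) {n : ℕ} (D : Fin n → Traj S A H m) (τ : Traj S A H m) :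
    bonusSum T δ D τ ∈ Set.Icc (0 : ℝ) (2 * (H : ℝ) ^ 2) := by
  refine ⟨Finset.sum_nonneg fun h _ => bonus_nonneg _ _ _ _, ?_⟩
  calc bonusSum T δ D τ ≤ ∑ _ : Fin H, (2 * H : ℝ) := Finset.sum_le_sum fun h _ => bonus_le _ _ _ _
    _ = 2 * (H : ℝ) ^ 2 := by simp; ring

variable [MeasurableSingletonClass S] [MeasurableSingletonClass A]

lemma measurable_policy {L : Learner S A H m} (h₁ : ∀ n, Measurable (L.main n))
    (h₂ : ∀ n, Measurable (L.aux n)) (d : Option (Fin m)) (n : ℕ) :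
    Measurable (L.policy d n) := by
  cases d with
  | none => exact h₁ n
  | some i => exact (measurable_pi_apply i).comp (h₂ n)

lemma measurable_bonus (T : ℕ) (δ : ℝ) {n : ℕ} (h : Fin H) (s : S) (a : A) :
    Measurable fun D : Fin n → Traj S A H m => bonus T δ D h s a := by
  have hv := measurable_visits (m := m) (n := n) h s a
  unfold bonus transBonus rewardBonus
  have hmax : Measurable fun D : Fin n → Traj S A H m => max (visits D h s a : ℝ) 1 :=
    hv.max measurable_const
  exact (((hmax.const_div _).sqrt).min measurable_const).add
    (((hmax.const_div _).sqrt).min measurable_const)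

lemma measurable_bonusSum (T : ℕ) (δ : ℝ) (d : Option (Fin m)) (n : ℕ) :
    Measurable fun p : (Fin n → Round S A H m) × Traj S A H m =>
      bonusSum T δ (dataset d p.1) p.2 := by
  unfold bonusSum
  refine Finset.measurable_fun_sum _ fun h _ => ?_
  have hg : Measurable fun q : (Fin n → Traj S A H m) × (S × A) =>
      bonus T δ q.1 h q.2.1 q.2.2 :=
    measurable_from_prod_countable_left fun z => measurable_bonus T δ h z.1 z.2
  have hx : Measurable fun τ : Traj S A H m => ((τ h).1, (τ h).2.1) := by fun_prop
  have hp : Measurable fun p : (Fin n → Round S A H m) × Traj S A H m =>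
      (dataset d p.1, ((p.2 h).1, (p.2 h).2.1)) :=
    ((measurable_dataset d).comp measurable_fst).prodMk (hx.comp measurable_snd)
  have hc := hg.comp hp
  simp only [Function.comp_def] at hc
  exact hc

lemma measurable_expectedBonus {L : Learner S A H m} (M : MOMDP S A H m)
    (h₁ : ∀ n, Measurable (L.main n)) (h₂ : ∀ n, Measurable (L.aux n)) (T : ℕ) (δ : ℝ)
    (d : Option (Fin m)) (n : ℕ) : Measurable (L.expectedBonus M T δ d n) := by
  let κ : Kernel (Fin n → Round S A H m) (Traj S A H m) :=
    ⟨fun past => M.episode (L.policy d n past),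
      (measurable_episode M).comp (measurable_policy h₁ h₂ d n)⟩
  have : IsMarkovKernel κ := ⟨fun past => isProbabilityMeasure_episode _ _⟩
  exact ((measurable_bonusSum T δ d n).stronglyMeasurable.integral_kernel_prod_right'
    (κ := κ)).measurable

/-- Azuma-Hoeffding: given the past, the total bonus of an episode lies in an interval of length `2
H ^ 2`. -/
lemma run_sum_expectedBonus_ge_le {L : Learner S A H m} (M : MOMDP S A H m)
    (h₁ : ∀ n, Measurable (L.main n)) (h₂ : ∀ n, Measurable (L.aux n)) (d : Option (Fin m))
    (T₀ : ℕ) (δ : ℝ) {T : ℕ} (hT : 0 < T) (hH : 0 < H) {c : ℝ} (hc : 0 ≤ c) :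
    L.run M T {rec | (H : ℝ) ^ 2 * Real.sqrt (2 * T * c) ≤
      ∑ n : Fin T, (L.expectedBonus M T₀ δ d n (restrict n.2.le rec) -
        bonusSum T₀ δ (initial (dataset d rec) n) (dataset d rec n))} ≤
      ENNReal.ofReal (Real.exp (-c)) := by
  have hT' : (0 : ℝ) < T := Nat.cast_pos.2 hT
  have hH' : (0 : ℝ) < H := Nat.cast_pos.2 hH
  set ε : ℝ := (H : ℝ) ^ 2 * Real.sqrt (2 * T * c) with hε
  have hε2 : ε ^ 2 = (H : ℝ) ^ 4 * (2 * T * c) := by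
    rw [hε, mul_pow, Real.sq_sqrt (by positivity)]; ring
  -- Maximiser of `θ ε - T θ ^ 2 H ^ 4 / 2`; the maximum `ε ^ 2 / (2 T H ^ 4)` equals `c`.
  set θ : ℝ := ε / (T * (H : ℝ) ^ 4) with hθ
  have hθ0 : 0 ≤ θ := by positivity
  let W : (n : ℕ) → (Fin n → Round S A H m) → Traj S A H m → ℝ := fun n past τ =>
    θ * (L.expectedBonus M T₀ δ d n past - bonusSum T₀ δ (dataset d past) τ) -
      θ ^ 2 * (H : ℝ) ^ 4 / 2
  have hW : ∀ n, Measurable fun p : (Fin n → Round S A H m) × Traj S A H m => W n p.1 p.2 := by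
    intro n
    have hE : Measurable fun p : (Fin n → Round S A H m) × Traj S A H m =>
        L.expectedBonus M T₀ δ d n p.1 :=
      (measurable_expectedBonus M h₁ h₂ T₀ δ d n).comp measurable_fst
    exact ((hE.sub (measurable_bonusSum T₀ δ d n)).const_mul _).sub_const _
  have hstep : ∀ n past, ∫⁻ τ, ENNReal.ofReal (Real.exp (W n past τ))
      ∂(M.episode (L.policy d n past)) ≤ 1 := by
    intro n past
    have hm : Measurable (bonusSum T₀ δ (dataset d past)) := by
      have hc := (measurable_bonusSum T₀ δ d n).comp (measurable_prodMk_left (x := past))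
      simp only [Function.comp_def] at hc
      exact hc
    have := lintegral_exp_centered_le (ρ := M.episode (L.policy d n past)) hm
      (Filter.Eventually.of_forall (bonusSum_mem_Icc T₀ δ (dataset d past))) (-θ)
    have hE : ∫ τ, bonusSum T₀ δ (dataset d past) τ ∂(M.episode (L.policy d n past)) =
      L.expectedBonus M T₀ δ d n past := rfl
    rw [hE] at this
    have hWe : ∀ τ, W n past τ = -θ * (bonusSum T₀ δ (dataset d past) τ -
        L.expectedBonus M T₀ δ d n past) - (-θ) ^ 2 * (2 * (H : ℝ) ^ 2 - 0) ^ 2 / 8 := by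
      intro τ
      simp only [W]
      ring
    simp only [hWe]
    exact this
  refine le_trans (measure_mono ?_) (run_predictableSum_ge_le M h₁ h₂ d hW hstep T c)
  intro rec hrec
  have e : predictableSum d W T rec = θ * ∑ n : Fin T,
      (L.expectedBonus M T₀ δ d n (restrict n.2.le rec) -
        bonusSum T₀ δ (initial (dataset d rec) n) (dataset d rec n)) -
      T * (θ ^ 2 * (H : ℝ) ^ 4 / 2) := by
    simp only [predictableSum, W, Finset.sum_sub_distrib, ← Finset.mul_sum, Finset.sum_const,
      Finset.card_univ, Fintype.card_fin, nsmul_eq_mul]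
    rfl
  have h3 := mul_le_mul_of_nonneg_left (Set.mem_ofPred_eq ▸ hrec : ε ≤ _) hθ0
  have e2 : θ * ε - T * (θ ^ 2 * (H : ℝ) ^ 4 / 2) = c := by
    have : θ * ε - T * (θ ^ 2 * (H : ℝ) ^ 4 / 2) = ε ^ 2 / (2 * T * (H : ℝ) ^ 4) := by
      rw [hθ]; field_simp; ring
    rw [this, hε2]; field_simp
  simp only [Set.mem_ofPred_eq, e]
  linarith

/-- All estimates are accurate and the collected bonuses are close to their expectations. -/
def Learner.GoodRecord (L : Learner S A H m) (M : MOMDP S A H m) {T : ℕ} (δ : ℝ)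
    (rec : Fin T → Round S A H m) : Prop :=
  ∀ d : Option (Fin m),
    (∀ n, Accurate M T δ (initial (dataset d rec) n)) ∧
    ∑ n : Fin T, (L.expectedBonus M T δ d n (restrict n.2.le rec) -
      bonusSum T δ (initial (dataset d rec) n) (dataset d rec n)) ≤
        (H : ℝ) ^ 2 * Real.sqrt (2 * T * bonusLog S A H m T δ)

lemma run_not_goodRecord_le_sum {L : Learner S A H m} (M : MOMDP S A H m)
    (h₁ : ∀ n, Measurable (L.main n)) (h₂ : ∀ n, Measurable (L.aux n)) {T : ℕ} (hT : 0 < T)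
    (hH : 0 < H) {δ : ℝ} (hℓ : 1 ≤ bonusLog S A H m T δ) :
    L.run M T {rec | ¬ L.GoodRecord M δ rec} ≤
      ∑ _ : Option (Fin m), (∑ _ : Fin H, ∑ _ : S, ∑ _ : A,
        (∑ _ : Fin m, 2 * ENNReal.ofReal (T ^ 2 * Real.exp (-(4 * bonusLog S A H m T δ))) +
        ∑ _ : Finset S, ENNReal.ofReal (T ^ 2 *
          Real.exp (-(4 * (Fintype.card S * bonusLog S A H m T δ))))) +
        ENNReal.ofReal (Real.exp (-bonusLog S A H m T δ))) := by
  set ℓ := bonusLog S A H m T δ with hℓ'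
  have hℓ0 : 0 ≤ ℓ := zero_le_one.trans hℓ
  let dev : Option (Fin m) → Fin H → S → A → ((Fin m → ℝ) → S → ℝ) → ℝ →
      Set (Fin T → Round S A H m) := fun d h s a X c =>
    {rec | ∃ (n : ℕ) (hn : n < T),
      0 < visits (dataset d (restrict hn.le rec)) h s a ∧
      Real.sqrt (2 * c / visits (dataset d (restrict hn.le rec)) h s a) *
        visits (dataset d (restrict hn.le rec)) h s a ≤
          visitSum X (dataset d (restrict hn.le rec)) h s a}
  let E₁ := fun (d : Option (Fin m)) h s a i => dev d h s a (fun x _ => x i - M.r i h s a) ℓ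
  let E₂ := fun (d : Option (Fin m)) h s a i => dev d h s a (fun x _ => M.r i h s a - x i) ℓ
  let E₃ := fun (d : Option (Fin m)) h s a (B : Finset S) => dev d h s a
    (fun _ s' => (if s' ∈ B then 1 else 0) - ∑ s' ∈ B, (M.trans h s a : S → ℝ) s')
    (Fintype.card S * ℓ)
  let E₄ : Option (Fin m) → Set (Fin T → Round S A H m) := fun d =>
    {rec | (H : ℝ) ^ 2 * Real.sqrt (2 * T * ℓ) ≤
      ∑ n : Fin T, (L.expectedBonus M T δ d n (restrict n.2.le rec) -
        bonusSum T δ (initial (dataset d rec) n) (dataset d rec n))}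
  -- A null event; off it the empirical rewards lie in the unit interval, which the truncated reward
  -- bonus requires.
  let E₀ : Option (Fin m) → Set (Fin T → Round S A H m) := fun d =>
    {rec | ∃ τ h i, (dataset d rec τ h).2.2.1 i ∉ Set.Icc (0 : ℝ) 1}
  have hsub : {rec | ¬ L.GoodRecord M δ rec} ⊆ ⋃ d, (((⋃ h, ⋃ s, ⋃ a,
      ((⋃ i, (E₁ d h s a i ∪ E₂ d h s a i)) ∪ ⋃ B, E₃ d h s a B)) ∪ E₄ d) ∪ E₀ d) := by
    intro rec hrec
    by_contra hcon
    simp only [Set.mem_iUnion, Set.mem_union, not_exists, not_or] at hcon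
    refine hrec fun d => ?_
    obtain ⟨⟨hdev, h4⟩, h0⟩ := hcon d
    refine ⟨fun n => ?_, (not_le.1 h4).le⟩
    have h0' : ∀ τ h i, (dataset d rec τ h).2.2.1 i ∈ Set.Icc (0 : ℝ) 1 := by
      by_contra hx
      push Not at hx
      exact h0 hx
    refine accurate_of_visitSum_lt hℓ (fun τ h i => h0' _ h i) ?_ ?_ ?_
    · intro h s a i hpos
      by_contra hx
      exact ((hdev h s a).1 i).1 ⟨n, n.2, hpos, not_lt.1 hx⟩
    · intro h s a i hpos
      by_contra hx
      exact ((hdev h s a).1 i).2 ⟨n, n.2, hpos, not_lt.1 hx⟩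
    · intro h s a B hpos
      by_contra hx
      exact (hdev h s a).2 B ⟨n, n.2, hpos, not_lt.1 hx⟩
  refine (measure_mono hsub).trans ((measure_iUnion_fintype_le _ _).trans
    (Finset.sum_le_sum fun d _ => ?_))
  refine (measure_union_le _ _).trans ?_
  rw [run_reward_notMem M h₁ h₂ d T, add_zero]
  refine (measure_union_le _ _).trans (add_le_add ?_
    (run_sum_expectedBonus_ge_le M h₁ h₂ d T δ hT hH hℓ0))
  refine (measure_iUnion_fintype_le _ _).trans (Finset.sum_le_sum fun h _ => ?_)
  refine (measure_iUnion_fintype_le _ _).trans (Finset.sum_le_sum fun s _ => ?_)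
  refine (measure_iUnion_fintype_le _ _).trans (Finset.sum_le_sum fun a _ => ?_)
  refine (measure_union_le _ _).trans (add_le_add ?_ ?_)
  · refine (measure_iUnion_fintype_le _ _).trans (Finset.sum_le_sum fun i _ => ?_)
    refine (measure_union_le _ _).trans ?_
    rw [two_mul]
    exact add_le_add
      (run_exists_visitSum_ge_le M h₁ h₂ d (by fun_prop) (isCentered_reward M h s a i) T hℓ0)
      (run_exists_visitSum_ge_le M h₁ h₂ d (by fun_prop) (isCentered_neg_reward M h s a i) T hℓ0)
  · refine (measure_iUnion_fintype_le _ _).trans (Finset.sum_le_sum fun B _ => ?_)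
    refine run_exists_visitSum_ge_le M h₁ h₂ d ?_ (isCentered_next M h s a B) T (by positivity)
    have : Measurable fun s' : S => (if s' ∈ B then (1 : ℝ) else 0) -
      ∑ s' ∈ B, (M.trans h s a : S → ℝ) s' := Measurable.of_discrete
    exact this.comp measurable_snd

lemma one_le_bonusLog (hS : 0 < Fintype.card S) (hA : 0 < Fintype.card A) (hH : 0 < H)
    (hm : 0 < m) {T : ℕ} (hT : 0 < T) {δ : ℝ} (hδ : 0 < δ) (hδ1 : δ < 1) :
    1 ≤ bonusLog S A H m T δ := by
  have hX : (1 : ℝ) ≤ m * Fintype.card S * Fintype.card A * H * T := by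
    exact_mod_cast (by positivity : 0 < m * Fintype.card S * Fintype.card A * H * T)
  rw [bonusLog, Real.le_log_iff_exp_le (by positivity), le_div_iff₀ hδ]
  have := Real.exp_one_lt_d9
  nlinarith [Real.exp_pos 1]

lemma run_not_goodRecord_le {L : Learner S A H m} (M : MOMDP S A H m)
    (h₁ : ∀ n, Measurable (L.main n)) (h₂ : ∀ n, Measurable (L.aux n)) {T : ℕ} (hT : 0 < T)
    (hH : 0 < H) (hm : 0 < m) (hA : 0 < Fintype.card A) {δ : ℝ} (hδ : 0 < δ) (hδ1 : δ < 1) :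
    L.run M T {rec | ¬ L.GoodRecord M δ rec} ≤ ENNReal.ofReal δ := by
  have hS : 0 < Fintype.card S := Fintype.card_pos_iff.2 ⟨M.init⟩
  refine (run_not_goodRecord_le_sum M h₁ h₂ hT hH
    (one_le_bonusLog hS hA hH hm hT hδ hδ1)).trans ?_
  have hS' : (1 : ℝ) ≤ Fintype.card S := Nat.one_le_cast.2 hS
  have hA' : (1 : ℝ) ≤ Fintype.card A := Nat.one_le_cast.2 hA
  have hH' : (1 : ℝ) ≤ H := Nat.one_le_cast.2 hH
  have hm' : (1 : ℝ) ≤ m := Nat.one_le_cast.2 hm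
  have hT' : (1 : ℝ) ≤ T := Nat.one_le_cast.2 hT
  set q : ℝ := Real.exp (-bonusLog S A H m T δ) with hq
  set X : ℝ := m * Fintype.card S * Fintype.card A * H * T with hX
  have hX1 : 1 ≤ X := by
    rw [hX]
    exact_mod_cast (by positivity : 0 < m * Fintype.card S * Fintype.card A * H * T)
  -- The failure probabilities are powers of `q = δ / (8 X)`. The deviation events have exponent
  -- four, which absorbs the unions over rounds, counts, datasets and objectives.
  have hqX : q * (8 * X) = δ := by
    rw [hq, Real.exp_neg, bonusLog, Real.exp_log (by positivity), hX]
    field_simp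
  have hq0 : 0 < q := Real.exp_pos _
  have hq8 : q ≤ 1 / 8 := by nlinarith
  have e1 : Real.exp (-(4 * bonusLog S A H m T δ)) = q ^ 4 := by
    rw [hq, ← Real.exp_nat_mul]; congr 1; push_cast; ring
  have e2 : Real.exp (-(4 * (Fintype.card S * bonusLog S A H m T δ))) =
      (q ^ Fintype.card S) ^ 4 := by
    rw [hq, ← pow_mul, ← Real.exp_nat_mul]; congr 1; push_cast; ring
  -- The factor `|S|` in the transition bonus pays for the `2 ^ |S|` subsets, since `2 q ≤ 1`.
  have e3 : (2 : ℝ) ^ Fintype.card S * (q ^ Fintype.card S) ^ 4 ≤ q ^ 3 := by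
    have h1 : (2 : ℝ) ^ Fintype.card S * q ^ Fintype.card S ≤ 1 := by
      rw [← mul_pow]; exact pow_le_one₀ (by positivity) (by linarith)
    have h2 : q ^ Fintype.card S ≤ q := by
      simpa using pow_le_pow_of_le_one hq0.le (by linarith) hS
    calc _ = (2 : ℝ) ^ Fintype.card S * q ^ Fintype.card S * (q ^ Fintype.card S) ^ 3 := by ring
      _ ≤ 1 * q ^ 3 := by gcongr
      _ = q ^ 3 := one_mul _
  rw [e1, e2]
  have e4 : (∑ _ : Option (Fin m), (∑ _ : Fin H, ∑ _ : S, ∑ _ : A,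
        (∑ _ : Fin m, 2 * ENNReal.ofReal (T ^ 2 * q ^ 4) +
        ∑ _ : Finset S, ENNReal.ofReal (T ^ 2 * (q ^ Fintype.card S) ^ 4)) +
        ENNReal.ofReal q)) = ENNReal.ofReal ((m + 1) * (H * (Fintype.card S * (Fintype.card A *
          (m * (2 * (T ^ 2 * q ^ 4)) +
            2 ^ Fintype.card S * (T ^ 2 * (q ^ Fintype.card S) ^ 4)))) + q)) := by
    have h2 : (2 : ℝ≥0∞) = ENNReal.ofReal 2 := by simp
    have hc : ∀ k : ℕ, (k : ℝ≥0∞) = ENNReal.ofReal k := fun k => (ENNReal.ofReal_natCast k).symm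
    simp only [Finset.sum_const, Finset.card_univ, Fintype.card_option, Fintype.card_fin,
      Fintype.card_finset, nsmul_eq_mul]
    rw [h2]
    simp only [hc]
    rw [← ENNReal.ofReal_mul (by positivity), ← ENNReal.ofReal_mul (by positivity),
      ← ENNReal.ofReal_mul (by positivity), ← ENNReal.ofReal_add (by positivity) (by positivity),
      ← ENNReal.ofReal_mul (by positivity), ← ENNReal.ofReal_mul (by positivity),
      ← ENNReal.ofReal_mul (by positivity), ← ENNReal.ofReal_add (by positivity) (by positivity),
      ← ENNReal.ofReal_mul (by positivity)]
    push_cast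
    rfl
  rw [e4]
  refine ENNReal.ofReal_le_ofReal ?_
  have hmX : (m : ℝ) ≤ X := by
    rw [hX]
    exact_mod_cast Nat.le_of_dvd (by positivity)
      ⟨Fintype.card S * Fintype.card A * H * T, by ring⟩
  have hTX : (T : ℝ) ≤ X := by
    rw [hX]
    exact_mod_cast Nat.le_of_dvd (by positivity)
      ⟨m * Fintype.card S * Fintype.card A * H, by ring⟩
  have hY : (H : ℝ) * (Fintype.card S * (Fintype.card A * T)) ≤ X := by
    rw [hX]
    exact_mod_cast Nat.le_of_dvd (by positivity) ⟨m, by ring⟩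
  have e5 : 2 ^ Fintype.card S * ((T : ℝ) ^ 2 * (q ^ Fintype.card S) ^ 4) ≤ T ^ 2 * q ^ 3 := by
    calc _ = (T : ℝ) ^ 2 * (2 ^ Fintype.card S * (q ^ Fintype.card S) ^ 4) := by ring
      _ ≤ _ := by gcongr
  calc ((m : ℝ) + 1) * (H * (Fintype.card S * (Fintype.card A * (m * (2 * (T ^ 2 * q ^ 4)) +
            2 ^ Fintype.card S * (T ^ 2 * (q ^ Fintype.card S) ^ 4)))) + q)
      ≤ (2 * m) * (H * (Fintype.card S * (Fintype.card A * (m * (2 * (T ^ 2 * q ^ 4)) +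
            T ^ 2 * q ^ 3))) + q) := by gcongr; linarith
    _ = (2 * m) * (2 * X * T * q ^ 4 +
          H * (Fintype.card S * (Fintype.card A * T)) * T * q ^ 3 + q) := by rw [hX]; ring
    _ ≤ (2 * X) * (2 * X * X * q ^ 4 + X * X * q ^ 3 + q) := by gcongr
    _ = (4 * X ^ 3 * q ^ 3) * q + 2 * (X * q) ^ 3 + 2 * (X * q) := by ring
    _ ≤ δ := by
        have hXq : X * q = δ / 8 := by linarith
        rw [show 4 * X ^ 3 * q ^ 3 = 4 * (X * q) ^ 3 by ring, hXq]
        have hδ3 : δ ^ 3 ≤ δ := by nlinarith [sq_nonneg δ]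
        have : 4 * (δ / 8) ^ 3 * q ≤ 4 * (δ / 8) ^ 3 * (1 / 8) := by gcongr
        nlinarith

end GoodEvent

/-- Positive probability vectors. -/
structure IsPosProb {ι : Type*} [Fintype ι] (p : ι → ℝ) : Prop where
  pos : ∀ i, 0 < p i
  sum_eq_one : ∑ i, p i = 1

/-! ### Entropy, Gibbs distributions and log-sum-exp. -/

section Entropy

variable {ι : Type*} [Fintype ι]

lemma IsPosProb.le_one {p : ι → ℝ} (hp : IsPosProb p) (i : ι) : p i ≤ 1 := by
  rw [← hp.sum_eq_one]
  exact Finset.single_le_sum (fun j _ => (hp.pos j).le) (Finset.mem_univ i)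

/-- Relative entropy of finite probability vectors. -/
noncomputable def relEntropy (p q : ι → ℝ) : ℝ := ∑ i, p i * (Real.log (p i) - Real.log (q i))

lemma relEntropy_nonneg {p q : ι → ℝ} (hp : IsPosProb p) (hq : IsPosProb q) :
    0 ≤ relEntropy p q := by
  have h : ∑ i, (p i - q i) ≤ relEntropy p q := by
    refine Finset.sum_le_sum fun i _ => ?_
    have h1 := Real.log_le_sub_one_of_pos (div_pos (hq.pos i) (hp.pos i))
    rw [Real.log_div (hq.pos i).ne' (hp.pos i).ne'] at h1
    have h2 := mul_le_mul_of_nonneg_left h1 (hp.pos i).le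
    have h3 : p i * (q i / p i - 1) = q i - p i := by
      rw [mul_sub, mul_div_cancel₀ _ (hp.pos i).ne', mul_one]
    linarith
  rwa [Finset.sum_sub_distrib, hp.sum_eq_one, hq.sum_eq_one, sub_self] at h

/-- Linear functional plus entropy. -/
noncomputable def entReg (μ : ℝ) (x p : ι → ℝ) : ℝ := ∑ i, p i * (x i - μ * Real.log (p i))

/-- The Gibbs distribution. -/
noncomputable def softmax (μ : ℝ) (x : ι → ℝ) (i : ι) : ℝ :=
  Real.exp (x i / μ) / ∑ j, Real.exp (x j / μ)

lemma sum_exp_pos [Nonempty ι] (y : ι → ℝ) : 0 < ∑ j, Real.exp (y j) :=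
  Finset.sum_pos (fun _ _ => Real.exp_pos _) Finset.univ_nonempty

lemma isPosProb_softmax [Nonempty ι] (μ : ℝ) (x : ι → ℝ) : IsPosProb (softmax μ x) := by
  have hZ := sum_exp_pos (fun j => x j / μ)
  refine ⟨fun i => div_pos (Real.exp_pos _) hZ, ?_⟩
  unfold softmax
  rw [← Finset.sum_div, div_self hZ.ne']

lemma log_softmax [Nonempty ι] (μ : ℝ) (x : ι → ℝ) (i : ι) :
    Real.log (softmax μ x i) = x i / μ - Real.log (∑ j, Real.exp (x j / μ)) := by
  rw [softmax, Real.log_div (Real.exp_pos _).ne' (sum_exp_pos _).ne', Real.log_exp]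

/-- The gap is exactly `μ` times the relative entropy of `p` with respect to the Gibbs distribution.
-/
lemma entReg_le_logSumExp [Nonempty ι] {μ : ℝ} (hμ : 0 < μ) (x : ι → ℝ) {p : ι → ℝ}
    (hp : IsPosProb p) : entReg μ x p ≤ μ * Real.log (∑ j, Real.exp (x j / μ)) := by
  have h := mul_nonneg hμ.le (relEntropy_nonneg hp (isPosProb_softmax μ x))
  have e : μ * relEntropy p (softmax μ x) =
      μ * Real.log (∑ j, Real.exp (x j / μ)) * ∑ i, p i - entReg μ x p := by
    simp_rw [relEntropy, entReg, log_softmax, Finset.mul_sum, ← Finset.sum_sub_distrib]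
    refine Finset.sum_congr rfl fun i _ => ?_
    field_simp
    ring
  rw [hp.sum_eq_one, mul_one] at e
  linarith

lemma entReg_softmax [Nonempty ι] {μ : ℝ} (hμ : 0 < μ) (x : ι → ℝ) :
    entReg μ x (softmax μ x) = μ * Real.log (∑ j, Real.exp (x j / μ)) := by
  have h : ∀ i, softmax μ x i * (x i - μ * Real.log (softmax μ x i)) =
      softmax μ x i * (μ * Real.log (∑ j, Real.exp (x j / μ))) := by
    intro i
    rw [log_softmax]
    field_simp
    ring
  rw [entReg, Finset.sum_congr rfl fun i _ => h i, ← Finset.sum_mul,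
    (isPosProb_softmax μ x).sum_eq_one, one_mul]

/-- Hoeffding's lemma for finitely supported distributions. -/
lemma log_sum_mul_exp_le {p x : ι → ℝ} (hp : IsPosProb p) {a b : ℝ}
    (hx : ∀ i, x i ∈ Set.Icc a b) (θ : ℝ) :
    Real.log (∑ i, p i * Real.exp (θ * x i)) ≤
      θ * ∑ i, p i * x i + θ ^ 2 * (b - a) ^ 2 / 8 := by
  let _ : MeasurableSpace ι := ⊤
  have hne : (Finset.univ : Finset ι).Nonempty := by
    by_contra h
    have := hp.sum_eq_one
    rw [Finset.not_nonempty_iff_eq_empty.1 h] at this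
    simp at this
  let ν : Measure ι := ∑ i, ENNReal.ofReal (p i) • Measure.dirac i
  have hν : IsProbabilityMeasure ν := ⟨by
    simp only [ν, Measure.finsetSum_apply, Measure.smul_apply, measure_univ, smul_eq_mul, mul_one]
    rw [← ENNReal.ofReal_sum_of_nonneg (fun i _ => (hp.pos i).le), hp.sum_eq_one,
      ENNReal.ofReal_one]⟩
  have hmean : ∫ i, x i ∂ν = ∑ i, p i * x i := by
    have hfin : ∀ i, IsFiniteMeasure (ENNReal.ofReal (p i) • Measure.dirac i) :=
      fun i => Measure.smul_finite _ ENNReal.ofReal_ne_top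
    rw [integral_finsetSum_measure fun i _ => Integrable.of_finite]
    simp [integral_smul_measure, ENNReal.toReal_ofReal (hp.pos _).le]
  have key := lintegral_exp_centered_le (ρ := ν) (Measurable.of_discrete (f := x))
    (Filter.Eventually.of_forall hx) θ
  rw [hmean, lintegral_finsetSum_measure] at key
  simp only [lintegral_smul_measure, lintegral_dirac, smul_eq_mul,
    ← ENNReal.ofReal_mul (hp.pos _).le] at key
  rw [← ENNReal.ofReal_sum_of_nonneg
    (fun i _ => mul_nonneg (hp.pos i).le (Real.exp_pos _).le), ENNReal.ofReal_le_one] at key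
  set c := θ * ∑ i, p i * x i + θ ^ 2 * (b - a) ^ 2 / 8 with hc
  have e : ∀ i, p i * Real.exp (θ * (x i - ∑ i, p i * x i) - θ ^ 2 * (b - a) ^ 2 / 8) =
      p i * Real.exp (θ * x i) * Real.exp (-c) := by
    intro i
    rw [mul_assoc, ← Real.exp_add]
    congr 2
    rw [hc]
    ring
  simp_rw [e] at key
  rw [← Finset.sum_mul, Real.exp_neg, ← div_eq_mul_inv, div_le_one (Real.exp_pos _)] at key
  rw [Real.log_le_iff_le_exp (Finset.sum_pos (fun i _ => mul_pos (hp.pos i) (Real.exp_pos _)) hne)]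
  exact key

end Entropy

/-! ### One step of entropic mirror ascent with mixing. -/

section Ascent

variable {m : ℕ}

lemma ascend_denom_pos (hm : 0 < m) (μ η : ℝ) (lam g : Fin m → ℝ) {w : Fin m → ℝ}
    (hw : ∀ i, 0 < w i) :
    0 < ∑ j, w j ^ (1 - μ * η) * Real.exp (η * (lam j * g j)) :=
  Finset.sum_pos (fun j _ => mul_pos (Real.rpow_pos_of_pos (hw j) _) (Real.exp_pos _))
    ⟨⟨0, hm⟩, Finset.mem_univ _⟩

lemma isPosProb_ascend (hm : 0 < m) (μ η : ℝ) (lam g : Fin m → ℝ) {w : Fin m → ℝ}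
    (hw : ∀ i, 0 < w i) : IsPosProb (ascend μ η lam w g) := by
  have hZ := ascend_denom_pos hm μ η lam g hw
  refine ⟨fun i => div_pos (mul_pos (Real.rpow_pos_of_pos (hw i) _) (Real.exp_pos _)) hZ, ?_⟩
  unfold ascend
  rw [← Finset.sum_div, div_self hZ.ne']

lemma isPosProb_mixWeights (hm : 0 < m) {α : ℝ} (h0 : 0 ≤ α) (h1 : α ≤ 1) {w : Fin m → ℝ}
    (hw : IsPosProb w) : IsPosProb (mixWeights α w) := by
  have hm' : (0 : ℝ) < m := Nat.cast_pos.2 hm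
  constructor
  · intro i
    unfold mixWeights
    rcases h0.eq_or_lt with rfl | h0
    · simpa using hw.pos i
    · exact add_pos_of_nonneg_of_pos (mul_nonneg (by linarith) (hw.pos i).le) (div_pos h0 hm')
  · unfold mixWeights
    rw [Finset.sum_add_distrib, ← Finset.mul_sum, hw.sum_eq_one]
    simp
    field_simp
    ring

/-- One step of mirror ascent on the entropy-regularized objective. -/
lemma entReg_sub_le_of_ascend (hm : 0 < m) {μ η : ℝ} (lam g : Fin m → ℝ)
    {w p : Fin m → ℝ} (hw : IsPosProb w) (hp : IsPosProb p) {a b : ℝ}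
    (hx : ∀ i, lam i * g i - μ * Real.log (w i) ∈ Set.Icc a b) :
    η * (entReg μ (fun i => lam i * g i) p - entReg μ (fun i => lam i * g i) w) ≤
      (1 - μ * η) * relEntropy p w - relEntropy p (ascend μ η lam w g) +
        η ^ 2 * (b - a) ^ 2 / 8 := by
  have hZ := ascend_denom_pos hm μ η lam g hw.pos
  set Z := ∑ j, w j ^ (1 - μ * η) * Real.exp (η * (lam j * g j)) with hZdef
  have hlog : ∀ i, Real.log (ascend μ η lam w g i) =
      (1 - μ * η) * Real.log (w i) + η * (lam i * g i) - Real.log Z := by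
    intro i
    rw [ascend, ← hZdef, Real.log_div (mul_pos (Real.rpow_pos_of_pos (hw.pos i) _)
      (Real.exp_pos _)).ne' hZ.ne', Real.log_mul (Real.rpow_pos_of_pos (hw.pos i) _).ne'
      (Real.exp_pos _).ne', Real.log_rpow (hw.pos i), Real.log_exp]
  -- Since `w ^ (1 - μη) = w exp (-μη log w)`, the normaliser is an exponential moment under `w` of
  -- the payoff gradient, up to an additive constant. Its mean under `w` is the payoff at `w`
  -- itself.
  have hZ' : Z = ∑ i, w i * Real.exp (η * (lam i * g i - μ * Real.log (w i))) := by
    refine Finset.sum_congr rfl fun i _ => ?_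
    rw [Real.rpow_def_of_pos (hw.pos i), ← Real.exp_add]
    nth_rewrite 2 [← Real.exp_log (hw.pos i)]
    rw [← Real.exp_add]
    congr 1
    ring
  have h1 := log_sum_mul_exp_le hw hx η
  rw [← hZ'] at h1
  -- An exact identity: the payoff at `p`, with its entropy, is what remains after the relative
  -- entropy is contracted by `1 - μη`. Only bounding `log Z` by Hoeffding loses anything.
  have h2 : relEntropy p (ascend μ η lam w g) = (1 - μ * η) * relEntropy p w -
      η * entReg μ (fun i => lam i * g i) p + Real.log Z * ∑ i, p i := by
    simp_rw [relEntropy, entReg, hlog, Finset.mul_sum, ← Finset.sum_sub_distrib,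
      ← Finset.sum_add_distrib]
    refine Finset.sum_congr rfl fun i _ => ?_
    ring
  rw [hp.sum_eq_one, mul_one] at h2
  have h3 : ∑ i, w i * (lam i * g i - μ * Real.log (w i)) =
    entReg μ (fun i => lam i * g i) w := rfl
  rw [h3] at h1
  linarith

/-- The mixed weights are at least `(1 - α) w`, and `-log (1 - α) ≤ α / (1 - α)`. -/
lemma relEntropy_mixWeights_le (hm : 0 < m) {α : ℝ} (h0 : 0 ≤ α) (h1 : α < 1) {w p : Fin m → ℝ}
    (hw : IsPosProb w) (hp : IsPosProb p) :
    relEntropy p (mixWeights α w) ≤ relEntropy p w + α / (1 - α) := by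
  have hα : 0 < 1 - α := by linarith
  have h : relEntropy p (mixWeights α w) ≤ relEntropy p w + ∑ i, p i * (α / (1 - α)) := by
    rw [relEntropy, relEntropy, ← Finset.sum_add_distrib]
    refine Finset.sum_le_sum fun i _ => ?_
    rw [← mul_add]
    refine mul_le_mul_of_nonneg_left ?_ (hp.pos i).le
    have h2 : Real.log ((1 - α) * w i) ≤ Real.log (mixWeights α w i) := by
      refine Real.log_le_log (mul_pos hα (hw.pos i)) ?_
      unfold mixWeights
      have : 0 ≤ α / m := by positivity
      linarith
    rw [Real.log_mul hα.ne' (hw.pos i).ne'] at h2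
    have h3 := Real.one_sub_inv_le_log_of_pos hα
    have h4 : α / (1 - α) = (1 - α)⁻¹ - 1 := by field_simp; ring
    linarith
  rwa [← Finset.sum_mul, hp.sum_eq_one, one_mul] at h

/-- The linear part moves by at most `2 α c`. In the entropy, `log v` is bounded below by `log (α /
m)` on the uniform share and by `log ((1 - α) w)` on the share of `w`; the leftover `μ α ∑ w log w`
is nonpositive. -/
lemma entReg_mixWeights_le (hm : 0 < m) {μ : ℝ} (hμ : 0 ≤ μ) {α : ℝ} (h0 : 0 < α) (h1 : α ≤ 1)
    {x w : Fin m → ℝ} {c : ℝ} (hx : ∀ i, |x i| ≤ c) (hw : IsPosProb w) :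
    entReg μ x (mixWeights α w) ≤
      entReg μ x w + α * (2 * c) + μ * (α * Real.log (m / α) + α) := by
  have hm' : (0 : ℝ) < m := Nat.cast_pos.2 hm
  have hv := isPosProb_mixWeights hm h0.le h1 hw
  have hterm : ∀ i, mixWeights α w i * (x i - μ * Real.log (mixWeights α w i)) ≤
      w i * (x i - μ * Real.log (w i)) + α * (w i * c + 1 / m * c) +
        μ * (α * (1 / m * Real.log (m / α)) + α * w i) +
        μ * α * (w i * Real.log (w i)) := by
    intro i
    set v := mixWeights α w i with hvdef
    have hv0 : 0 < v := hv.pos i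
    have hvi : v = (1 - α) * w i + α / m := rfl
    have hαm : 0 < α / m := div_pos h0 hm'
    have hwi := hw.pos i
    have hl1 : Real.log (α / m) ≤ Real.log v := by
      refine Real.log_le_log hαm ?_
      rw [hvi]
      nlinarith
    have hl2 : (1 - α) * w i * (Real.log (w i)) - α * w i ≤ (1 - α) * w i * Real.log v := by
      rcases h1.eq_or_lt with rfl | h1
      · simp; exact hwi.le
      · have hα : 0 < 1 - α := by linarith
        have h2 : Real.log ((1 - α) * w i) ≤ Real.log v := by
          refine Real.log_le_log (mul_pos hα hwi) ?_
          rw [hvi]; linarith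
        rw [Real.log_mul hα.ne' hwi.ne'] at h2
        have h3 := Real.one_sub_inv_le_log_of_pos hα
        have h4 : (1 - α) * (1 - (1 - α)⁻¹) = -α := by field_simp; ring
        have h5 := mul_le_mul_of_nonneg_left (h2.trans' (add_le_add_left h3 _))
          (mul_pos hα hwi).le
        have h6 : (1 - α) * w i * (1 - (1 - α)⁻¹ + Real.log (w i)) =
          (1 - α) * w i * Real.log (w i) + ((1 - α) * (1 - (1 - α)⁻¹)) * w i := by ring
        rw [h6, h4] at h5
        linarith
    have hl3 : α / m * Real.log (α / m) ≤ α / m * Real.log v :=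
      mul_le_mul_of_nonneg_left hl1 hαm.le
    have hl4 : Real.log (α / m) = -Real.log (m / α) := by
      rw [← Real.log_inv, inv_div]
    rw [hl4] at hl3
    have hxi := abs_le.1 (hx i)
    have hvx : v * x i ≤ w i * x i + α * (w i * c + 1 / m * c) := by
      have e : v * x i = w i * x i + α * (1 / m * x i - w i * x i) := by rw [hvi]; ring
      rw [e]
      have g1 : 1 / m * x i ≤ 1 / m * c := mul_le_mul_of_nonneg_left hxi.2 (by positivity)
      have g2 : -(w i * c) ≤ w i * x i := by nlinarith [hxi.1]
      have := mul_le_mul_of_nonneg_left (show 1 / m * x i - w i * x i ≤ w i * c + 1 / m * c by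
        linarith) h0.le
      linarith
    have hvl : -(v * Real.log v) ≤ -(w i * Real.log (w i)) +
        (α * (1 / m * Real.log (m / α)) + α * w i) + α * (w i * Real.log (w i)) := by
      have e : v * Real.log v = (1 - α) * w i * Real.log v + α / m * Real.log v := by
        nth_rewrite 1 [hvi]; ring
      have e2 : α / m * -Real.log (m / α) = -(α * (1 / m * Real.log (m / α))) := by ring
      rw [e2] at hl3
      rw [e]
      linarith
    have := mul_le_mul_of_nonneg_left hvl hμ
    linarith
  have hsum := Finset.sum_le_sum fun i (_ : i ∈ Finset.univ) => hterm i
  have hent : ∑ i, w i * Real.log (w i) ≤ 0 := Finset.sum_nonpos fun i _ =>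
    mul_nonpos_of_nonneg_of_nonpos (hw.pos i).le (Real.log_nonpos (hw.pos i).le (hw.le_one i))
  simp only [Finset.sum_add_distrib, ← Finset.mul_sum, ← Finset.sum_mul, hw.sum_eq_one] at hsum
  have hc : ∀ y : ℝ, 1 / (m : ℝ) * ∑ _ : Fin m, y = y := by intro y; simp; field_simp
  rw [hc, hc] at hsum
  have := mul_nonpos_of_nonneg_of_nonpos (mul_nonneg hμ h0.le) hent
  unfold entReg
  linarith

end Ascent

/-! ### Logarithmic regret of the weights. -/

section Regret

variable {m : ℕ}

lemma isPosProb_ascend_zero (hm : 0 < m) (μ : ℝ) (lam g : Fin m → ℝ) :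
    IsPosProb (ascend μ 0 lam (mixWeights 0 fun _ => 1 / (m : ℝ)) g) := by
  have hm' : (0 : ℝ) < m := Nat.cast_pos.2 hm
  refine isPosProb_ascend hm _ _ _ _ fun i => ?_
  simp [mixWeights]
  exact hm

/-- Regret in a single round. -/
lemma entReg_sub_le (hm : 0 < m) {μ : ℝ} (hμ : 0 < μ) {T n : ℕ} (hn : n < T)
    {lam g w p : Fin m → ℝ} (hw : IsPosProb w) (hp : IsPosProb p) {B : ℝ}
    (hB : ∀ i, |lam i * g i| ≤ B) :
    entReg μ (fun i => lam i * g i) p - entReg μ (fun i => lam i * g i) w ≤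
      μ * n * relEntropy p w - μ * (n + 1) * relEntropy p
        (ascend μ (stepSize μ (n + 1)) lam (mixWeights (mixRate (n + 1)) w) g) +
      1 / (n + 1) * ((2 * B + 2 * μ * Real.log (m * T)) ^ 2 / (8 * μ) + μ + 2 * B +
        μ * (2 * Real.log (m * T) + 1)) := by
  set Λ := Real.log (m * T) with hΛ
  set x : Fin m → ℝ := fun i => lam i * g i with hx
  have hm' : (0 : ℝ) < m := Nat.cast_pos.2 hm
  have hm1 : (1 : ℝ) ≤ m := Nat.one_le_cast.2 hm
  have hT' : (n : ℝ) + 1 ≤ T := by exact_mod_cast hn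
  have hT0 : (0 : ℝ) < T := Nat.cast_pos.2 (by omega)
  set t : ℝ := (n : ℝ) + 1 with ht
  have ht1 : 1 ≤ t := by have : (0 : ℝ) ≤ n := Nat.cast_nonneg n; linarith
  have ht0 : 0 < t := by linarith
  have hB0 : 0 ≤ B := (abs_nonneg _).trans (hB ⟨0, hm⟩)
  have hη : stepSize μ (n + 1) = 1 / (μ * t) := by simp [stepSize, ht]
  have hα : mixRate (n + 1) = 1 / t ^ 2 := by simp [mixRate, ht]
  rw [hη, hα]
  have hα0 : 0 < 1 / t ^ 2 := by positivity
  have hαt : 1 / t ^ 2 ≤ 1 / t := by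
    refine one_div_le_one_div_of_le ht0 ?_
    nlinarith
  have hα1 : 1 / t ^ 2 ≤ 1 := hαt.trans (by rw [div_le_one ht0]; exact ht1)
  have hv := isPosProb_mixWeights hm hα0.le hα1 hw
  have hlogα : Real.log (m / (1 / t ^ 2)) ≤ 2 * Λ := by
    have : (m : ℝ) / (1 / t ^ 2) = m * t ^ 2 := by field_simp
    rw [this, hΛ, ← Real.log_rpow (by positivity)]
    refine Real.log_le_log (by positivity) ?_
    have h1 : t ^ 2 ≤ (T : ℝ) ^ 2 := by gcongr
    have h2 : (m : ℝ) ≤ m ^ 2 := by nlinarith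
    calc (m : ℝ) * t ^ 2 ≤ m ^ 2 * T ^ 2 := by gcongr
      _ = ((m : ℝ) * T) ^ (2 : ℝ) := by norm_cast; ring
  have hΛ0 : 0 ≤ Λ := by
    refine Real.log_nonneg ?_
    nlinarith
  -- Mixing keeps every weight above `1 / (m t ^ 2)`, so the gradient has range at most `2 B + 2 μ
  -- Λ`.
  have hrange : ∀ i, lam i * g i - μ * Real.log (mixWeights (1 / t ^ 2) w i) ∈
      Set.Icc (-B) (B + μ * (2 * Λ)) := by
    intro i
    have h1 := abs_le.1 (hB i)
    have h2 : Real.log (mixWeights (1 / t ^ 2) w i) ≤ 0 :=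
      Real.log_nonpos (hv.pos i).le (hv.le_one i)
    have h3 : -(2 * Λ) ≤ Real.log (mixWeights (1 / t ^ 2) w i) := by
      have h4 : Real.log (1 / t ^ 2 / m) ≤ Real.log (mixWeights (1 / t ^ 2) w i) := by
        refine Real.log_le_log (by positivity) ?_
        unfold mixWeights
        have := mul_nonneg (sub_nonneg.2 hα1) (hw.pos i).le
        linarith
      have h5 : Real.log (1 / t ^ 2 / m) = -Real.log (m / (1 / t ^ 2)) := by
        rw [← Real.log_inv, inv_div]
      linarith
    constructor
    · have := mul_nonpos_of_nonneg_of_nonpos hμ.le h2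
      linarith
    · have := mul_le_mul_of_nonneg_left h3 hμ.le
      linarith
  have hstep := entReg_sub_le_of_ascend hm (η := 1 / (μ * t)) lam g hv hp hrange
  have hstep' := mul_le_mul_of_nonneg_left hstep (mul_pos hμ ht0).le
  set v := mixWeights (1 / t ^ 2) w with hvdef
  set w' := ascend μ (1 / (μ * t)) lam v g with hw'
  have e1 : μ * t * (1 / (μ * t) * (entReg μ x p - entReg μ x v)) =
      entReg μ x p - entReg μ x v := by field_simp
  -- The step size is chosen so that `μ t (1 - μ η) = μ (t - 1) = μ n`: the relative entropies
  -- telescope with weights `μ n`.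
  have e2 : μ * t * ((1 - μ * (1 / (μ * t))) * relEntropy p v - relEntropy p w' +
      (1 / (μ * t)) ^ 2 * (B + μ * (2 * Λ) - -B) ^ 2 / 8) =
      μ * n * relEntropy p v - μ * t * relEntropy p w' +
        1 / t * ((2 * B + 2 * μ * Λ) ^ 2 / (8 * μ)) := by
    have : (n : ℝ) = t - 1 := by rw [ht]; ring
    rw [this]
    field_simp
    ring
  rw [e1, e2] at hstep'
  have hKL : μ * n * relEntropy p v ≤ μ * n * relEntropy p w + 1 / t * μ := by
    -- In the first update `α = 1` and the mixing estimate is unavailable, but the relative entropy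
    -- then has coefficient zero. Later the loss is `μ n α / (1 - α) = μ / (t + 1)`.
    rcases Nat.eq_zero_or_pos n with h0 | hn0
    · rw [h0]; simp; positivity
    · have hn0' : (0 : ℝ) < n := Nat.cast_pos.2 hn0
      have ht1' : 1 < t := by linarith
      have h1 : 1 / t ^ 2 < 1 := by
        rw [div_lt_one (by positivity)]; nlinarith
      have h2 := relEntropy_mixWeights_le hm hα0.le h1 hw hp
      have h3 := mul_le_mul_of_nonneg_left h2 (mul_pos hμ hn0').le
      have h4 : μ * n * (1 / t ^ 2 / (1 - 1 / t ^ 2)) = μ * (1 / (t + 1)) := by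
        have : (n : ℝ) = t - 1 := by rw [ht]; ring
        have h5 : t ^ 2 - 1 ≠ 0 := by nlinarith
        have h6 : t + 1 ≠ 0 := by linarith
        have h7 : 1 - 1 / t ^ 2 = (t ^ 2 - 1) / t ^ 2 := by field_simp
        rw [this, h7]
        field_simp
        ring
      have h5 : 1 / (t + 1) ≤ 1 / t := one_div_le_one_div_of_le ht0 (by linarith)
      have h6 := mul_le_mul_of_nonneg_left h5 hμ.le
      rw [mul_add, h4] at h3
      linarith
  have hmix := entReg_mixWeights_le hm hμ.le hα0 hα1 hB hw
  have hmix2 : 1 / t ^ 2 * (2 * B) + μ * (1 / t ^ 2 * Real.log (m / (1 / t ^ 2)) + 1 / t ^ 2) ≤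
      1 / t * (2 * B + μ * (2 * Λ + 1)) := by
    calc _ ≤ 1 / t ^ 2 * (2 * B) + μ * (1 / t ^ 2 * (2 * Λ) + 1 / t ^ 2) := by gcongr
      _ = 1 / t ^ 2 * (2 * B + μ * (2 * Λ + 1)) := by ring
      _ ≤ _ := by gcongr
  have hmix' : entReg μ x v ≤ entReg μ x w + 1 / t ^ 2 * (2 * B) +
      μ * (1 / t ^ 2 * Real.log (m / (1 / t ^ 2)) + 1 / t ^ 2) := hmix
  have e3 : 1 / t * ((2 * B + 2 * μ * Λ) ^ 2 / (8 * μ) + μ + 2 * B + μ * (2 * Λ + 1)) =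
      1 / t * ((2 * B + 2 * μ * Λ) ^ 2 / (8 * μ)) + 1 / t * μ +
        1 / t * (2 * B + μ * (2 * Λ + 1)) := by ring
  rw [e3]
  linarith

lemma isPosProb_of_ascend (hm : 0 < m) {μ : ℝ} {lam : Fin m → ℝ} {g W : ℕ → Fin m → ℝ}
    (hW0 : IsPosProb (W 0))
    (hW : ∀ n, W (n + 1) =
      ascend μ (stepSize μ (n + 1)) lam (mixWeights (mixRate (n + 1)) (W n)) (g n)) (n : ℕ) :
    IsPosProb (W n) := by
  induction n with
  | zero => exact hW0
  | succ n ih =>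
    rw [hW]
    have h0 : 0 ≤ mixRate (n + 1) := by unfold mixRate; split_ifs <;> positivity
    have h1 : mixRate (n + 1) ≤ 1 := by
      rw [mixRate, if_neg (Nat.succ_ne_zero n), div_le_one (by positivity)]
      exact one_le_pow₀ (Nat.one_le_cast.2 n.succ_pos)
    exact isPosProb_ascend hm _ _ _ _ (isPosProb_mixWeights hm h0 h1 ih).pos

lemma sum_one_div_le (T : ℕ) : ∑ n ∈ Finset.range T, 1 / ((n : ℝ) + 1) ≤ 1 + Real.log T := by
  have := harmonic_le_one_add_log T
  rw [harmonic] at this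
  push_cast at this
  simpa [one_div] using this

/-- Regret of mirror ascent with mixing on entropy-regularized linear objectives. -/
lemma sum_entReg_sub_le (hm : 0 < m) {μ : ℝ} (hμ : 0 < μ) {T : ℕ} (hT : 0 < T)
    {lam : Fin m → ℝ} {g W : ℕ → Fin m → ℝ} (hW0 : IsPosProb (W 0))
    (hW : ∀ n, W (n + 1) =
      ascend μ (stepSize μ (n + 1)) lam (mixWeights (mixRate (n + 1)) (W n)) (g n))
    {B : ℝ} (hB : ∀ n i, |lam i * g n i| ≤ B) {p : Fin m → ℝ} (hp : IsPosProb p) :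
    ∑ n ∈ Finset.range T, (entReg μ (fun i => lam i * g n i) p -
      entReg μ (fun i => lam i * g n i) (W n)) ≤
      (1 + Real.log T) * ((2 * B + 2 * μ * Real.log (m * T)) ^ 2 / (8 * μ) + μ + 2 * B +
        μ * (2 * Real.log (m * T) + 1)) := by
  set K := (2 * B + 2 * μ * Real.log (m * T)) ^ 2 / (8 * μ) + μ + 2 * B +
        μ * (2 * Real.log (m * T) + 1) with hK
  have hB0 : 0 ≤ B := (abs_nonneg _).trans (hB 0 ⟨0, hm⟩)
  have hm1 : (1 : ℝ) ≤ m := Nat.one_le_cast.2 hm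
  have hT1 : (1 : ℝ) ≤ T := Nat.one_le_cast.2 hT
  have hΛ0 : 0 ≤ Real.log (m * T) := Real.log_nonneg (by nlinarith)
  have hK0 : 0 ≤ K := by positivity
  have hpos := isPosProb_of_ascend hm hW0 hW
  -- The potential `μ N * relEntropy p (W N)` vanishes at `N = 0`, so the initial weights leave no
  -- term.
  have key : ∀ N ≤ T, ∑ n ∈ Finset.range N, (entReg μ (fun i => lam i * g n i) p -
      entReg μ (fun i => lam i * g n i) (W n)) ≤
      (∑ n ∈ Finset.range N, 1 / ((n : ℝ) + 1)) * K - μ * N * relEntropy p (W N) := by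
    intro N
    induction N with
    | zero => intro _; simp
    | succ N ih =>
      intro hN
      rw [Finset.sum_range_succ, Finset.sum_range_succ, add_mul]
      have h1 := ih (by omega)
      have h2 := entReg_sub_le hm hμ (T := T) (n := N) (by omega) (hpos N) hp (hB N)
      rw [← hW N] at h2
      push_cast
      linarith
  have h1 := key T le_rfl
  have h2 := mul_nonneg (mul_nonneg hμ.le (Nat.cast_nonneg T)) (relEntropy_nonneg hp (hpos T))
  have h3 := mul_le_mul_of_nonneg_right (sum_one_div_le T) hK0
  linarith

/-- The lower bound `log 2` on `L` lets constants be absorbed into powers of the logarithms, and `4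
H ≤ 2 H ^ 2 / μ + 2 μ` removes the mixed term. This excludes `T = 1`. -/
lemma regret_bound_le {μ H L Λ : ℝ} (hμ : 0 < μ) (hL : Real.log 2 ≤ L) (hΛ : L ≤ Λ) :
    (1 + L) * ((2 * (2 * H) + 2 * μ * Λ) ^ 2 / (8 * μ) + μ + 2 * (2 * H) + μ * (2 * Λ + 1)) ≤
      18 * (H ^ 2 * L / μ) + 60 * (μ * Λ ^ 3) := by
  have hlog2 := Real.log_two_gt_d9
  have hL0 : 0.69 ≤ L := by linarith
  have h1 : (2 * (2 * H) + 2 * μ * Λ) ^ 2 / (8 * μ) ≤ 4 * (H ^ 2 / μ) + μ * Λ ^ 2 := by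
    rw [div_le_iff₀ (by positivity)]
    have : (4 * (H ^ 2 / μ) + μ * Λ ^ 2) * (8 * μ) = 32 * H ^ 2 + 8 * (μ * Λ) ^ 2 := by
      field_simp
      ring
    rw [this]
    nlinarith [sq_nonneg (2 * H - μ * Λ)]
  have h2 : 2 * (2 * H) ≤ 2 * (H ^ 2 / μ) + 2 * μ := by
    have : 2 * (H ^ 2 / μ) + 2 * μ - 2 * (2 * H) = 2 * (H - μ) ^ 2 / μ := by field_simp; ring
    have h3 : 0 ≤ 2 * (H - μ) ^ 2 / μ := by positivity
    linarith
  have h3 : Λ ^ 2 + 2 * Λ + 4 ≤ 14 * Λ ^ 2 := by nlinarith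
  have h4 : 1 + L ≤ 3 * L := by linarith
  have h4' : 1 + L ≤ 3 * Λ := by linarith
  have hX : 0 ≤ H ^ 2 / μ := by positivity
  calc _ ≤ (1 + L) * (6 * (H ^ 2 / μ) + μ * (Λ ^ 2 + 2 * Λ + 4)) := by
        refine mul_le_mul_of_nonneg_left ?_ (by linarith)
        linarith
    _ ≤ (1 + L) * (6 * (H ^ 2 / μ) + μ * (14 * Λ ^ 2)) := by
        refine mul_le_mul_of_nonneg_left ?_ (by linarith)
        have := mul_le_mul_of_nonneg_left h3 hμ.le
        linarith
    _ = (1 + L) * (6 * (H ^ 2 / μ)) + (1 + L) * (μ * (14 * Λ ^ 2)) := by ring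
    _ ≤ (3 * L) * (6 * (H ^ 2 / μ)) + (3 * Λ) * (μ * (14 * Λ ^ 2)) := by
        gcongr
    _ ≤ _ := by
        have : 0 ≤ μ * Λ ^ 3 := by
          have : 0 ≤ Λ := by linarith
          positivity
        have e : (3 * L) * (6 * (H ^ 2 / μ)) = 18 * (H ^ 2 * L / μ) := by ring
        rw [e]
        nlinarith

end Regret

/-! ### Cumulative estimation error and properties of the scalarization. -/

section Guarantee

variable {S : Type u} {A : Type v} [Fintype S] [Fintype A] [DecidableEq S] [DecidableEq A]
  [MeasurableSpace S] [MeasurableSpace A] [MeasurableSingletonClass S] [MeasurableSingletonClass A]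
  {H m T : ℕ} {δ : ℝ}

lemma Accurate.optV_init_le {M : MOMDP S A H m} {n : ℕ} {D : Fin n → Traj S A H m}
    (hD : Accurate M T δ D) (i : Fin m) (π : Policy S A H) :
    optV T δ D i π 0 M.init ≤ M.value π i + 2 * ∫ τ, bonusSum T δ D τ ∂(M.episode π) := by
  refine (hD.optV_le i π (Nat.zero_le _) M.init).trans_eq ?_
  rw [← integral_episode_eq_stageValue]
  have e : ∀ τ : Traj S A H m, ∑ h, (M.r i h (τ h).1 (τ h).2.1 +
      2 * bonus T δ D h (τ h).1 (τ h).2.1) =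
      ∑ h, M.r i h (τ h).1 (τ h).2.1 + 2 * bonusSum T δ D τ := by
    intro τ
    rw [Finset.sum_add_distrib, ← Finset.mul_sum, bonusSum]
  simp_rw [e]
  have hb : Integrable (bonusSum T δ D) (M.episode π) := integrable_episode M (bonus T δ D) π
  rw [integral_add (integrable_episode M (M.r i) π) (hb.const_mul 2), integral_const_mul]
  rfl

/-- The excess of each round is at most twice the expected bonus of its policy; on the good event
the expected bonuses are at most the realised ones plus the Azuma term. The bonuses do not depend on
the objective, so one bound serves all. -/
lemma Learner.GoodRecord.sum_optV_sub_value_le {L : Learner S A H m} {M : MOMDP S A H m}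
    {rec : Fin T → Round S A H m} (hrec : L.GoodRecord M δ rec)
    (hℓ : 0 ≤ bonusLog S A H m T δ) (d : Option (Fin m)) (i : Fin m) :
    ∑ n : Fin T, (optV T δ (initial (dataset d rec) n) i (L.policy d n (restrict n.2.le rec)) 0
        M.init - M.value (L.policy d n (restrict n.2.le rec)) i) ≤
      2 * (6 * (H * (Real.sqrt (2 * (H : ℝ) ^ 2 * Fintype.card S * bonusLog S A H m T δ) *
        Real.sqrt (Fintype.card S * Fintype.card A * T))) +
        (H : ℝ) ^ 2 * Real.sqrt (2 * T * bonusLog S A H m T δ)) := by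
  obtain ⟨hacc, hsum⟩ := hrec d
  have h1 := sum_bonus_le hℓ (dataset d rec)
  have h2 : ∑ n : Fin T, (optV T δ (initial (dataset d rec) n) i
      (L.policy d n (restrict n.2.le rec)) 0 M.init -
        M.value (L.policy d n (restrict n.2.le rec)) i) ≤
      ∑ n : Fin T, 2 * L.expectedBonus M T δ d n (restrict n.2.le rec) := by
    refine Finset.sum_le_sum fun n _ => ?_
    rw [sub_le_iff_le_add']
    exact (hacc n).optV_init_le i _
  rw [← Finset.mul_sum] at h2
  rw [Finset.sum_sub_distrib] at hsum
  have h3 : ∑ n : Fin T, bonusSum T δ (initial (dataset d rec) n) (dataset d rec n) ≤ _ := h1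
  linarith

lemma log_two_le_log_of_two_le_card (hA : 2 ≤ Fintype.card A) (hS : 0 < Fintype.card S)
    (hH : 0 < H) (hm : 0 < m) (hT : 0 < T) (hδ : 0 < δ) (hδ1 : δ < 1) :
    Real.log 2 ≤ Real.log ((m : ℝ) * Fintype.card S * Fintype.card A * H * T / δ) := by
  refine Real.log_le_log (by norm_num) ?_
  rw [le_div_iff₀ hδ]
  have : (2 : ℝ) ≤ m * Fintype.card S * Fintype.card A * H * T := by
    have h1 : 2 ≤ m * Fintype.card S * Fintype.card A * H * T := by
      calc 2 ≤ Fintype.card A := hA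
        _ ≤ m * Fintype.card S * Fintype.card A * H * T :=
          Nat.le_of_dvd (by positivity) ⟨m * Fintype.card S * H * T, by ring⟩
    exact_mod_cast h1
  linarith

lemma bonusLog_le (hA : 2 ≤ Fintype.card A) (hS : 0 < Fintype.card S)
    (hH : 0 < H) (hm : 0 < m) (hT : 0 < T) (hδ : 0 < δ) (hδ1 : δ < 1) :
    bonusLog S A H m T δ ≤
      4 * Real.log ((m : ℝ) * Fintype.card S * Fintype.card A * H * T / δ) := by
  have h := log_two_le_log_of_two_le_card (δ := δ) hA hS hH hm hT hδ hδ1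
  have hX : (0 : ℝ) < m * Fintype.card S * Fintype.card A * H * T := by
    have : 0 < Fintype.card A := by omega
    exact_mod_cast (by positivity : 0 < m * Fintype.card S * Fintype.card A * H * T)
  have e : bonusLog S A H m T δ =
      3 * Real.log 2 + Real.log ((m : ℝ) * Fintype.card S * Fintype.card A * H * T / δ) := by
    rw [bonusLog, show (8 : ℝ) * m * Fintype.card S * Fintype.card A * H * T / δ =
      2 ^ 3 * (m * Fintype.card S * Fintype.card A * H * T / δ) by ring,
      Real.log_mul (by norm_num) (by positivity), Real.log_pow]
    norm_num
  linarith

/-- Both roots are at most `3` times the target scale, as `2 * 4 ≤ 9`; hence `2 (6 * 3 + 3) = 42`.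
-/
lemma estimation_bound_le {h s a t ℓ ϱ : ℝ} (hh : 0 ≤ h) (hs : 1 ≤ s) (ha : 1 ≤ a) (ht : 0 ≤ t)
    (hℓ0 : 0 ≤ ℓ) (hℓ : ℓ ≤ 4 * ϱ) :
    2 * (6 * (h * (Real.sqrt (2 * h ^ 2 * s * ℓ) * Real.sqrt (s * a * t))) +
      h ^ 2 * Real.sqrt (2 * t * ℓ)) ≤ 42 * (h ^ 2 * s * Real.sqrt (a * ϱ * t)) := by
  have hϱ : 0 ≤ ϱ := by linarith
  set R := Real.sqrt (a * ϱ * t) with hR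
  have hR0 : 0 ≤ R := Real.sqrt_nonneg _
  have hRsq : R ^ 2 = a * ϱ * t := Real.sq_sqrt (by positivity)
  have h1 : Real.sqrt (2 * h ^ 2 * s * ℓ) * Real.sqrt (s * a * t) ≤ 3 * (h * s * R) := by
    rw [← Real.sqrt_mul (by positivity)]
    refine Real.sqrt_le_iff.2 ⟨by positivity, ?_⟩
    have e : (3 * (h * s * R)) ^ 2 = 9 * (h ^ 2 * s ^ 2 * (a * ϱ * t)) := by rw [← hRsq]; ring
    rw [e]
    have : h ^ 2 * s ^ 2 * a * t * ℓ ≤ h ^ 2 * s ^ 2 * a * t * (4 * ϱ) := by gcongr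
    have : 0 ≤ h ^ 2 * s ^ 2 * (a * ϱ * t) := by positivity
    nlinarith
  have h2 : Real.sqrt (2 * t * ℓ) ≤ 3 * (s * R) := by
    refine Real.sqrt_le_iff.2 ⟨by positivity, ?_⟩
    have e : (3 * (s * R)) ^ 2 = 9 * (s ^ 2 * (a * ϱ * t)) := by rw [← hRsq]; ring
    rw [e]
    have g1 : t * ℓ ≤ t * (4 * ϱ) := by gcongr
    have g2 : 1 * (ϱ * t) ≤ (s ^ 2 * a) * (ϱ * t) :=
      mul_le_mul_of_nonneg_right (by nlinarith [one_le_pow₀ hs (n := 2)]) (by positivity)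
    have : 0 ≤ ϱ * t := by positivity
    nlinarith
  have h3 := mul_le_mul_of_nonneg_left h1 hh
  have h4 := mul_le_mul_of_nonneg_left h2 (sq_nonneg h)
  nlinarith

/-- Since `λ_i ≤ 1`, lowering the values by at most `c` multiplies every exponential by at most `exp
(c / μ)`. -/
lemma MOMDP.stch_le_add (M : MOMDP S A H m) (hm : 0 < m) (lam : stdSimplex ℝ (Fin m)) (ι : ℝ)
    {μ c : ℝ} (hμ : 0 < μ) (hc : 0 ≤ c) {v v' : Fin m → ℝ} (h : ∀ i, v' i ≤ v i + c) :
    M.stch lam ι μ v ≤ M.stch lam ι μ v' + c := by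
  have : Nonempty (Fin m) := ⟨⟨0, hm⟩⟩
  unfold MOMDP.stch
  have h1 : ∑ i, Real.exp ((lam : Fin m → ℝ) i * (M.optValue i + ι - v i) / μ) ≤
      (∑ i, Real.exp ((lam : Fin m → ℝ) i * (M.optValue i + ι - v' i) / μ)) *
        Real.exp (c / μ) := by
    rw [Finset.sum_mul]
    refine Finset.sum_le_sum fun i _ => ?_
    rw [← Real.exp_add, ← add_div]
    gcongr
    have h2 := mul_le_mul_of_nonneg_left (h i) (stdSimplex.zero_le lam i)
    have h3 := mul_le_of_le_one_left hc (stdSimplex.le_one lam i)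
    linarith
  have h2 := Real.log_le_log (sum_exp_pos _) h1
  rw [Real.log_mul (sum_exp_pos _).ne' (Real.exp_pos _).ne', Real.log_exp] at h2
  have h3 := mul_le_mul_of_nonneg_left h2 hμ.le
  rw [mul_add, mul_div_cancel₀ _ hμ.ne'] at h3
  exact h3

lemma entReg_sub_entReg {ι : Type*} [Fintype ι] (μ : ℝ) (x y p : ι → ℝ) :
    entReg μ x p - entReg μ y p = ∑ i, p i * (x i - y i) := by
  rw [entReg, entReg, ← Finset.sum_sub_distrib]
  exact Finset.sum_congr rfl fun i _ => by ring

lemma entReg_sum_div {ι : Type*} [Fintype ι] (μ : ℝ) {T : ℕ} (hT : 0 < T) (x : ℕ → ι → ℝ)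
    (p : ι → ℝ) : T * entReg μ (fun i => (∑ n ∈ Finset.range T, x n i) / T) p =
      ∑ n ∈ Finset.range T, entReg μ (x n) p := by
  have hT' : (T : ℝ) ≠ 0 := Nat.cast_ne_zero.2 hT.ne'
  simp_rw [entReg]
  rw [Finset.sum_comm, Finset.mul_sum]
  refine Finset.sum_congr rfl fun i _ => ?_
  rw [← Finset.mul_sum, Finset.sum_sub_distrib, Finset.sum_const, Finset.card_range, nsmul_eq_mul]
  field_simp

end Guarantee

/-! ### The game argument on the good event. -/

section Guarantee

variable {S : Type u} {A : Type v} [Fintype S] [Fintype A] [DecidableEq S] [DecidableEq A]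
  [MeasurableSpace S] [MeasurableSpace A] [MeasurableSingletonClass S] [MeasurableSingletonClass A]
  {H m T : ℕ} {δ : ℝ}

/-- On the good event the suboptimality of the mixture is bounded by the regret of the weights and
the estimation errors of the optimistic values. -/
lemma stch_mixValue_sub_le [Nonempty A] (hm : 0 < m) (hT : 0 < T)
    {M : MOMDP S A H m} {lam : stdSimplex ℝ (Fin m)} {ι μ : ℝ} (hH : 0 < H) (hι : 0 < ι)
    (hι1 : ι ≤ 1) (hμ : 0 < μ) {L : Learner S A H m}
    (hL : L.IsSTchRL M.init T δ (lam : Fin m → ℝ) ι μ (stepSize μ) mixRate)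
    (π' : Policy S A H) {rec : Fin T → Round S A H m} (hrec : L.GoodRecord M δ rec) {E : ℝ}
    (hE : ∀ d i, ∑ n : Fin T, (optV T δ (initial (dataset d rec) n) i
      (L.policy d n (restrict n.2.le rec)) 0 M.init -
        M.value (L.policy d n (restrict n.2.le rec)) i) ≤ E) (hE0 : 0 ≤ E) :
    T * (M.stch lam ι μ (M.mixValue (L.played rec)) - M.stch lam ι μ (M.value π')) ≤
      (1 + Real.log T) * ((2 * (2 * H) + 2 * μ * Real.log (m * T)) ^ 2 / (8 * μ) + μ +
        2 * (2 * H) + μ * (2 * Real.log (m * T) + 1)) + 2 * E := by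
  have : Nonempty (Fin m) := ⟨⟨0, hm⟩⟩
  have hT' : (T : ℝ) ≠ 0 := Nat.cast_ne_zero.2 hT.ne'
  have hlam0 : ∀ i, 0 ≤ (lam : Fin m → ℝ) i := fun i => stdSimplex.zero_le lam i
  have hlam1 : ∀ i, (lam : Fin m → ℝ) i ≤ 1 := fun i => stdSimplex.le_one lam i
  have hlamsum : ∑ i, (lam : Fin m → ℝ) i = 1 := stdSimplex.sum_eq_one lam
  -- The record is prolonged arbitrarily so that weights and payoffs become sequences on `ℕ`; after
  -- round `T` only the boundedness of the payoffs is needed, which holds for every record.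
  let rec' : ℕ → Round S A H m := fun n => if h : n < T then rec ⟨n, h⟩ else rec ⟨0, hT⟩
  let past : (n : ℕ) → Fin n → Round S A H m := fun n j => rec' j
  have hpast : ∀ n (hn : n ≤ T), restrict hn rec = past n := by
    intro n hn
    funext j
    have : (j : ℕ) < T := j.2.trans_le hn
    simp only [past, rec', dif_pos this]
    rfl
  let W : ℕ → Fin m → ℝ := fun n =>
    L.weights M.init T δ (lam : Fin m → ℝ) ι μ (stepSize μ) mixRate n (past n)
  let aV : ℕ → Fin m → ℝ := fun n i => L.auxV M.init T δ n (past n) i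
  let mV : ℕ → Fin m → ℝ := fun n i => L.mainV M.init T δ n (past n) i
  let g : ℕ → Fin m → ℝ := fun n i => aV n i + ι - mV n i
  let val : ℕ → Fin m → ℝ := fun n i => M.value (L.main n (past n)) i
  have hW0 : IsPosProb (W 0) := by
    have := isPosProb_ascend_zero hm μ (lam : Fin m → ℝ) (fun _ => 0 + ι - 0)
    simpa [W, Learner.weights, stepSize, mixRate] using this
  have hW : ∀ n, W (n + 1) = ascend μ (stepSize μ (n + 1)) (lam : Fin m → ℝ)
      (mixWeights (mixRate (n + 1)) (W n)) (g n) := fun n => rfl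
  have hWpos := isPosProb_of_ascend hm hW0 hW
  have hH1 : (1 : ℝ) ≤ H := Nat.one_le_cast.2 hH
  -- Optimistic values lie in `[0, H]`, so the gap is at most `H + ι ≤ 2 H` in absolute value.
  have hB : ∀ n i, |(lam : Fin m → ℝ) i * g n i| ≤ 2 * H := by
    intro n i
    have h1 : aV n i ∈ Set.Icc (0 : ℝ) (H - (0 : ℕ)) := optV_mem_Icc _ _ _ (Nat.zero_le _) _
    have h2 : mV n i ∈ Set.Icc (0 : ℝ) (H - (0 : ℕ)) := optV_mem_Icc _ _ _ (Nat.zero_le _) _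
    simp only [Nat.cast_zero, sub_zero] at h1 h2
    rw [abs_mul, abs_of_nonneg (hlam0 i)]
    refine (mul_le_of_le_one_left (abs_nonneg _) (hlam1 i)).trans (abs_le.2 ⟨?_, ?_⟩)
    · simp only [g]; linarith [h1.1, h2.2]
    · simp only [g]; linarith [h1.2, h2.1]
  have hacc : ∀ d n, n < T → Accurate M T δ (dataset d (past n)) := by
    intro d n hn
    have := (hrec d).1 ⟨n, hn⟩
    rw [← hpast n hn.le]
    exact this
  have hmain : ∀ n < T, ∑ i, W n i * (lam : Fin m → ℝ) i * M.value π' i ≤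
      ∑ i, W n i * (lam : Fin m → ℝ) i * mV n i := by
    intro n hn
    simp_rw [M.value_eq_stageValue]
    exact (hacc none n hn).sum_stageValue_le
      (fun i => mul_nonneg ((hWpos n).pos i).le (hlam0 i)) (hL.main_greedy n (past n)) π'
      (Nat.zero_le _) M.init
  have haux : ∀ n < T, ∀ i, M.optValue i ≤ aV n i := by
    intro n hn i
    refine ciSup_le fun π => ?_
    have h0 : ∀ j, 0 ≤ (Pi.single i (1 : ℝ) : Fin m → ℝ) j := by
      intro j
      by_cases hj : j = i
      · subst hj; simp
      · simp [hj]
    have hsingle : ∀ f : Fin m → ℝ, ∑ j, (Pi.single i (1 : ℝ) : Fin m → ℝ) j * f j = f i := by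
      intro f
      simp [Pi.single_apply]
    -- A single objective is the combination whose coefficients are concentrated at `i`.
    have := (hacc (some i) n hn).sum_stageValue_le (c := Pi.single i 1) (π := L.aux n (past n) i)
      h0 (fun h s p => by
        simp only [hsingle]
        exact hL.aux_greedy n (past n) i h s p) π (Nat.zero_le _) M.init
    rw [M.value_eq_stageValue]
    rw [hsingle, hsingle] at this
    exact this
  have hEmain : ∀ i, ∑ n ∈ Finset.range T, (mV n i - val n i) ≤ E := by
    intro i
    refine le_of_eq_of_le ?_ (hE none i)
    rw [Finset.sum_range]
    refine Finset.sum_congr rfl fun n _ => ?_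
    rw [hpast n n.2.le]
    simp only [mV, val, ← hpast n n.2.le]
    rfl
  have hEaux : ∀ i, ∑ n ∈ Finset.range T, (aV n i - M.optValue i) ≤ E := by
    intro i
    refine le_trans ?_ (hE (some i) i)
    rw [Finset.sum_range]
    refine Finset.sum_le_sum fun n _ => ?_
    have h1 : aV n i = optV T δ (initial (dataset (some i) rec) n) i
        (L.policy (some i) n (restrict n.2.le rec)) 0 M.init := by
      simp only [aV, ← hpast n n.2.le]
      rfl
    rw [h1]
    exact sub_le_sub_left (M.value_le_optValue _ i) _
  -- The maximiser for the mixture depends on the whole record, which is allowed because the regret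
  -- bound is deterministic and holds for every `p`.
  set p : Fin m → ℝ := softmax μ (fun i =>
    (lam : Fin m → ℝ) i * (M.optValue i + ι - M.mixValue (L.played rec) i)) with hp
  have hpp : IsPosProb p := isPosProb_softmax _ _
  have hmix : ∀ i, M.mixValue (L.played rec) i = (∑ n ∈ Finset.range T, val n i) / T := by
    intro i
    rw [M.mixValue_eq, Finset.sum_range]
    congr 1
    refine Finset.sum_congr rfl fun n _ => ?_
    simp only [val, ← hpast n n.2.le]
    rfl
  have hstch : T * M.stch lam ι μ (M.mixValue (L.played rec)) = ∑ n ∈ Finset.range T,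
      entReg μ (fun i => (lam : Fin m → ℝ) i * (M.optValue i + ι - val n i)) p := by
    have h1 : M.stch lam ι μ (M.mixValue (L.played rec)) = entReg μ (fun i =>
        (lam : Fin m → ℝ) i * (M.optValue i + ι - M.mixValue (L.played rec) i)) p :=
      (entReg_softmax hμ _).symm
    rw [h1, ← entReg_sum_div μ hT]
    congr 3
    funext i
    rw [hmix, ← Finset.mul_sum, Finset.sum_sub_distrib, Finset.sum_const, Finset.card_range,
      nsmul_eq_mul]
    field_simp
  have hreg := sum_entReg_sub_le hm hμ hT hW0 hW hB hpp
  have hcmp : ∀ n ∈ Finset.range T,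
      entReg μ (fun i => (lam : Fin m → ℝ) i * (M.optValue i + ι - val n i)) p ≤
        entReg μ (fun i => (lam : Fin m → ℝ) i * g n i) p +
          ∑ i, p i * (lam : Fin m → ℝ) i * (mV n i - val n i) := by
    intro n hn
    rw [← sub_le_iff_le_add', entReg_sub_entReg]
    refine Finset.sum_le_sum fun i _ => ?_
    rw [mul_assoc, ← mul_sub]
    refine mul_le_mul_of_nonneg_left (mul_le_mul_of_nonneg_left ?_ (hlam0 i)) (hpp.pos i).le
    have := haux n (Finset.mem_range.1 hn) i
    simp only [g]
    linarith
  have hopt : ∀ n ∈ Finset.range T, entReg μ (fun i => (lam : Fin m → ℝ) i * g n i) (W n) ≤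
      M.stch lam ι μ (M.value π') + ∑ i, (lam : Fin m → ℝ) i * (aV n i - M.optValue i) := by
    intro n hn
    have hn' := Finset.mem_range.1 hn
    have h1 : entReg μ (fun i => (lam : Fin m → ℝ) i * (M.optValue i + ι - M.value π' i)) (W n) ≤
      M.stch lam ι μ (M.value π') := entReg_le_logSumExp hμ _ (hWpos n)
    have h2 := entReg_sub_entReg μ (fun i => (lam : Fin m → ℝ) i * g n i)
      (fun i => (lam : Fin m → ℝ) i * (M.optValue i + ι - M.value π' i)) (W n)
    have h3 : ∑ i, W n i * ((lam : Fin m → ℝ) i * g n i -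
        (lam : Fin m → ℝ) i * (M.optValue i + ι - M.value π' i)) =
        ∑ i, W n i * ((lam : Fin m → ℝ) i * (aV n i - M.optValue i)) +
        (∑ i, W n i * (lam : Fin m → ℝ) i * M.value π' i -
          ∑ i, W n i * (lam : Fin m → ℝ) i * mV n i) := by
      rw [← Finset.sum_sub_distrib, ← Finset.sum_add_distrib]
      refine Finset.sum_congr rfl fun i _ => ?_
      simp only [g]
      ring
    -- The weights change with the round. Optimism makes the errors nonnegative, so the weights can
    -- be replaced by `1` before the errors of each objective are summed over the rounds.
    have h4 : ∑ i, W n i * ((lam : Fin m → ℝ) i * (aV n i - M.optValue i)) ≤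
        ∑ i, (lam : Fin m → ℝ) i * (aV n i - M.optValue i) :=
      Finset.sum_le_sum fun i _ => mul_le_of_le_one_left
        (mul_nonneg (hlam0 i) (sub_nonneg.2 (haux n hn' i))) ((hWpos n).le_one i)
    have h5 := hmain n hn'
    linarith
  have hsum1 : ∑ n ∈ Finset.range T, ∑ i, p i * (lam : Fin m → ℝ) i * (mV n i - val n i) ≤ E := by
    rw [Finset.sum_comm]
    calc _ ≤ ∑ i, (lam : Fin m → ℝ) i * E := by
          refine Finset.sum_le_sum fun i _ => ?_
          rw [← Finset.mul_sum]
          refine (mul_le_mul_of_nonneg_left (hEmain i)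
            (mul_nonneg (hpp.pos i).le (hlam0 i))).trans ?_
          exact mul_le_mul_of_nonneg_right (mul_le_of_le_one_left (hlam0 i) (hpp.le_one i)) hE0
      _ = E := by rw [← Finset.sum_mul, hlamsum, one_mul]
  have hsum2 : ∑ n ∈ Finset.range T, ∑ i, (lam : Fin m → ℝ) i * (aV n i - M.optValue i) ≤ E := by
    rw [Finset.sum_comm]
    calc _ ≤ ∑ i, (lam : Fin m → ℝ) i * E := by
          refine Finset.sum_le_sum fun i _ => ?_
          rw [← Finset.mul_sum]
          exact mul_le_mul_of_nonneg_left (hEaux i) (hlam0 i)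
      _ = E := by rw [← Finset.sum_mul, hlamsum, one_mul]
  have hs1 := Finset.sum_le_sum hcmp
  have hs2 := Finset.sum_le_sum hopt
  rw [Finset.sum_add_distrib] at hs1 hs2
  rw [Finset.sum_const, Finset.card_range, nsmul_eq_mul] at hs2
  rw [Finset.sum_sub_distrib] at hreg
  rw [mul_sub, hstch]
  linarith

end Guarantee

end MORL

/-! ### Assembly and degenerate cases. -/

theorem theorem3 :
    ∃ C : ℝ, 0 < C ∧
      ∀ (S : Type u) (A : Type v) [Fintype S] [Fintype A] [DecidableEq S] [DecidableEq A]
        [MeasurableSpace S] [MeasurableSpace A] [MeasurableSingletonClass S]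
        [MeasurableSingletonClass A] [Nonempty A] (H m T : ℕ) (_ : 1 ≤ H) (_ : 1 ≤ m) (_ : 1 ≤ T)
        (M : MORL.MOMDP S A H m) (lam : stdSimplex ℝ (Fin m)) (ι μ δ : ℝ)
        (_ : 0 < ι) (_ : ι ≤ 1) (_ : 0 < μ) (_ : 0 < δ) (_ : δ < 1)
        (L : MORL.Learner S A H m)
        (_ : L.IsSTchRL M.init T δ (lam : Fin m → ℝ) ι μ (MORL.stepSize μ) MORL.mixRate)
        (πstar : MORL.Policy S A H)
        (_ : ∀ π : MORL.Policy S A H,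
          M.stch lam ι μ (M.value πstar) ≤ M.stch lam ι μ (M.value π)),
        ENNReal.ofReal (1 - δ) ≤
          L.run M T {rec : Fin T → MORL.Round S A H m |
            M.stch lam ι μ (M.mixValue (L.played rec)) - M.stch lam ι μ (M.value πstar) ≤
              C * ((H : ℝ) ^ 2 * Real.log T / (μ * T)
                + μ * Real.log ((m : ℝ) * T) ^ 3 / T
                + Real.sqrt ((H : ℝ) ^ 4 * (Fintype.card S : ℝ) ^ 2 * Fintype.card A *
                    Real.log ((m : ℝ) * Fintype.card S * Fintype.card A * H * T / δ) / T))} := by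
  -- The estimation error `42` is paid twice, for the main and the auxiliary policies; the regret
  -- constants `18` and `60` are smaller.
  refine ⟨84, by norm_num, ?_⟩
  intro S A _ _ _ _ _ _ _ _ _ H m T hH hm hT M lam ι μ δ hι hι1 hμ hδ hδ1 L hL πstar _
  have h₁ := hL.measurable_main
  have h₂ := hL.measurable_aux
  have hprob := MORL.isProbabilityMeasure_run M h₁ h₂ T
  have hS : 0 < Fintype.card S := Fintype.card_pos_iff.2 ⟨M.init⟩
  have hA : 0 < Fintype.card A := Fintype.card_pos
  have hT1 : (1 : ℝ) ≤ T := Nat.one_le_cast.2 hT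
  have hT0 : (0 : ℝ) < T := by linarith
  have hm1 : (1 : ℝ) ≤ m := Nat.one_le_cast.2 hm
  have hH1 : (1 : ℝ) ≤ H := Nat.one_le_cast.2 hH
  have hS1 : (1 : ℝ) ≤ Fintype.card S := Nat.one_le_cast.2 hS
  have hA1 : (1 : ℝ) ≤ Fintype.card A := Nat.one_le_cast.2 hA
  have hlogT : 0 ≤ Real.log T := Real.log_nonneg hT1
  have hlogmT : 0 ≤ Real.log ((m : ℝ) * T) := Real.log_nonneg (by nlinarith)
  set ϱ := Real.log ((m : ℝ) * Fintype.card S * Fintype.card A * H * T / δ) with hϱ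
  have hX1 : 0 ≤ (H : ℝ) ^ 2 * Real.log T / (μ * T) := by positivity
  have hX2 : 0 ≤ μ * Real.log ((m : ℝ) * T) ^ 3 / T := by positivity
  have hgood : ENNReal.ofReal (1 - δ) ≤ L.run M T {rec | L.GoodRecord M δ rec} := by
    have h1 := MORL.run_not_goodRecord_le M h₁ h₂ hT hH hm hA hδ hδ1
    -- Subadditivity suffices here, so the good event need not be shown measurable.
    have h2 : (1 : ENNReal) ≤ L.run M T {rec | L.GoodRecord M δ rec} +
        L.run M T {rec | ¬ L.GoodRecord M δ rec} := by
      rw [← measure_univ (μ := L.run M T)]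
      refine le_trans (measure_mono fun rec _ => ?_) (measure_union_le _ _)
      exact em _
    rw [ENNReal.ofReal_sub _ hδ.le, ENNReal.ofReal_one]
    exact tsub_le_iff_right.2 (h2.trans (add_le_add le_rfl h1))
  refine hgood.trans (measure_mono fun rec hrec => ?_)
  change M.stch lam ι μ (M.mixValue (L.played rec)) - M.stch lam ι μ (M.value πstar) ≤ _
  rcases Nat.lt_or_ge (Fintype.card A) 2 with hA2 | hA2
  -- With one action `ϱ` can be arbitrarily close to zero and cannot absorb the `log 8` of the
  -- bonuses; but then all policies coincide and the left side vanishes.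
  · have : Subsingleton A := Fintype.card_le_one_iff_subsingleton.1 (by omega)
    have hv : M.mixValue (L.played rec) = M.value πstar := by
      funext i
      rw [M.mixValue_eq]
      have : ∀ t, L.played rec t = πstar := fun t => Subsingleton.elim _ _
      simp only [this, Finset.sum_const, Finset.card_univ, Fintype.card_fin, nsmul_eq_mul]
      field_simp
    rw [hv, sub_self]
    have := Real.sqrt_nonneg ((H : ℝ) ^ 4 * (Fintype.card S : ℝ) ^ 2 * Fintype.card A * ϱ / T)
    positivity
  have hϱ2 : Real.log 2 ≤ ϱ := MORL.log_two_le_log_of_two_le_card hA2 hS hH hm hT hδ hδ1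
  have hlog2 := Real.log_two_gt_d9
  have hsqrt : Real.sqrt ((H : ℝ) ^ 4 * (Fintype.card S : ℝ) ^ 2 * Fintype.card A * ϱ / T) =
      (H : ℝ) ^ 2 * Fintype.card S * Real.sqrt (Fintype.card A * ϱ * T) / T := by
    have e : (H : ℝ) ^ 4 * (Fintype.card S : ℝ) ^ 2 * Fintype.card A * ϱ / T =
        ((H : ℝ) ^ 2 * Fintype.card S / T) ^ 2 * (Fintype.card A * ϱ * T) := by
      field_simp
    rw [e, Real.sqrt_mul (sq_nonneg _), Real.sqrt_sq (by positivity)]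
    ring
  rw [hsqrt]
  rcases Nat.lt_or_ge T 2 with hT2 | hT2
  -- For one round `log T = 0` cannot absorb constants. The suboptimality is at most `H` because all
  -- values lie in `[0, H]`, and the square-root term is already at least `H / 2`.
  · obtain rfl : T = 1 := by omega
    have h1 := M.stch_le_add hm lam ι hμ (c := H) (by linarith)
      (v := M.mixValue (L.played rec)) (v' := M.value πstar) (fun i => by
        have h2 := (M.value_mem_Icc πstar i).2
        have h3 : 0 ≤ M.mixValue (L.played rec) i := by
          rw [M.mixValue_eq]
          exact div_nonneg (Finset.sum_nonneg fun t _ => (M.value_mem_Icc _ i).1) hT0.le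
        linarith)
    have h4 : (1 / 2 : ℝ) ≤ Real.sqrt (Fintype.card A * ϱ * (1 : ℕ)) := by
      refine Real.le_sqrt_of_sq_le ?_
      push_cast
      nlinarith
    have h5 : (H : ℝ) ≤ H ^ 2 * Fintype.card S := by nlinarith
    have h6 : (H : ℝ) * (1 / 2) ≤
        H ^ 2 * Fintype.card S * Real.sqrt (Fintype.card A * ϱ * (1 : ℕ)) := by gcongr
    have h7 : (H : ℝ) ^ 2 * Fintype.card S * Real.sqrt (Fintype.card A * ϱ * (1 : ℕ)) / (1 : ℕ) =
      (H : ℝ) ^ 2 * Fintype.card S * Real.sqrt (Fintype.card A * ϱ * (1 : ℕ)) := by simp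
    rw [h7]
    linarith
  have hℓ := MORL.one_le_bonusLog hS hA hH hm hT hδ hδ1
  have hℓϱ := MORL.bonusLog_le hA2 hS hH hm hT hδ hδ1
  have hest : ∀ d i, _ ≤ 42 * ((H : ℝ) ^ 2 * Fintype.card S * Real.sqrt (Fintype.card A * ϱ * T)) :=
    fun d i => (MORL.Learner.GoodRecord.sum_optV_sub_value_le hrec (by linarith) d i).trans
      (MORL.estimation_bound_le (by linarith) hS1 hA1 hT0.le (by linarith) hℓϱ)
  have hmain := MORL.stch_mixValue_sub_le hm hT hH hι hι1 hμ hL πstar hrec hest (by positivity)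
  have hreg := MORL.regret_bound_le (μ := μ) (H := H) (L := Real.log T)
    (Λ := Real.log ((m : ℝ) * T)) hμ
    (Real.log_le_log (by norm_num) (by exact_mod_cast hT2))
    (Real.log_le_log hT0 (by nlinarith))
  have hfin := hmain.trans (add_le_add hreg le_rfl)
  rw [mul_comm, ← le_div_iff₀ hT0] at hfin
  refine hfin.trans ?_
  have e : (18 * ((H : ℝ) ^ 2 * Real.log T / μ) + 60 * (μ * Real.log ((m : ℝ) * T) ^ 3) +
      2 * (42 * ((H : ℝ) ^ 2 * Fintype.card S * Real.sqrt (Fintype.card A * ϱ * T)))) / T =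
      18 * ((H : ℝ) ^ 2 * Real.log T / (μ * T)) + 60 * (μ * Real.log ((m : ℝ) * T) ^ 3 / T) +
      84 * ((H : ℝ) ^ 2 * Fintype.card S * Real.sqrt (Fintype.card A * ϱ * T) / T) := by
    field_simp
    ring
  rw [e]
  linarith
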